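/- **Conventions.** Let $A$ be a closed oriented annulus and $I=[0,1]$. An oriented annular link $(L,o)\subset A\times I$ is given by an oriented link diagram $\mathcal P$ in $A$, viewed in $S^2\setminus\{\mathbb X,\mathbb O\}$, where $\mathbb X$ and $\mathbb O$ are base points in the discs bounded by the inner and the outer boundary circle of $A$. The empty link is allowed. *Lee complex.* Let $\mathcal C$ be the complex vector space whose distinguished basis consists of the complete resolutions of $\mathcal P$ with every circle labelled $v_+$ or $v_-$. The differential $\partial^{Lee}$ is the signed sum, over all changes of one $0$-smoothing into a $1$-smoothing, of the merge and split maps $$m:\ v_+v_+\mapsto v_+,\quad v_+v_-,\,v_-v_+\mapsto v_-,\quad v_-v_-\mapsto v_+,$$ $$\Delta:\ v_+\mapsto v_+\otimes v_-+v_-\otimes v_+,\quad v_-\mapsto v_-\otimes v_-+v_+\otimes v_+ ,$$ where the sign is $-1$ to the number of $1$-smoothings at earlier crossings. *Gradings.* For a basis element $\mathbf x$ let $$j(\mathbf x)=\#\{v_+\}-\#\{v_-\}+\#\{1\text{-smoothings}\}+n_+-2n_-,$$ where $n_\pm$ is the number of positive/negative crossings. Let $k(\mathbf x)$ be the sum,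 over the circles that meet an arc from $\mathbb X$ to $\mathbb O$ in an odd number of points, of $+1$ for a label $v_+$ and $-1$ for a label $v_-$. For $t\in[0,2]$ put $j_t=j-t\,k$ and $\mathcal F^t_s=\mathrm{Span}\{\mathbf x : j_t(\mathbf x)\ge s\}$. For a chain $x\ne0$ let $\mathrm{gr}_{j_t}(x)=\max\{s : x\in\mathcal F^t_s\}$, and for a homology class $\eta\neq 0$ let $\mathrm{gr}_{j_t}(\eta)=\max\{\mathrm{gr}_{j_t}(x) : [x]=\eta\}$. *Canonical class.* The canonical Lee cycle $\mathfrak s_o$ is the oriented resolution of $\mathcal P$ with each circle $C$ labelled by $\mathbf a=v_-+v_+$ or $\mathbf b=v_--v_+$, according as the number of circles separating $C$ from $\mathbb O$, plus $1$ if $C$ is oriented counterclockwise, is even or odd. The annular Rasmussen invariant is $$d_t(L,o)=\mathrm{gr}_{j_t}([\mathfrak s_o])\in\mathbb R\qquad(t\in[0,2]),$$ computed from any diagram of $(L,o)$, and its slope is $$m_t(L,o)=\lim_{\epsilon\to0^+}\frac{d_{t+\epsilon}(L,o)-d_t(L,o)}{\epsilon}\qquad(t\in[0,2)).$$ *Annular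 composition.* A diagram of $(L,o)\amalg(L',o')$ is obtained from diagrams of $(L,o)$ and $(L',o')$ by identifying the inner boundary of the annulus containing the diagram of $L$ with the outer boundary of the annulus containing the diagram of $L'$, keeping the orientations. **Proposition.** Let $(L,o),(L',o')\subset A\times I$ be oriented annular links, given by arbitrary diagrams, and let $(L,o)\amalg(L',o')$ be their annular composition, with the diagram just described. Then for all $t\in[0,2]$ the maxima defining $d_t$ of $(L,o)$, $(L',o')$ and $(L,o)\amalg(L',o')$ exist, and $$d_t\big((L,o)\amalg(L',o')\big)=d_t(L,o)+d_t(L',o').$$ Moreover, for all $t\in[0,2)$ the slopes exist and $$m_t\big((L,o)\amalg(L',o')\big)=m_t(L,o)+m_t(L',o').$$ -/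

import Mathlib

open Set Filter Topology

/-!
Oriented annular link diagrams, in general position with respect to the angular coordinate.

The annulus is swept counterclockwise by a radial arc running from the inner basepoint `X` to the
outer basepoint `O`.  Between finitely many angles the arc meets the diagram in finitely many
strands; these are listed from left to right, i.e. from the innermost to the outermost one, and each
is recorded by its direction: `true` if it runs counterclockwise around `X` (upwards, when the angle
is drawn vertically), `false` if it runs clockwise (downwards).  At finitely many angles one of the
following elementary events occurs.  Up to planar isotopy in the annulus every diagram of an
oriented annular link has this form.
-/

/-- An elementary event between two consecutive positions of the sweeping arc.
* `birth i b` : a local minimum of the angle, creating two adjacent strands in positions `i`,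
  `i + 1`, with directions `b` and `!b`;
* `death i` : a local maximum of the angle, joining the strands in positions `i`, `i + 1`;
* `cross i s` : a crossing of the strands in positions `i`, `i + 1`.  If `s = true`, the strand going
  from the lower left (inner) to the upper right (outer) is the overcrossing one; if `s = false`,
  the strand going from the lower right to the upper left is. -/
inductive AnnularEvent where
  | birth (i : ℕ) (b : Bool)
  | death (i : ℕ)
  | cross (i : ℕ) (s : Bool)

namespace AnnularEvent

/-- The position of the left strand that takes part in the event. -/
def pos : AnnularEvent → ℕ
  | birth i _ => i
  | death i => i
  | cross i _ => i

/-- For a crossing: is the strand from lower left to upper right the overcrossing strand? -/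
def risingOver : AnnularEvent → Bool
  | cross _ s => s
  | _ => false

/-- Is the event a crossing? -/
def IsCross : AnnularEvent → Prop
  | cross _ _ => True
  | _ => False

/-- The event can happen to the given list of oriented strands (for a death, the two strands must
have opposite directions, so that orientations match). -/
def Valid : AnnularEvent → List Bool → Prop
  | birth i _, l => i ≤ l.length
  | death i, l => ∃ b, l[i]? = some b ∧ l[i + 1]? = some (!b)
  | cross i _, l => i + 1 < l.length

/-- The oriented strands after the event. -/
def apply : AnnularEvent → List Bool → List Bool
  | birth i b, l => l.take i ++ b :: (!b) :: l.drop i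
  | death i, l => l.take i ++ l.drop (i + 2)
  | cross i _, l => l.take i ++ (((l.drop i).take 2).reverse ++ l.drop (i + 2))

/-- The same event, happening `n` positions further out. -/
def shift (n : ℕ) : AnnularEvent → AnnularEvent
  | birth i b => birth (n + i) b
  | death i => death (n + i)
  | cross i s => cross (n + i) s

theorem Valid.append_right {e : AnnularEvent} {l : List Bool} (h : e.Valid l) (r : List Bool) :
    e.Valid (l ++ r) := by
  cases e with
  | birth i b => simp only [Valid, List.length_append] at *; omega
  | death i =>
    obtain ⟨b, h1, h2⟩ := h
    refine ⟨b, ?_, ?_⟩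
    · rw [List.getElem?_append_left (List.getElem?_eq_some_iff.1 h1).1, h1]
    · rw [List.getElem?_append_left (List.getElem?_eq_some_iff.1 h2).1, h2]
  | cross i s => simp only [Valid, List.length_append] at *; omega

theorem apply_append_right {e : AnnularEvent} {l : List Bool} (h : e.Valid l) (r : List Bool) :
    e.apply (l ++ r) = e.apply l ++ r := by
  cases e with
  | birth i b =>
    simp only [Valid] at h
    simp [apply, List.take_append_of_le_length h, List.drop_append_of_le_length h]
  | death i =>
    obtain ⟨b, h1, h2⟩ := h
    have h3 := (List.getElem?_eq_some_iff.1 h2).1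
    simp [apply, List.take_append_of_le_length (show i ≤ l.length by omega),
      List.drop_append_of_le_length (show i + 2 ≤ l.length by omega)]
  | cross i s =>
    simp only [Valid] at h
    simp [apply, List.take_append_of_le_length (show i ≤ l.length by omega),
      List.drop_append_of_le_length (show i ≤ l.length by omega),
      List.drop_append_of_le_length (show i + 2 ≤ l.length by omega),
      List.take_append_of_le_length (show 2 ≤ (l.drop i).length by rw [List.length_drop]; omega)]

theorem Valid.shift {e : AnnularEvent} {r : List Bool} (h : e.Valid r) (l : List Bool) :
    (e.shift l.length).Valid (l ++ r) := by
  cases e with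
  | birth i b => simp only [AnnularEvent.shift, Valid, List.length_append] at *; omega
  | death i =>
    obtain ⟨b, h1, h2⟩ := h
    refine ⟨b, ?_, ?_⟩
    · rw [List.getElem?_append_right (by omega), ← h1]; congr 1; omega
    · rw [List.getElem?_append_right (by omega), ← h2]; congr 1; omega
  | cross i s => simp only [AnnularEvent.shift, Valid, List.length_append] at *; omega

theorem apply_shift (e : AnnularEvent) (l r : List Bool) :
    (e.shift l.length).apply (l ++ r) = l ++ e.apply r := by
  cases e with
  | birth i b => simp [AnnularEvent.shift, apply, List.take_length_add_append,
      List.drop_length_add_append]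
  | death i => simp [AnnularEvent.shift, apply, List.take_length_add_append, add_assoc,
      List.drop_length_add_append]
  | cross i s => simp [AnnularEvent.shift, apply, List.take_length_add_append, add_assoc,
      List.drop_length_add_append]

/-- The oriented strands after the first `h` events of the word `w`, starting from `l`. -/
def levelAt (l : List Bool) (w : List AnnularEvent) (h : ℕ) : List Bool :=
  (w.take h).foldl (fun l e => e.apply l) l

theorem levelAt_zero (l : List Bool) (w : List AnnularEvent) : levelAt l w 0 = l := by
  simp [levelAt]

theorem levelAt_succ (l : List Bool) (w : List AnnularEvent) (h : ℕ) (hh : h < w.length) :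
    levelAt l w (h + 1) = (w[h]).apply (levelAt l w h) := by
  rw [levelAt, levelAt, List.take_succ_eq_append_getElem hh, List.foldl_append]
  rfl

end AnnularEvent

/-- An oriented annular link diagram: the oriented strands met by the arc from `X` to `O` at angle
`0`, and the events met during one full counterclockwise turn of the arc. -/
structure OrientedAnnularDiagram where
  start : List Bool
  word : List AnnularEvent
  valid : ∀ (h : ℕ) (hh : h < word.length), (word[h]).Valid (AnnularEvent.levelAt start word h)
  closed : AnnularEvent.levelAt start word word.length = start

namespace OrientedAnnularDiagram

open AnnularEvent

/-- The oriented strands met by the arc after the first `h` events. -/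
def level (D : OrientedAnnularDiagram) (h : ℕ) : List Bool :=
  levelAt D.start D.word h

theorem level_zero (D : OrientedAnnularDiagram) : D.level 0 = D.start := levelAt_zero _ _

theorem level_length (D : OrientedAnnularDiagram) : D.level D.word.length = D.start := D.closed

theorem level_succ (D : OrientedAnnularDiagram) (h : ℕ) (hh : h < D.word.length) :
    D.level (h + 1) = (D.word[h]).apply (D.level h) := levelAt_succ _ _ _ hh

/-- The word of the annular composition: first the events of the inner diagram `D'`, then those of
the outer diagram `D`, pushed outwards past the strands of `D'`. -/
def compWord (D D' : OrientedAnnularDiagram) : List AnnularEvent :=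
  D'.word ++ D.word.map (AnnularEvent.shift D'.start.length)

theorem levelAt_comp_left (D D' : OrientedAnnularDiagram) (h : ℕ) (hh : h ≤ D'.word.length) :
    levelAt (D'.start ++ D.start) (compWord D D') h = D'.level h ++ D.start := by
  induction h with
  | zero => rw [levelAt_zero, level_zero]
  | succ h ih =>
    have hlt : h < D'.word.length := hh
    have hlt' : h < (compWord D D').length := by
      simp only [compWord, List.length_append]; omega
    have he : (compWord D D')[h] = D'.word[h] := by
      simp only [compWord]; exact List.getElem_append_left hlt
    have ha : (D'.word[h]).apply (D'.level h ++ D.start) = (D'.word[h]).apply (D'.level h) ++ D.start :=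
      apply_append_right (D'.valid h hlt) D.start
    rw [levelAt_succ _ _ _ hlt', ih hlt.le, he, ha, level_succ _ _ hlt]

theorem levelAt_comp_right (D D' : OrientedAnnularDiagram) (h : ℕ) (hh : h ≤ D.word.length) :
    levelAt (D'.start ++ D.start) (compWord D D') (D'.word.length + h) =
      D'.start ++ D.level h := by
  induction h with
  | zero => rw [Nat.add_zero, levelAt_comp_left _ _ _ le_rfl, level_zero, level_length]
  | succ h ih =>
    have hlt : h < D.word.length := hh
    have hlt' : D'.word.length + h < (compWord D D').length := by
      simp only [compWord, List.length_append, List.length_map]; omega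
    have he : (compWord D D')[D'.word.length + h] = (D.word[h]).shift D'.start.length := by
      simp [compWord, List.getElem_append_right]
    rw [← add_assoc, levelAt_succ _ _ _ hlt', ih hlt.le, he, apply_shift, level_succ _ _ hlt]

/-- The annular composition `D ⨿ D'`: the inner boundary of the annulus containing `D` is
identified with the outer boundary of the annulus containing `D'`, and the orientations are kept.
(The angles of the events are chosen such that those of `D'` come first.) -/
def annularComp (D D' : OrientedAnnularDiagram) : OrientedAnnularDiagram where
  start := D'.start ++ D.start
  word := compWord D D'
  valid := by
    intro h hh
    by_cases hl : h < D'.word.length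
    · have he : (compWord D D')[h] = D'.word[h] := by
        simp only [compWord]; exact List.getElem_append_left hl
      rw [he, levelAt_comp_left _ _ _ hl.le]
      exact (D'.valid h hl).append_right _
    · obtain ⟨k, rfl⟩ := Nat.exists_eq_add_of_le (not_lt.1 hl)
      have hk : k < D.word.length := by
        simp only [compWord, List.length_append, List.length_map] at hh; omega
      have he : (compWord D D')[D'.word.length + k] = (D.word[k]).shift D'.start.length := by
        simp [compWord, List.getElem_append_right]
      rw [he, levelAt_comp_right _ _ _ hk.le]
      exact (D.valid k hk).shift _
  closed := by
    have h : (compWord D D').length = D'.word.length + D.word.length := by simp [compWord]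
    rw [h, levelAt_comp_right _ _ _ le_rfl, level_length]

/-! ### Crossings, complete resolutions and their circles -/

/-- The crossings of the diagram, ordered by their angle. -/
abbrev Crossing (D : OrientedAnnularDiagram) : Type :=
  {h : Fin D.word.length // (D.word[(h : ℕ)]).IsCross}

/-- The index of the event in which the crossing takes place. -/
def Crossing.time {D : OrientedAnnularDiagram} (c : D.Crossing) : ℕ := (c.1 : ℕ)

theorem Crossing.time_lt {D : OrientedAnnularDiagram} (c : D.Crossing) :
    c.time < D.word.length := c.1.2

/-- The position of the left strand at the crossing. -/
def Crossing.pos {D : OrientedAnnularDiagram} (c : D.Crossing) : ℕ := (D.word[c.time]'c.time_lt).pos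

/-- Is the strand from lower left to upper right the overcrossing one? -/
def Crossing.risingOver {D : OrientedAnnularDiagram} (c : D.Crossing) : Bool :=
  (D.word[c.time]'c.time_lt).risingOver

/-- The points in which the diagram meets the arc between events.  Level `0` and the last level are
two copies of the arc at angle `0`, whose points are identified in `Arc.close` below. -/
abbrev Point (D : OrientedAnnularDiagram) : Type :=
  (h : Fin (D.word.length + 1)) × Fin (D.level h).length

/-- Level and position of a point. -/
def Point.coord {D : OrientedAnnularDiagram} (x : D.Point) : ℕ × ℕ := (x.1, x.2)

/-- The direction of the diagram at a point (`true` is counterclockwise around `X`). -/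
def Point.dir {D : OrientedAnnularDiagram} (x : D.Point) : Bool := (D.level x.1).get x.2

/-- A vertex of the cube of resolutions: `false` is the `0`-smoothing, `true` the `1`-smoothing. -/
abbrev Resolution (D : OrientedAnnularDiagram) : Type := D.Crossing → Bool

/-- The arcs between consecutive points in the complete resolution `v`.  The `0`-smoothing of a
crossing joins the two regions swept out when the overcrossing strand is turned counterclockwise
towards the undercrossing one.  So it is the vertical smoothing `)(` if the strand from lower left
to upper right is over, and the horizontal one otherwise; the `1`-smoothing is the other one. -/
inductive Arc (D : OrientedAnnularDiagram) (v : D.Resolution) : ℕ × ℕ → ℕ × ℕ → Prop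
  | close (p : ℕ) : Arc D v (D.word.length, p) (0, p)
  | birth (h i : ℕ) (b : Bool) (e : D.word[h]? = some (AnnularEvent.birth i b)) :
      Arc D v (h + 1, i) (h + 1, i + 1)
  | birth_left (h i p : ℕ) (b : Bool) (e : D.word[h]? = some (AnnularEvent.birth i b))
      (hp : p < i) : Arc D v (h, p) (h + 1, p)
  | birth_right (h i p : ℕ) (b : Bool) (e : D.word[h]? = some (AnnularEvent.birth i b))
      (hp : i ≤ p) : Arc D v (h, p) (h + 1, p + 2)
  | death (h i : ℕ) (e : D.word[h]? = some (AnnularEvent.death i)) : Arc D v (h, i) (h, i + 1)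
  | death_left (h i p : ℕ) (e : D.word[h]? = some (AnnularEvent.death i)) (hp : p < i) :
      Arc D v (h, p) (h + 1, p)
  | death_right (h i p : ℕ) (e : D.word[h]? = some (AnnularEvent.death i)) (hp : i ≤ p) :
      Arc D v (h, p + 2) (h + 1, p)
  | cross_other (c : D.Crossing) (p : ℕ) (hp : p ≠ c.pos) (hp' : p ≠ c.pos + 1) :
      Arc D v (c.time, p) (c.time + 1, p)
  | vertical_left (c : D.Crossing) (hc : v c ≠ c.risingOver) :
      Arc D v (c.time, c.pos) (c.time + 1, c.pos)
  | vertical_right (c : D.Crossing) (hc : v c ≠ c.risingOver) :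
      Arc D v (c.time, c.pos + 1) (c.time + 1, c.pos + 1)
  | horizontal_bottom (c : D.Crossing) (hc : v c = c.risingOver) :
      Arc D v (c.time, c.pos) (c.time, c.pos + 1)
  | horizontal_top (c : D.Crossing) (hc : v c = c.risingOver) :
      Arc D v (c.time + 1, c.pos) (c.time + 1, c.pos + 1)

/-- Two points are equivalent if they lie on the same circle of the complete resolution `v`. -/
def circleSetoid (D : OrientedAnnularDiagram) (v : D.Resolution) : Setoid D.Point :=
  Relation.EqvGen.setoid fun x y => Arc D v x.coord y.coord

/-- The circles of the complete resolution `v`. -/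
abbrev Circle (D : OrientedAnnularDiagram) (v : D.Resolution) : Type :=
  Quotient (D.circleSetoid v)

/-- The circle of the complete resolution `v` that contains the point `x`. -/
def circleOf (D : OrientedAnnularDiagram) (v : D.Resolution) (x : D.Point) : D.Circle v :=
  Quotient.mk (D.circleSetoid v) x

theorem Crossing.pos_lt {D : OrientedAnnularDiagram} (c : D.Crossing) :
    c.pos + 1 < (D.level c.time).length := by
  have hv := D.valid c.time c.time_lt
  have hc : (D.word[c.time]'c.time_lt).IsCross := c.2
  unfold Crossing.pos
  generalize D.word[c.time]'c.time_lt = e at hv hc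
  cases e with
  | birth i b => exact hc.elim
  | death i => exact hc.elim
  | cross i s => exact hv

theorem Crossing.pos_lt_succ {D : OrientedAnnularDiagram} (c : D.Crossing) :
    c.pos + 1 < (D.level (c.time + 1)).length := by
  have hp := c.pos_lt
  have hc : (D.word[c.time]'c.time_lt).IsCross := c.2
  rw [D.level_succ _ c.time_lt]
  unfold Crossing.pos at hp ⊢
  generalize D.word[c.time]'c.time_lt = e at hp hc
  cases e with
  | birth i b => exact hc.elim
  | death i => exact hc.elim
  | cross i s =>
    simp only [AnnularEvent.pos, apply, List.length_append, List.length_take, List.length_reverse,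
      List.length_drop] at hp ⊢
    omega

/-- The lower left end of a crossing. -/
def Crossing.lowerLeft {D : OrientedAnnularDiagram} (c : D.Crossing) : D.Point :=
  ⟨⟨c.time, Nat.lt_succ_of_lt c.time_lt⟩, ⟨c.pos, Nat.lt_of_succ_lt c.pos_lt⟩⟩

/-- The lower right end of a crossing. -/
def Crossing.lowerRight {D : OrientedAnnularDiagram} (c : D.Crossing) : D.Point :=
  ⟨⟨c.time, Nat.lt_succ_of_lt c.time_lt⟩, ⟨c.pos + 1, c.pos_lt⟩⟩

/-- The upper right end of a crossing.  In both smoothings of the crossing, the lower left and the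
upper right end belong to different ones of the two arcs. -/
def Crossing.upperRight {D : OrientedAnnularDiagram} (c : D.Crossing) : D.Point :=
  ⟨⟨c.time + 1, Nat.succ_lt_succ c.time_lt⟩, ⟨c.pos + 1, c.pos_lt_succ⟩⟩

/-- The crossing is positive.  If both strands point upwards or both downwards, this means that the
strand from lower left to upper right is over; reversing one of them changes the sign. -/
def Crossing.Positive {D : OrientedAnnularDiagram} (c : D.Crossing) : Prop :=
  c.lowerLeft.dir = c.lowerRight.dir ↔ c.risingOver = true

/-! ### The Lee complex and its gradings -/

/-- The distinguished basis: complete resolutions whose circles are labelled by `v₊` (`true`) or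
`v₋` (`false`). -/
abbrev EnhancedState (D : OrientedAnnularDiagram) : Type :=
  (v : D.Resolution) × (D.Circle v → Bool)

noncomputable instance (D : OrientedAnnularDiagram) (v : D.Resolution) : Fintype (D.Circle v) :=
  Fintype.ofFinite _

noncomputable instance (D : OrientedAnnularDiagram) : Fintype D.Crossing :=
  Fintype.ofFinite _

noncomputable instance (D : OrientedAnnularDiagram) : Fintype D.EnhancedState :=
  Fintype.ofFinite _

/-- The vector space underlying the Lee complex, in coordinates with respect to the distinguished
basis. -/
abbrev LeeChain (D : OrientedAnnularDiagram) : Type := D.EnhancedState → ℂ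

/-- The coefficient of `v_z` in Lee's product `m (v_x ⊗ v_y)`:
`v₊v₊ ↦ v₊`, `v₊v₋, v₋v₊ ↦ v₋`, `v₋v₋ ↦ v₊`. -/
def leeMul : Bool → Bool → Bool → ℂ
  | true, true, true => 1
  | true, false, false => 1
  | false, true, false => 1
  | false, false, true => 1
  | _, _, _ => 0

/-- The coefficient of `v_x ⊗ v_y` in Lee's coproduct `Δ (v_z)`:
`v₊ ↦ v₊ ⊗ v₋ + v₋ ⊗ v₊`, `v₋ ↦ v₋ ⊗ v₋ + v₊ ⊗ v₊`. -/
def leeComul : Bool → Bool → Bool → ℂ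
  | true, true, false => 1
  | true, false, true => 1
  | false, false, false => 1
  | false, true, true => 1
  | _, _, _ => 0

/-- `S'` lies over the end of the edge of the cube that starts at the resolution of `S` and changes
the smoothing of `c` from `0` to `1`, and the circles that do not meet `c` carry the same labels. -/
def IsEdge (D : OrientedAnnularDiagram) (c : D.Crossing) (S S' : D.EnhancedState) : Prop :=
  S.1 c = false ∧ S'.1 c = true ∧ (∀ c', c' ≠ c → S'.1 c' = S.1 c') ∧
    ∀ x : D.Point, D.circleOf S.1 x ≠ D.circleOf S.1 c.lowerLeft →
      D.circleOf S.1 x ≠ D.circleOf S.1 c.upperRight →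
        S'.2 (D.circleOf S'.1 x) = S.2 (D.circleOf S.1 x)

open Classical in
/-- The coefficient of Lee's merge or split map at the crossing `c`: if the two arcs at `c` lie on
different circles of the resolution of `S`, these are merged, otherwise their circle is split. -/
noncomputable def saddleCoeff (D : OrientedAnnularDiagram) (c : D.Crossing)
    (S S' : D.EnhancedState) : ℂ :=
  if D.circleOf S.1 c.lowerLeft ≠ D.circleOf S.1 c.upperRight then
    leeMul (S.2 (D.circleOf S.1 c.lowerLeft)) (S.2 (D.circleOf S.1 c.upperRight))
      (S'.2 (D.circleOf S'.1 c.lowerLeft))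
  else
    leeComul (S.2 (D.circleOf S.1 c.lowerLeft)) (S'.2 (D.circleOf S'.1 c.lowerLeft))
      (S'.2 (D.circleOf S'.1 c.upperRight))

open Classical in
/-- The sign of an edge: `-1` to the number of `1`-smoothings at crossings preceding `c`. -/
noncomputable def edgeSign (D : OrientedAnnularDiagram) (v : D.Resolution) (c : D.Crossing) : ℂ :=
  (-1) ^ (Finset.univ.filter fun c' : D.Crossing => c'.time < c.time ∧ v c' = true).card

open Classical in
/-- The coefficient of `S'` in the Lee differential of `S`. -/
noncomputable def leeCoeff (D : OrientedAnnularDiagram) (S S' : D.EnhancedState) : ℂ :=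
  ∑ c : D.Crossing, if D.IsEdge c S S' then D.edgeSign S.1 c * D.saddleCoeff c S S' else 0

/-- The Lee differential. -/
noncomputable def leeDifferential (D : OrientedAnnularDiagram) : D.LeeChain →ₗ[ℂ] D.LeeChain :=
  (Matrix.of fun S' S : D.EnhancedState => D.leeCoeff S S').mulVecLin

/-- The number of positive crossings. -/
noncomputable def nPlus (D : OrientedAnnularDiagram) : ℕ :=
  Nat.card {c : D.Crossing // c.Positive}

/-- The number of negative crossings. -/
noncomputable def nMinus (D : OrientedAnnularDiagram) : ℕ :=
  Nat.card {c : D.Crossing // ¬ c.Positive}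

/-- The degree `±1` of a label `v±`. -/
def labelDegree (b : Bool) : ℤ := if b then 1 else -1

/-- The quantum grading `j` of a distinguished basis element. -/
noncomputable def jGrading (D : OrientedAnnularDiagram) (S : D.EnhancedState) : ℤ :=
  ∑ C : D.Circle S.1, labelDegree (S.2 C) + (Nat.card {c : D.Crossing // S.1 c = true} : ℤ)
    + (D.nPlus : ℤ) - 2 * (D.nMinus : ℤ)

/-- A circle is nontrivial if it meets the arc from `X` to `O` at angle `0` in an odd number of
points. -/
def Nontrivial (D : OrientedAnnularDiagram) (v : D.Resolution) (C : D.Circle v) : Prop :=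
  Odd (Nat.card {x : D.Point // x.1 = 0 ∧ D.circleOf v x = C})

open Classical in
/-- The annular grading `k` of a distinguished basis element: the algebraic intersection number of
the arc with the circles, those labelled `v₊` being oriented counterclockwise and those labelled
`v₋` clockwise.  A nontrivial circle contributes `1` or `-1` according to its label, a trivial one
contributes `0`. -/
noncomputable def kGrading (D : OrientedAnnularDiagram) (S : D.EnhancedState) : ℤ :=
  ∑ C : D.Circle S.1, if D.Nontrivial S.1 C then labelDegree (S.2 C) else 0

/-- The grading `j_t = j - t k` of a distinguished basis element. -/
noncomputable def jtGrading (D : OrientedAnnularDiagram) (t : ℝ) (S : D.EnhancedState) : ℝ :=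
  (D.jGrading S : ℝ) - t * (D.kGrading S : ℝ)

open Classical in
/-- The descending filtration of the Lee complex induced by the `j_t` grading. -/
noncomputable def filtration (D : OrientedAnnularDiagram) (t s : ℝ) : Submodule ℂ D.LeeChain :=
  Submodule.span ℂ {x | ∃ S : D.EnhancedState, s ≤ D.jtGrading t S ∧ x = Pi.single S 1}

/-- The filtration grading of a (nonzero) chain: the largest `s` such that the chain lies in the
`s`-th step of the filtration. -/
noncomputable def gr (D : OrientedAnnularDiagram) (t : ℝ) (x : D.LeeChain) : ℝ :=
  sSup {s | x ∈ D.filtration t s}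

/-! ### The canonical Lee class and the annular Rasmussen invariants -/

open Classical in
/-- The oriented resolution: the `0`-smoothing of the positive crossings and the `1`-smoothing of
the negative ones. -/
noncomputable def orientedResolution (D : OrientedAnnularDiagram) : D.Resolution :=
  fun c => if c.Positive then false else true

/-- The mod 2 invariant of a circle of the oriented resolution, read off at a point `x` on it by
following the ray from `x` outwards to `O`: the number of circles separating the circle from `O`,
plus one if the circle runs counterclockwise in the plane (the complement of `O`).  Mod 2, the
former is the number of points of other circles on the ray, and the circle runs counterclockwise
iff it runs counterclockwise around `X` at `x` and meets the rest of the ray evenly often, or runs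
clockwise at `x` and meets the rest of the ray oddly often. -/
def Point.leeIndex {D : OrientedAnnularDiagram} (x : D.Point) : ℕ :=
  ((D.level x.1).length - 1 - x.2) + (if x.dir then 1 else 0)

/-- A circle of the oriented resolution is labelled by `𝐛 = v₋ - v₊` if its mod 2 invariant is `1`,
and by `𝐚 = v₋ + v₊` if it is `0`. -/
def IsB (D : OrientedAnnularDiagram) (v : D.Resolution) (C : D.Circle v) : Prop :=
  ∃ x : D.Point, D.circleOf v x = C ∧ Odd x.leeIndex

open Classical in
/-- The canonical Lee cycle `𝔰_o`: the tensor product of the labels `𝐚`, `𝐛` over the circles of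
the oriented resolution. -/
noncomputable def canonicalCycle (D : OrientedAnnularDiagram) : D.LeeChain :=
  fun S =>
    if S.1 = D.orientedResolution then
      ∏ C : D.Circle S.1, if D.IsB S.1 C ∧ S.2 C = true then -1 else 1
    else 0

/-- The filtration gradings of the cycles that represent the homology class `[𝔰_o]`. -/
def classGradings (D : OrientedAnnularDiagram) (t : ℝ) : Set ℝ :=
  {r | ∃ x : D.LeeChain, D.leeDifferential x = 0 ∧
    x - D.canonicalCycle ∈ LinearMap.range D.leeDifferential ∧ r = D.gr t x}

/-- The annular Rasmussen invariant `d_t`: the `j_t` grading of the homology class `[𝔰_o]`, i.e. the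
largest filtration grading of a cycle representing it. -/
noncomputable def annularRasmussen (D : OrientedAnnularDiagram) (t : ℝ) : ℝ :=
  sSup (D.classGradings t)

/-- The right-limit slope `m_t` of `d_t` at `t` exists and equals `m`. -/
def HasSlope (D : OrientedAnnularDiagram) (t m : ℝ) : Prop :=
  Tendsto (fun ε : ℝ => (D.annularRasmussen (t + ε) - D.annularRasmussen t) / ε) (𝓝[>] 0) (𝓝 m)

end OrientedAnnularDiagram

/-!
Evaluating the two labels at the two algebra maps `v₊ ↦ 1`, `v₋ ↦ ± 1` diagonalises the Lee
complex: the evaluations belong to colourings of the circles by two colours, and the differential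
only joins resolutions and colourings that give both arcs at a crossing the same colour. Hence a
colouring that distinguishes the two arcs at every crossing, as that of `𝔰_o` does, gives a cycle
whose class is detected by an evaluation.

The level of a class is the largest `a` such that the class has a representative in level `a`; by
finite-dimensional duality, some functional on homology then detects the class and vanishes on all
basis elements of level `> a`. Representatives and functionals can both be tensored, so that levels
add up under disjoint unions. In the annular composition, the outer strands may exchange `𝐚` and
`𝐛` on all inner circles; multiplication by `i ^ j` undoes this, because the Lee differential
preserves `j` modulo `4`. Finally, the order of the finitely many affine functions `t ↦ j_t(𝐱)` is
constant just to the right of every `t`, so that `d_t` agrees there with one of them.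
-/

section Merge

open Equiv Equiv.Perm

variable {P : Type*}

open Classical in
/-- The equivalence relation obtained from `E` by uniting the classes of `p` and `s`: every point
of the class of `s` is represented by `p` instead. -/
noncomputable def mergeClasses (E : Setoid P) (p s : P) : Setoid P :=
  Setoid.ker fun x => if E x s then Quotient.mk E p else Quotient.mk E x

/-- `E'` arises from `E` by merging the classes of `p` and `s`, which are different. -/
structure IsMerge (E E' : Setoid P) (p s : P) : Prop where
  not_rel : ¬ E p s
  eq_mergeClasses : E' = mergeClasses E p s

open Classical in
theorem mergeClasses_iff {E : Setoid P} {p s x y : P} : mergeClasses E p s x y ↔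
    (if E x s then Quotient.mk E p else Quotient.mk E x) =
      if E y s then Quotient.mk E p else Quotient.mk E y := Iff.rfl

theorem le_mergeClasses (E : Setoid P) (p s : P) : E ≤ mergeClasses E p s := by
  classical
  intro x y hxy
  have hs : E x s ↔ E y s := ⟨E.trans (E.symm hxy), E.trans hxy⟩
  rw [mergeClasses_iff]
  exact if_congr hs rfl (Quotient.sound hxy)

theorem mergeClasses_rel (E : Setoid P) (p s : P) : mergeClasses E p s p s := by
  rw [mergeClasses_iff, if_pos (E.refl s), ite_self]

theorem mergeClasses_le {E r : Setoid P} {p s : P} (hE : E ≤ r) (hps : r p s) :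
    mergeClasses E p s ≤ r := by
  classical
  have hmove (z : P) : ∃ w, (if E z s then Quotient.mk E p else Quotient.mk E z) =
      Quotient.mk E w ∧ r z w := by
    by_cases hz : E z s
    · exact ⟨p, if_pos hz, r.trans (hE hz) (r.symm hps)⟩
    · exact ⟨z, if_neg hz, r.refl z⟩
  intro x y hxy
  obtain ⟨x', hx', hrx⟩ := hmove x
  obtain ⟨y', hy', hry⟩ := hmove y
  rw [mergeClasses_iff, hx', hy'] at hxy
  exact r.trans hrx (r.trans (hE (Quotient.exact hxy)) (r.symm hry))

namespace IsMerge

variable {E E' : Setoid P} {p s : P}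

theorem le (h : IsMerge E E' p s) : E ≤ E' := h.eq_mergeClasses ▸ le_mergeClasses E p s

theorem rel (h : IsMerge E E' p s) : E' p s := h.eq_mergeClasses ▸ mergeClasses_rel E p s

theorem rel_iff_of_not (h : IsMerge E E' p s) {x y : P} (hx : ¬ E x s) (hy : ¬ E y s) :
    E' x y ↔ E x y := by
  rw [h.eq_mergeClasses, mergeClasses_iff, if_neg hx, if_neg hy]
  exact Quotient.eq

theorem rel_left_iff (h : IsMerge E E' p s) {x : P} : E' x p ↔ E x p ∨ E x s := by
  by_cases hx : E x s
  · exact iff_of_true (E'.trans (h.le hx) (E'.symm h.rel)) (Or.inr hx)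
  · rw [h.rel_iff_of_not hx h.not_rel, or_iff_left hx]

theorem bijective_map (h : IsMerge E E' p s) :
    Function.Bijective fun C : {C : Quotient E // C ≠ Quotient.mk E s} =>
      Quotient.map' (s₁ := E) (s₂ := E') id (fun _ _ hxy => h.le hxy) C.1 := by
  constructor
  · rintro ⟨C, hC⟩ ⟨C', hC'⟩ hCC'
    induction C, C' using Quotient.inductionOn₂ with | h x y
    exact Subtype.ext (Quotient.sound ((h.rel_iff_of_not (fun hx => hC (Quotient.sound hx))
      (fun hy => hC' (Quotient.sound hy))).1 (Quotient.exact hCC')))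
  · intro C'
    induction C' using Quotient.inductionOn with | h y
    by_cases hy : E y s
    · exact ⟨⟨Quotient.mk E p, fun hp => h.not_rel (Quotient.exact hp)⟩,
        Quotient.sound (E'.trans h.rel (E'.symm (h.le hy)))⟩
    · exact ⟨⟨Quotient.mk E y, fun hp => hy (Quotient.exact hp)⟩, rfl⟩

theorem prod_mul_eq {M : Type*} [CommMonoid M] [Fintype (Quotient E)] [Fintype (Quotient E')]
    (h : IsMerge E E' p s) (G : Quotient E → M) (G' : Quotient E' → M)
    (hG : ∀ x, ¬ E' x p → G' (Quotient.mk E' x) = G (Quotient.mk E x)) :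
    (∏ C, G C) * G' (Quotient.mk E' p) =
      G (Quotient.mk E p) * G (Quotient.mk E s) * ∏ C, G' C := by
  classical
  set merged := Equiv.ofBijective _ h.bijective_map
  let P₀ : {C : Quotient E // C ≠ Quotient.mk E s} :=
    ⟨Quotient.mk E p, fun hp => h.not_rel (Quotient.exact hp)⟩
  have hoff : ∀ C : {C // C ≠ P₀}, G C.1.1 = G' (merged C.1) := by
    rintro ⟨⟨C, hs⟩, hp⟩
    induction C using Quotient.inductionOn with | h x
    refine (hG x fun hx => ?_).symm
    rcases h.rel_left_iff.1 hx with hx | hx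
    · exact hp (Subtype.ext (Quotient.sound hx))
    · exact hs (Quotient.sound hx)
  rw [Fintype.prod_eq_mul_prod_subtype_ne G (Quotient.mk E s),
    Fintype.prod_eq_mul_prod_subtype_ne (fun C : {C // C ≠ Quotient.mk E s} => G C) P₀,
    ← merged.prod_comp G', Fintype.prod_eq_mul_prod_subtype_ne (fun C => G' (merged C)) P₀]
  simp only [hoff, merged, P₀, Equiv.ofBijective_apply, Quotient.map'_mk'', id]
  ac_rfl

end IsMerge

variable {σ : Perm P} {p s : P}

theorem exists_first_return [Finite P] (σ : Perm P) (p s : P) :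
    ∃ n, 0 < n ∧ ((σ ^ n) s = p ∨ (σ ^ n) s = s) ∧
      ∀ k, 0 < k → k < n → (σ ^ k) s ≠ p ∧ (σ ^ k) s ≠ s := by
  classical
  have hex : ∃ n, 0 < n ∧ ((σ ^ n) s = p ∨ (σ ^ n) s = s) := by
    obtain ⟨n, hn, -, hs⟩ := (SameCycle.refl σ s).exists_pow_eq''
    exact ⟨n, hn, Or.inr hs⟩
  refine ⟨Nat.find hex, (Nat.find_spec hex).1, (Nat.find_spec hex).2, fun k hk hkn => ?_⟩
  simpa only [hk, true_and, not_or] using Nat.find_min hex hkn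

theorem exists_pow_eq_of_sameCycle [Finite P] {x y : P} {n : ℕ} (h : σ.SameCycle x y)
    (hn : 0 < n) (hx : (σ ^ n) x = x) : ∃ k < n, (σ ^ k) x = y := by
  obtain ⟨k, -, rfl⟩ := h.exists_pow_eq'
  have hperiodic : Function.IsPeriodicPt σ n x := by
    rw [Function.IsPeriodicPt, Function.IsFixedPt, iterate_eq_pow, hx]
  refine ⟨k % n, Nat.mod_lt k hn, ?_⟩
  simpa only [iterate_eq_pow] using hperiodic.iterate_mod_apply k

theorem sameCycle_setoid_le [Finite P] {r : Setoid P} (h : ∀ x, r x (σ x)) :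
    SameCycle.setoid σ ≤ r := by
  intro x y hxy
  obtain ⟨k, -, rfl⟩ := SameCycle.exists_pow_eq' hxy
  clear hxy
  induction k with
  | zero => exact r.refl x
  | succ k ih => rw [pow_succ', Perm.mul_apply]; exact r.trans ih (h _)

variable [DecidableEq P]

theorem pow_mul_swap_apply {n : ℕ} (hn : 0 < n)
    (h : ∀ k, 0 < k → k < n → (σ ^ k) s ≠ p ∧ (σ ^ k) s ≠ s) :
    ((σ * swap p s) ^ n) p = (σ ^ n) s := by
  induction n, hn using Nat.le_induction with
  | base => simp
  | succ n hn ih =>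
    obtain ⟨hp, hs⟩ := h n hn n.lt_succ_self
    rw [pow_succ', Perm.mul_apply, ih fun k hk hkn => h k hk (hkn.trans n.lt_succ_self),
      Perm.mul_apply, swap_apply_of_ne_of_ne hp hs, pow_succ', Perm.mul_apply]

variable [Finite P]

theorem sameCycle_mul_swap (h : ¬ σ.SameCycle p s) : (σ * swap p s).SameCycle p s := by
  obtain ⟨n, hn, hp | hs, hmin⟩ := exists_first_return σ p s
  · exact absurd (SameCycle.symm ⟨n, by simpa using hp⟩) h
  · exact ⟨n, by simpa [hs] using pow_mul_swap_apply hn hmin⟩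

theorem not_sameCycle_mul_swap (hps : p ≠ s) (h : σ.SameCycle p s) :
    ¬ (σ * swap p s).SameCycle p s := by
  obtain ⟨n, hn, hret, hmin⟩ := exists_first_return σ p s
  have hp : (σ ^ n) s = p := by
    refine hret.resolve_right fun hs => ?_
    obtain ⟨k, hkn, hk⟩ := exists_pow_eq_of_sameCycle h.symm hn hs
    rcases Nat.eq_zero_or_pos k with rfl | hpos
    · exact hps hk.symm
    · exact (hmin k hpos hkn).1 hk
  intro hτ
  obtain ⟨k, hkn, hk⟩ := exists_pow_eq_of_sameCycle hτ hn
    ((pow_mul_swap_apply hn hmin).trans hp)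
  rcases Nat.eq_zero_or_pos k with rfl | hpos
  · exact hps hk
  · rw [pow_mul_swap_apply hpos fun j hj hjk => hmin j hj (hjk.trans hkn)] at hk
    exact (hmin k hpos hkn).2 hk

theorem sameCycle_setoid_mul_swap_le {r : Setoid P} (hσ : SameCycle.setoid σ ≤ r)
    (hps : r p s) : SameCycle.setoid (σ * swap p s) ≤ r := by
  refine sameCycle_setoid_le fun x => r.trans ?_ (hσ ((SameCycle.refl σ _).apply_right))
  rcases eq_or_ne x p with rfl | hp
  · rwa [swap_apply_left]
  · rcases eq_or_ne x s with rfl | hs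
    · rw [swap_apply_right]; exact r.symm hps
    · rw [swap_apply_of_ne_of_ne hp hs]

theorem isMerge_mul_swap (h : ¬ σ.SameCycle p s) :
    IsMerge (SameCycle.setoid σ) (SameCycle.setoid (σ * swap p s)) p s := by
  have hps := sameCycle_mul_swap h
  have hle : SameCycle.setoid σ ≤ SameCycle.setoid (σ * swap p s) := by
    simpa only [mul_swap_mul_self] using
      sameCycle_setoid_mul_swap_le (σ := σ * swap p s) le_rfl hps
  exact ⟨h, le_antisymm (sameCycle_setoid_mul_swap_le (le_mergeClasses _ p s)
    (mergeClasses_rel _ p s)) (mergeClasses_le hle hps)⟩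

theorem isMerge_of_mul_swap (hps : p ≠ s) (h : σ.SameCycle p s) :
    IsMerge (SameCycle.setoid (σ * swap p s)) (SameCycle.setoid σ) p s := by
  simpa only [mul_swap_mul_self] using isMerge_mul_swap (not_sameCycle_mul_swap hps h)

end Merge

namespace AnnularEvent

/-- The pairing of the ends of the strands that pass through an event; `(false, p)` and `(true, p)`
are the ends in position `p` before and after the event.  Crossings are smoothed, horizontally iff
`hz` is true. -/
def mate : AnnularEvent → Bool → Bool × ℕ → Bool × ℕ
  | birth i _, _, (false, p) => if p < i then (true, p) else (true, p + 2)
  | birth i _, _, (true, p) => if p < i then (false, p) else if p = i then (true, i + 1)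
      else if p = i + 1 then (true, i) else (false, p - 2)
  | death i, _, (true, p) => if p < i then (false, p) else (false, p + 2)
  | death i, _, (false, p) => if p < i then (true, p) else if p = i then (false, i + 1)
      else if p = i + 1 then (false, i) else (true, p - 2)
  | cross i _, hz, (u, p) => if hz = true ∧ p = i then (u, i + 1)
      else if hz = true ∧ p = i + 1 then (u, i) else (!u, p)

theorem mate_mate (e : AnnularEvent) (hz : Bool) (z : Bool × ℕ) :
    e.mate hz (e.mate hz z) = z := by
  obtain ⟨u, p⟩ := z
  cases e <;> cases u <;> simp only [mate] <;> grind [mate]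

theorem mate_parity (e : AnnularEvent) (hz : Bool) (z : Bool × ℕ) :
    ((e.mate hz z).1 ^^ (e.mate hz z).2.bodd) = !(z.1 ^^ z.2.bodd) := by
  obtain ⟨u, p⟩ := z
  have bodd_sub_two (hp : 2 ≤ p) : (p - 2).bodd = p.bodd := by
    obtain ⟨q, rfl⟩ := Nat.exists_eq_add_of_le' hp
    simp [Nat.bodd_succ]
  cases e <;> cases u <;> simp only [mate] <;> split_ifs <;>
    first
    | (rw [bodd_sub_two (by omega)]; simp)
    | simp_all [Nat.bodd_succ]

theorem length_apply_birth {i : ℕ} {b : Bool} {l : List Bool} (h : (birth i b).Valid l) :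
    ((birth i b).apply l).length = l.length + 2 := by
  simp only [Valid] at h
  simp only [apply, List.length_append, List.length_take, List.length_cons, List.length_drop]
  omega

theorem succ_lt_length_of_valid_death {i : ℕ} {l : List Bool} (h : (death i).Valid l) :
    i + 1 < l.length := by
  obtain ⟨b, -, hb⟩ := h
  exact (List.getElem?_eq_some_iff.1 hb).1

theorem length_apply_death {i : ℕ} {l : List Bool} (h : (death i).Valid l) :
    ((death i).apply l).length + 2 = l.length := by
  have := succ_lt_length_of_valid_death h
  simp only [apply, List.length_append, List.length_take, List.length_drop]
  omega

theorem length_apply_cross {i : ℕ} {s : Bool} {l : List Bool} (h : (cross i s).Valid l) :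
    ((cross i s).apply l).length = l.length := by
  simp only [Valid] at h
  simp only [apply, List.length_append, List.length_take, List.length_drop, List.length_reverse]
  omega

/-- The strands before (`false`) and after (`true`) an event. -/
def sideStrands (e : AnnularEvent) (l : List Bool) (u : Bool) : List Bool :=
  if u then e.apply l else l

theorem mate_lt {e : AnnularEvent} {l : List Bool} (h : e.Valid l) (hz : Bool) {z : Bool × ℕ}
    (hp : z.2 < (e.sideStrands l z.1).length) :
    (e.mate hz z).2 < (e.sideStrands l (e.mate hz z).1).length := by
  obtain ⟨u, p⟩ := z
  cases e with
  | birth i b =>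
    have := length_apply_birth h
    have : i ≤ l.length := h
    cases u <;> simp only [mate, sideStrands] at * <;> grind
  | death i =>
    have := length_apply_death h
    have := succ_lt_length_of_valid_death h
    cases u <;> simp only [mate, sideStrands] at * <;> grind
  | cross i s =>
    have := length_apply_cross h
    have : i + 1 < l.length := h
    cases u <;> simp only [mate, sideStrands] at * <;> grind

end AnnularEvent

namespace OrientedAnnularDiagram

open AnnularEvent

variable {D : OrientedAnnularDiagram} {v v' : D.Resolution}

theorem Point.coord_injective : Function.Injective (Point.coord (D := D)) := by
  rintro ⟨⟨h, hh⟩, ⟨p, hp⟩⟩ ⟨⟨h', hh'⟩, ⟨p', hp'⟩⟩ e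
  simp only [Point.coord, Prod.mk.injEq] at e
  obtain ⟨rfl, rfl⟩ := e
  rfl

theorem Crossing.ext_time {c c' : D.Crossing} (h : c.time = c'.time) : c = c' :=
  Subtype.ext (Fin.ext h)

theorem Crossing.word_time (c : D.Crossing) :
    D.word[c.time]'c.time_lt = AnnularEvent.cross c.pos c.risingOver := by
  have hc : (D.word[c.time]'c.time_lt).IsCross := c.2
  unfold Crossing.pos Crossing.risingOver
  generalize D.word[c.time]'c.time_lt = e at hc
  cases e with
  | birth i b => exact hc.elim
  | death i => exact hc.elim
  | cross i s => rfl

theorem exists_crossing {h i : ℕ} {s : Bool} (hh : h < D.word.length)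
    (e : D.word[h] = AnnularEvent.cross i s) :
    ∃ c : D.Crossing, c.time = h ∧ c.pos = i ∧ c.risingOver = s := by
  refine ⟨⟨⟨h, hh⟩, (by rw [e]; trivial : (D.word[h]).IsCross)⟩, rfl, ?_, ?_⟩
  · exact congrArg AnnularEvent.pos e
  · exact congrArg AnnularEvent.risingOver e

open Classical in
/-- Does a crossing take place in the event `h`, and is it smoothed horizontally by `v`? -/
noncomputable def horizontal (v : D.Resolution) (h : ℕ) : Bool :=
  decide (∃ c : D.Crossing, c.time = h ∧ v c = c.risingOver)

theorem horizontal_time (v : D.Resolution) (c : D.Crossing) :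
    horizontal v c.time = decide (v c = c.risingOver) := by
  refine decide_eq_decide.2 ⟨?_, fun h => ⟨c, rfl, h⟩⟩
  rintro ⟨c', hc', h⟩
  rwa [← Crossing.ext_time hc']

theorem horizontal_congr {c : D.Crossing} (h : ∀ c', c' ≠ c → v' c' = v c')
    {t : ℕ} (ht : t ≠ c.time) : horizontal v' t = horizontal v t := by
  refine decide_eq_decide.2 (exists_congr fun c' => and_congr_right fun hc' => ?_)
  rw [h c' (by rintro rfl; exact ht hc'.symm)]

/-- The pairing of strand ends in the gap between the level `g` and the cyclically next one.  In the
gap between the last level and level `0` there is no event. -/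
noncomputable def gapMate (v : D.Resolution) (g : Fin (D.word.length + 1)) (z : Bool × ℕ) :
    Bool × ℕ :=
  if hg : (g : ℕ) < D.word.length then (D.word[(g : ℕ)]).mate (horizontal v g) z else (!z.1, z.2)

/-- The level before (`false`) or after (`true`) a gap. -/
def sideLevel (g : Fin (D.word.length + 1)) (u : Bool) : Fin (D.word.length + 1) :=
  if u then g + 1 else g

/-- The gap after (`false`) or before (`true`) a level. -/
def sideGap (h : Fin (D.word.length + 1)) (u : Bool) : Fin (D.word.length + 1) :=
  if u then h - 1 else h

theorem sideLevel_sideGap (h : Fin (D.word.length + 1)) (u : Bool) :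
    sideLevel (sideGap h u) u = h := by
  cases u <;> simp [sideLevel, sideGap]

theorem sideGap_sideLevel (g : Fin (D.word.length + 1)) (u : Bool) :
    sideGap (sideLevel g u) u = g := by
  cases u <;> simp [sideLevel, sideGap]

theorem gapMate_gapMate (v : D.Resolution) (g : Fin (D.word.length + 1)) (z : Bool × ℕ) :
    gapMate v g (gapMate v g z) = z := by
  by_cases hg : (g : ℕ) < D.word.length <;> simp [gapMate, hg, mate_mate]

theorem gapMate_parity (v : D.Resolution) (g : Fin (D.word.length + 1)) (z : Bool × ℕ) :
    ((gapMate v g z).1 ^^ (gapMate v g z).2.bodd) = !(z.1 ^^ z.2.bodd) := by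
  by_cases hg : (g : ℕ) < D.word.length <;> simp [gapMate, hg, mate_parity]

theorem val_sideLevel_of_lt {g : Fin (D.word.length + 1)} (hg : (g : ℕ) < D.word.length)
    (u : Bool) : (sideLevel g u : ℕ) = g + u.toNat := by
  cases u
  · rfl
  · exact Fin.val_add_one_of_lt hg

theorem eq_last_of_not_lt {g : Fin (D.word.length + 1)} (hg : ¬ (g : ℕ) < D.word.length) :
    g = Fin.last _ :=
  Fin.ext (le_antisymm g.le_last (not_lt.1 hg))

theorem level_sideLevel_of_lt {g : Fin (D.word.length + 1)} (hg : (g : ℕ) < D.word.length)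
    (u : Bool) : D.level (sideLevel g u) = (D.word[(g : ℕ)]).sideStrands (D.level g) u := by
  rw [val_sideLevel_of_lt hg]
  cases u
  · rfl
  · exact D.level_succ g hg

theorem level_sideLevel_last (u : Bool) :
    D.level (sideLevel (Fin.last D.word.length) u) = D.start := by
  cases u
  · exact D.level_length
  · simp [sideLevel, D.level_zero]

theorem gapMate_lt (v : D.Resolution) (g : Fin (D.word.length + 1)) {z : Bool × ℕ}
    (hz : z.2 < (D.level (sideLevel g z.1)).length) :
    (gapMate v g z).2 < (D.level (sideLevel g (gapMate v g z).1)).length := by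
  by_cases hg : (g : ℕ) < D.word.length
  · rw [level_sideLevel_of_lt hg] at hz ⊢
    simp only [gapMate, hg, dif_pos]
    exact mate_lt (D.valid g hg) (horizontal v g) hz
  · obtain rfl := eq_last_of_not_lt hg
    rw [level_sideLevel_last] at hz ⊢
    simpa only [gapMate, hg, dif_neg, not_false_iff] using hz

namespace Point

/-- The pairing of strand ends in the gap after (`u = false`) or before (`u = true`) the point `x`,
applied to the end of a strand at `x`. -/
noncomputable def mateEnd (v : D.Resolution) (x : D.Point) (u : Bool) : Bool × ℕ :=
  gapMate v (sideGap x.1 u) (u, x.2)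

/-- The other endpoint of the arc that leaves `x` in the direction of increasing angle
(`u = false`) or decreasing angle (`u = true`). -/
noncomputable def mate (v : D.Resolution) (x : D.Point) (u : Bool) : D.Point :=
  ⟨sideLevel (sideGap x.1 u) (x.mateEnd v u).1, (x.mateEnd v u).2,
    gapMate_lt v _ (by rw [sideLevel_sideGap]; exact x.2.2)⟩

theorem mate_mate (v : D.Resolution) (x : D.Point) (u : Bool) :
    (x.mate v u).mate v (x.mateEnd v u).1 = x := by
  apply coord_injective
  have hgap : sideGap (x.mate v u).1 (x.mateEnd v u).1 = sideGap x.1 u := sideGap_sideLevel _ _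
  have hend : (x.mate v u).mateEnd v (x.mateEnd v u).1 = (u, (x.2 : ℕ)) := by
    rw [mateEnd, hgap]
    exact gapMate_gapMate v _ _
  refine Prod.ext ?_ ?_
  · change ((sideLevel (sideGap _ _) ((x.mate v u).mateEnd v _).1 : Fin _) : ℕ) = x.1
    rw [hgap, hend, sideLevel_sideGap]
  · exact show ((x.mate v u).mateEnd v _).2 = _ by rw [hend]; rfl

theorem mateEnd_parity (v : D.Resolution) (x : D.Point) (u : Bool) :
    ((x.mateEnd v u).1 ^^ (x.mate v u).coord.2.bodd) = !(u ^^ x.coord.2.bodd) :=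
  gapMate_parity v _ _

theorem sideGap_eq_of_coord {x : D.Point} {u : Bool} {h p : ℕ} (hh : h < D.word.length)
    (hx : x.coord = (h + u.toNat, p)) : sideGap x.1 u = ⟨h, hh.trans (Nat.lt_succ_self _)⟩ := by
  have hlevel : x.1 = sideLevel ⟨h, hh.trans (Nat.lt_succ_self _)⟩ u :=
    Fin.ext ((congrArg Prod.fst hx).trans
      (val_sideLevel_of_lt (g := ⟨h, hh.trans (Nat.lt_succ_self _)⟩) hh u).symm)
  rw [hlevel, sideGap_sideLevel]

theorem mateEnd_eq_of_coord (v : D.Resolution) {x : D.Point} {u : Bool} {h p : ℕ}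
    (hh : h < D.word.length) (hx : x.coord = (h + u.toNat, p)) :
    x.mateEnd v u = (D.word[h]).mate (horizontal v h) (u, p) := by
  obtain rfl : (x.2 : ℕ) = p := congrArg Prod.snd hx
  simp only [mateEnd, sideGap_eq_of_coord hh hx, gapMate, hh, dif_pos]

theorem coord_mate_of_coord (v : D.Resolution) {x : D.Point} {u : Bool} {h p : ℕ}
    (hh : h < D.word.length) (hx : x.coord = (h + u.toNat, p)) :
    (x.mate v u).coord = (h + ((D.word[h]).mate (horizontal v h) (u, p)).1.toNat,
      ((D.word[h]).mate (horizontal v h) (u, p)).2) := by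
  rw [← mateEnd_eq_of_coord v hh hx]
  refine Prod.ext ?_ rfl
  change ((sideLevel (sideGap x.1 u) _ : Fin _) : ℕ) = _
  rw [sideGap_eq_of_coord hh hx, val_sideLevel_of_lt hh]

theorem sideGap_eq_last {x : D.Point} {u : Bool}
    (hx : x.coord.1 = if u then 0 else D.word.length) : sideGap x.1 u = Fin.last _ := by
  have hlevel : x.1 = sideLevel (Fin.last _) u := by
    cases u
    · exact Fin.ext hx
    · exact (Fin.ext hx : x.1 = 0).trans (by simp [sideLevel])
  rw [hlevel, sideGap_sideLevel]

theorem mateEnd_of_closing (v : D.Resolution) {x : D.Point} {u : Bool}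
    (hx : x.coord.1 = if u then 0 else D.word.length) : x.mateEnd v u = (!u, x.coord.2) := by
  simp [mateEnd, sideGap_eq_last hx, gapMate, coord]

theorem coord_mate_of_closing (v : D.Resolution) {x : D.Point} {u : Bool}
    (hx : x.coord.1 = if u then 0 else D.word.length) :
    (x.mate v u).coord = (if u then D.word.length else 0, x.coord.2) := by
  refine Prod.ext ?_ (show (x.mateEnd v u).2 = _ by rw [mateEnd_of_closing v hx])
  change ((sideLevel (sideGap x.1 u) (x.mateEnd v u).1 : Fin _) : ℕ) = _
  rw [sideGap_eq_last hx, mateEnd_of_closing v hx]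
  cases u <;> simp [sideLevel]

theorem event_or_closing (x : D.Point) (u : Bool) :
    (∃ h < D.word.length, x.coord = (h + u.toNat, (x.2 : ℕ))) ∨
      x.coord.1 = if u then 0 else D.word.length := by
  obtain ⟨⟨h, hh⟩, p⟩ := x
  cases u
  · rcases (Nat.lt_succ_iff.1 hh).lt_or_eq with hlt | heq
    · exact Or.inl ⟨h, hlt, rfl⟩
    · exact Or.inr heq
  · cases h with
    | zero => exact Or.inr rfl
    | succ h => exact Or.inl ⟨h, Nat.lt_of_succ_lt_succ hh, rfl⟩

end Point

theorem Arc.exists_event_or_closing {x y : ℕ × ℕ} (h : D.Arc v x y) :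
    (∃ (t : ℕ) (ht : t < D.word.length) (u : Bool), x.1 = t + u.toNat ∧
      y = (t + ((D.word[t]).mate (horizontal v t) (u, x.2)).1.toNat,
        ((D.word[t]).mate (horizontal v t) (u, x.2)).2)) ∨
      x.1 = D.word.length ∧ y = (0, x.2) := by
  have of_event (t : ℕ) (e : AnnularEvent) (he : D.word[t]? = some e) (u : Bool)
      (hx : x.1 = t + u.toNat) (hy : y = (t + (e.mate (horizontal v t) (u, x.2)).1.toNat,
        (e.mate (horizontal v t) (u, x.2)).2)) :
      ∃ (t : ℕ) (ht : t < D.word.length) (u : Bool), x.1 = t + u.toNat ∧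
        y = (t + ((D.word[t]).mate (horizontal v t) (u, x.2)).1.toNat,
          ((D.word[t]).mate (horizontal v t) (u, x.2)).2) := by
    obtain ⟨ht, rfl⟩ := List.getElem?_eq_some_iff.1 he
    exact ⟨t, ht, u, hx, hy⟩
  have of_crossing (c : D.Crossing) : D.word[c.time]? = some (.cross c.pos c.risingOver) :=
    List.getElem?_eq_some_iff.2 ⟨c.time_lt, c.word_time⟩
  cases h with
  | close p => exact Or.inr ⟨rfl, rfl⟩
  | birth t i b e => exact Or.inl (of_event t _ e true rfl (by simp [AnnularEvent.mate]))
  | birth_left t i p b e hp =>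
    exact Or.inl (of_event t _ e false rfl (by simp [AnnularEvent.mate, hp]))
  | birth_right t i p b e hp =>
    exact Or.inl (of_event t _ e false rfl (by simp [AnnularEvent.mate, not_lt.2 hp]))
  | death t i e => exact Or.inl (of_event t _ e false rfl (by simp [AnnularEvent.mate]))
  | death_left t i p e hp =>
    exact Or.inl (of_event t _ e false rfl (by simp [AnnularEvent.mate, hp]))
  | death_right t i p e hp =>
    refine Or.inl (of_event t _ e false rfl ?_)
    simp [AnnularEvent.mate, show ¬ p + 2 < i by omega, show ¬ p + 2 = i by omega,
      show ¬ p + 2 = i + 1 by omega]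
  | cross_other c p hp hp' =>
    exact Or.inl (of_event _ _ (of_crossing c) false rfl (by simp [AnnularEvent.mate, hp, hp']))
  | vertical_left c hc | vertical_right c hc | horizontal_bottom c hc =>
    exact Or.inl (of_event _ _ (of_crossing c) false rfl
      (by simp [AnnularEvent.mate, horizontal_time, hc]))
  | horizontal_top c hc =>
    exact Or.inl (of_event _ _ (of_crossing c) true rfl
      (by simp [AnnularEvent.mate, horizontal_time, hc]))

theorem exists_mate_of_arc {x y : D.Point} (h : D.Arc v x.coord y.coord) :
    ∃ u, x.mate v u = y := by
  rcases h.exists_event_or_closing with ⟨t, ht, u, hx, hy⟩ | ⟨hx, hy⟩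
  · exact ⟨u, Point.coord_injective ((Point.coord_mate_of_coord v ht (Prod.ext hx rfl)).trans
      hy.symm)⟩
  · exact ⟨false, Point.coord_injective ((Point.coord_mate_of_closing v hx).trans hy.symm)⟩

theorem arc_birth_mate {h i : ℕ} {b : Bool} (e : D.word[h]? = some (.birth i b)) (hz : Bool)
    (u : Bool) (p : ℕ) :
    Arc D v (h + u.toNat, p) (h + ((AnnularEvent.birth i b).mate hz (u, p)).1.toNat,
        ((AnnularEvent.birth i b).mate hz (u, p)).2) ∨
      Arc D v (h + ((AnnularEvent.birth i b).mate hz (u, p)).1.toNat,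
        ((AnnularEvent.birth i b).mate hz (u, p)).2) (h + u.toNat, p) := by
  have hleft := Arc.birth_left (v := v) h i p b e
  cases u
  · by_cases h1 : p < i
    · simpa [AnnularEvent.mate, h1] using Or.inl (hleft h1)
    · simpa [AnnularEvent.mate, h1] using Or.inl (Arc.birth_right h i p b e (not_lt.1 h1))
  · by_cases h1 : p < i
    · simpa [AnnularEvent.mate, h1] using Or.inr (hleft h1)
    · rcases eq_or_ne p i with rfl | h2
      · simpa [AnnularEvent.mate] using Or.inl (Arc.birth h p b e)
      · rcases eq_or_ne p (i + 1) with rfl | h3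
        · simpa [AnnularEvent.mate] using Or.inr (Arc.birth h i b e)
        · obtain ⟨q, rfl⟩ : ∃ q, p = q + 2 := ⟨p - 2, by omega⟩
          simpa [AnnularEvent.mate, h1, h2, h3] using
            Or.inr (Arc.birth_right h i q b e (by omega))

theorem arc_death_mate {h i : ℕ} (e : D.word[h]? = some (.death i)) (hz : Bool)
    (u : Bool) (p : ℕ) :
    Arc D v (h + u.toNat, p) (h + ((AnnularEvent.death i).mate hz (u, p)).1.toNat,
        ((AnnularEvent.death i).mate hz (u, p)).2) ∨
      Arc D v (h + ((AnnularEvent.death i).mate hz (u, p)).1.toNat,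
        ((AnnularEvent.death i).mate hz (u, p)).2) (h + u.toNat, p) := by
  have hleft := Arc.death_left (v := v) h i p e
  cases u
  · by_cases h1 : p < i
    · simpa [AnnularEvent.mate, h1] using Or.inl (hleft h1)
    · rcases eq_or_ne p i with rfl | h2
      · simpa [AnnularEvent.mate] using Or.inl (Arc.death h p e)
      · rcases eq_or_ne p (i + 1) with rfl | h3
        · simpa [AnnularEvent.mate] using Or.inr (Arc.death h i e)
        · obtain ⟨q, rfl⟩ : ∃ q, p = q + 2 := ⟨p - 2, by omega⟩
          simpa [AnnularEvent.mate, h1, h2, h3] using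
            Or.inl (Arc.death_right h i q e (by omega))
  · by_cases h1 : p < i
    · simpa [AnnularEvent.mate, h1] using Or.inr (hleft h1)
    · simpa [AnnularEvent.mate, h1] using Or.inr (Arc.death_right h i p e (not_lt.1 h1))

theorem arc_cross_mate (c : D.Crossing) (u : Bool) (p : ℕ) {e : AnnularEvent}
    (he : e = .cross c.pos c.risingOver) :
    Arc D v (c.time + u.toNat, p) (c.time + (e.mate (horizontal v c.time) (u, p)).1.toNat,
        (e.mate (horizontal v c.time) (u, p)).2) ∨
      Arc D v (c.time + (e.mate (horizontal v c.time) (u, p)).1.toNat,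
        (e.mate (horizontal v c.time) (u, p)).2) (c.time + u.toNat, p) := by
  subst he
  rw [horizontal_time]
  by_cases hc : v c = c.risingOver
  · rcases eq_or_ne p c.pos with rfl | h1
    · cases u
      · simpa [AnnularEvent.mate, hc] using Or.inl (Arc.horizontal_bottom c hc)
      · simpa [AnnularEvent.mate, hc] using Or.inl (Arc.horizontal_top c hc)
    · rcases eq_or_ne p (c.pos + 1) with rfl | h2
      · cases u
        · simpa [AnnularEvent.mate, hc] using Or.inr (Arc.horizontal_bottom c hc)
        · simpa [AnnularEvent.mate, hc] using Or.inr (Arc.horizontal_top c hc)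
      · have hv := Arc.cross_other (v := v) c p h1 h2
        cases u <;> simp [AnnularEvent.mate, h1, h2, hv]
  · have hv : Arc D v (c.time, p) (c.time + 1, p) := by
      rcases eq_or_ne p c.pos with rfl | h1
      · exact Arc.vertical_left c hc
      · rcases eq_or_ne p (c.pos + 1) with rfl | h2
        · exact Arc.vertical_right c hc
        · exact Arc.cross_other c p h1 h2
    cases u <;> simp [AnnularEvent.mate, hc, hv]

theorem circleSetoid_mate (v : D.Resolution) (x : D.Point) (u : Bool) :
    D.circleSetoid v x (x.mate v u) := by
  have harc : Arc D v x.coord (x.mate v u).coord ∨ Arc D v (x.mate v u).coord x.coord := by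
    rcases x.event_or_closing u with ⟨h, hh, hx⟩ | hx
    · rw [Point.coord_mate_of_coord v hh hx, hx]
      have he : D.word[h]? = some D.word[h] := List.getElem?_eq_getElem hh
      cases hw : D.word[h] with
      | birth i b => exact arc_birth_mate (hw ▸ he) _ u _
      | death i => exact arc_death_mate (hw ▸ he) _ u _
      | cross i s =>
        obtain ⟨c, rfl, rfl, rfl⟩ := exists_crossing hh hw
        exact arc_cross_mate c u _ rfl
    · rw [Point.coord_mate_of_closing v hx, ← Prod.mk.eta (p := x.coord), hx]
      cases u
      · exact Or.inl (Arc.close _)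
      · exact Or.inr (Arc.close _)
  rcases harc with h | h
  · exact .rel _ _ h
  · exact .symm _ _ (.rel _ _ h)

theorem circleSetoid_le {r : Setoid D.Point} (h : ∀ x u, r x (x.mate v u)) :
    D.circleSetoid v ≤ r := by
  refine Setoid.eqvGen_le fun x y hxy => ?_
  obtain ⟨u, rfl⟩ := exists_mate_of_arc hxy
  exact h x u

namespace Point

/-- The successor of a point on its circle, when the strands in positions of the parity of `b` are
directed upwards and the other ones downwards. -/
noncomputable def next (v : D.Resolution) (b : Bool) (x : D.Point) : D.Point :=
  x.mate v (b ^^ x.coord.2.bodd)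

theorem next_next (v : D.Resolution) (b : Bool) (x : D.Point) :
    (x.next v b).next v (!b) = x := by
  have hside : ((!b) ^^ (x.next v b).coord.2.bodd) = (x.mateEnd v (b ^^ x.coord.2.bodd)).1 := by
    have := x.mateEnd_parity v (b ^^ x.coord.2.bodd)
    rw [next]
    grind
  rw [next, hside]
  exact x.mate_mate v _

end Point

/-- The permutation of the points whose cycles are the circles of a complete resolution. -/
noncomputable def nextPerm (v : D.Resolution) (b : Bool) : Equiv.Perm D.Point where
  toFun := Point.next v b
  invFun := Point.next v (!b)
  left_inv := Point.next_next v b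
  right_inv x := by simpa using x.next_next v (!b)

theorem sameCycle_nextPerm_mate (v : D.Resolution) (b : Bool) (x : D.Point) (u : Bool) :
    (nextPerm v b).SameCycle x (x.mate v u) := by
  by_cases hu : u = (b ^^ x.coord.2.bodd)
  · exact hu ▸ (Equiv.Perm.SameCycle.refl _ x).apply_right
  · have hu' : u = ((!b) ^^ x.coord.2.bodd) := by rwa [Bool.not_xor, Bool.eq_not]
    exact hu' ▸ ⟨-1, by rw [zpow_neg_one]; rfl⟩

theorem circleSetoid_eq (v : D.Resolution) (b : Bool) :
    D.circleSetoid v = Equiv.Perm.SameCycle.setoid (nextPerm v b) :=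
  le_antisymm (circleSetoid_le (sameCycle_nextPerm_mate v b))
    (sameCycle_setoid_le fun x => circleSetoid_mate v x _)

theorem Crossing.lowerLeft_ne_upperRight (c : D.Crossing) : c.lowerLeft ≠ c.upperRight := by
  intro h
  have : c.time = c.time + 1 := congrArg (fun x : D.Point => x.coord.1) h
  omega

theorem Crossing.next_lowerLeft {c : D.Crossing} (hc : v' c ≠ v c) :
    c.lowerLeft.next v' c.pos.bodd = c.upperRight.next v c.pos.bodd := by
  have hflip : decide (v' c = c.risingOver) = !decide (v c = c.risingOver) := by
    revert hc
    cases v c <;> cases v' c <;> cases c.risingOver <;> decide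
  apply Point.coord_injective
  have hleft : (c.pos.bodd ^^ c.lowerLeft.coord.2.bodd) = false := Bool.xor_self _
  have hright : (c.pos.bodd ^^ c.upperRight.coord.2.bodd) = true := by
    simp [show c.upperRight.coord.2 = c.pos + 1 from rfl, Nat.bodd_succ]
  rw [Point.next, Point.next, hleft, hright,
    Point.coord_mate_of_coord v' c.time_lt (p := c.pos) rfl,
    Point.coord_mate_of_coord v c.time_lt (p := c.pos + 1) rfl,
    c.word_time, horizontal_time, horizontal_time, hflip]
  cases decide (v c = c.risingOver) <;> simp [AnnularEvent.mate]

theorem next_congr {c : D.Crossing} (h : ∀ c', c' ≠ c → v' c' = v c') {x : D.Point}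
    (hleft : x ≠ c.lowerLeft) (hright : x ≠ c.upperRight) :
    x.next v' c.pos.bodd = x.next v c.pos.bodd := by
  apply Point.coord_injective
  rw [Point.next, Point.next]
  generalize hu : (c.pos.bodd ^^ x.coord.2.bodd) = u
  rcases x.event_or_closing u with ⟨t, ht, hx⟩ | hx
  · rw [Point.coord_mate_of_coord v' ht hx, Point.coord_mate_of_coord v ht hx]
    rcases eq_or_ne t c.time with rfl | htc
    · have hp : (x.2 : ℕ) ≠ c.pos ∧ (x.2 : ℕ) ≠ c.pos + 1 := by
        rw [hx] at hu
        constructor <;> intro hp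
        · obtain rfl : false = u := by simpa [hp] using hu
          exact hleft (Point.coord_injective (hx.trans (by rw [hp]; rfl)))
        · obtain rfl : true = u := by simpa [hp, Nat.bodd_succ] using hu
          exact hright (Point.coord_injective (hx.trans (by rw [hp]; rfl)))
      simp [c.word_time, AnnularEvent.mate, hp]
    · rw [horizontal_congr h htc]
  · rw [Point.coord_mate_of_closing v' hx, Point.coord_mate_of_closing v hx]

open Classical in
theorem nextPerm_eq_mul_swap {c : D.Crossing} (h : ∀ c', c' ≠ c → v' c' = v c')
    (hc : v' c ≠ v c) : nextPerm v' c.pos.bodd =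
      nextPerm v c.pos.bodd * Equiv.swap c.lowerLeft c.upperRight := by
  ext1 x
  change x.next v' _ = (Equiv.swap _ _ x).next v _
  rcases eq_or_ne x c.lowerLeft with rfl | hleft
  · rw [Equiv.swap_apply_left, Crossing.next_lowerLeft hc]
  · rcases eq_or_ne x c.upperRight with rfl | hright
    · rw [Equiv.swap_apply_right, ← Crossing.next_lowerLeft hc.symm]
    · rw [Equiv.swap_apply_of_ne_of_ne hleft hright, next_congr h hleft hright]

theorem isMerge_circleSetoid {c : D.Crossing} (h : ∀ c', c' ≠ c → v' c' = v c')
    (hc : v' c ≠ v c) (hn : ¬ D.circleSetoid v c.lowerLeft c.upperRight) :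
    IsMerge (D.circleSetoid v) (D.circleSetoid v') c.lowerLeft c.upperRight := by
  classical
  rw [circleSetoid_eq v c.pos.bodd] at hn ⊢
  rw [circleSetoid_eq v' c.pos.bodd, nextPerm_eq_mul_swap h hc]
  exact isMerge_mul_swap hn

theorem isMerge_circleSetoid_of_rel {c : D.Crossing} (h : ∀ c', c' ≠ c → v' c' = v c')
    (hc : v' c ≠ v c) (hn : D.circleSetoid v c.lowerLeft c.upperRight) :
    IsMerge (D.circleSetoid v') (D.circleSetoid v) c.lowerLeft c.upperRight := by
  classical
  rw [circleSetoid_eq v c.pos.bodd] at hn ⊢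
  rw [circleSetoid_eq v' c.pos.bodd, nextPerm_eq_mul_swap h hc]
  exact isMerge_of_mul_swap c.lowerLeft_ne_upperRight hn

end OrientedAnnularDiagram

namespace OrientedAnnularDiagram

variable {D : OrientedAnnularDiagram}

theorem circleOf_eq_iff {v : D.Resolution} {x y : D.Point} :
    D.circleOf v x = D.circleOf v y ↔ D.circleSetoid v x y :=
  ⟨fun h => Quotient.exact h, fun h => Quotient.sound h⟩

theorem circleOf_out (v : D.Resolution) (C : D.Circle v) : D.circleOf v C.out = C :=
  Quotient.out_eq C

theorem EnhancedState.ext_circleOf {S T : D.EnhancedState} (hv : S.1 = T.1)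
    (hl : ∀ x, S.2 (D.circleOf S.1 x) = T.2 (D.circleOf T.1 x)) : S = T := by
  obtain ⟨v, l⟩ := S
  obtain ⟨v', l'⟩ := T
  obtain rfl : v = v' := hv
  congr 1
  funext C
  induction C using Quotient.inductionOn with | h x => exact hl x

section Edge

/-- The circle of the resolution `v` through the point `x` meets the crossing `c`. -/
def Meets (v : D.Resolution) (c : D.Crossing) (x : D.Point) : Prop :=
  D.circleSetoid v x c.lowerLeft ∨ D.circleSetoid v x c.upperRight

variable {v v' : D.Resolution} {c : D.Crossing}

theorem meets_iff_and_rel_iff (h : ∀ c', c' ≠ c → v' c' = v c') (hc : v' c ≠ v c) {x y : D.Point} :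
    (Meets v' c x ↔ Meets v c x) ∧
      (¬ Meets v c x → (D.circleSetoid v' x y ↔ D.circleSetoid v x y)) := by
  have of_merge {v v' : D.Resolution} (hm : IsMerge (D.circleSetoid v) (D.circleSetoid v')
      c.lowerLeft c.upperRight) : (Meets v' c x ↔ Meets v c x) ∧
      (¬ Meets v c x → (D.circleSetoid v' x y ↔ D.circleSetoid v x y)) := by
    have hright : D.circleSetoid v' x c.upperRight ↔ D.circleSetoid v' x c.lowerLeft :=
      ⟨fun hx => Setoid.trans' _ hx (Setoid.symm' _ hm.rel),
        fun hx => Setoid.trans' _ hx hm.rel⟩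
    refine ⟨by rw [Meets, hright, or_self]; exact hm.rel_left_iff, fun hx => ⟨fun hxy => ?_,
      fun hxy => hm.le hxy⟩⟩
    refine (hm.rel_iff_of_not (fun hs => hx (Or.inr hs)) fun hs => hx ?_).1 hxy
    exact hm.rel_left_iff.1 (hright.1 (Setoid.trans' _ hxy (hm.le hs)))
  by_cases hr : D.circleSetoid v c.lowerLeft c.upperRight
  · obtain ⟨hmeets, hrel⟩ := of_merge (isMerge_circleSetoid_of_rel h hc hr)
    exact ⟨hmeets.symm, fun hx => (hrel (mt hmeets.2 hx)).symm⟩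
  · exact of_merge (isMerge_circleSetoid h hc hr)

theorem update_ne_self {b : Bool} (hc : v c = !b) : Function.update v c b c ≠ v c := by
  simp [hc]

theorem rel_update_iff (hc : v c = false) :
    D.circleSetoid (Function.update v c true) c.lowerLeft c.upperRight ↔
      ¬ D.circleSetoid v c.lowerLeft c.upperRight := by
  have h (c') (hc' : c' ≠ c) : Function.update v c true c' = v c' := Function.update_of_ne hc' ..
  by_cases hr : D.circleSetoid v c.lowerLeft c.upperRight
  · exact iff_of_false (isMerge_circleSetoid_of_rel h (update_ne_self hc) hr).not_rel (not_not.2 hr)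
  · exact iff_of_true (isMerge_circleSetoid h (update_ne_self hc) hr).rel hr

variable {S T : D.EnhancedState}

theorem meets_update_iff (hc : S.1 c = false) {x : D.Point} :
    Meets (Function.update S.1 c true) c x ↔ Meets S.1 c x :=
  (meets_iff_and_rel_iff (y := x) (fun _ h => Function.update_of_ne h ..) (update_ne_self hc)).1

open Classical in
/-- The enhanced state at the end of an edge with labels `z` and `w` of the circles through the
lower left and the upper right end of the crossing; if these are the same circle, its label is
`z`. -/
noncomputable def edgeState (S : D.EnhancedState) {c : D.Crossing} (hc : S.1 c = false)
    (z w : Bool) : D.EnhancedState :=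
  ⟨Function.update S.1 c true, Quotient.lift (fun x =>
    if D.circleSetoid (Function.update S.1 c true) x c.lowerLeft then z
    else if D.circleSetoid (Function.update S.1 c true) x c.upperRight then w
    else S.2 (D.circleOf S.1 x)) (by
      intro x y hxy
      change D.circleSetoid _ x y at hxy
      have hiff (q) : D.circleSetoid (Function.update S.1 c true) x q ↔
          D.circleSetoid (Function.update S.1 c true) y q :=
        ⟨Setoid.trans' _ (Setoid.symm' _ hxy), Setoid.trans' _ hxy⟩
      simp only [← hiff]
      split_ifs with hl hr
      · rfl
      · rfl
      · exact congrArg S.2 (circleOf_eq_iff.2 (((meets_iff_and_rel_iff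
          (fun _ h => Function.update_of_ne h ..) (update_ne_self hc)).2
          (mt (meets_update_iff hc).2 (not_or.2 ⟨hl, hr⟩))).1 hxy)))⟩

open Classical in
theorem edgeState_label (hc : S.1 c = false) (z w : Bool) (x : D.Point) :
    (edgeState S hc z w).2 (D.circleOf (Function.update S.1 c true) x) =
      if D.circleSetoid (Function.update S.1 c true) x c.lowerLeft then z
      else if D.circleSetoid (Function.update S.1 c true) x c.upperRight then w
      else S.2 (D.circleOf S.1 x) := rfl

theorem edgeState_lowerLeft (hc : S.1 c = false) (z w : Bool) :
    (edgeState S hc z w).2 (D.circleOf (Function.update S.1 c true) c.lowerLeft) = z := by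
  rw [edgeState_label, if_pos (Setoid.refl' _ _)]

theorem edgeState_upperRight (hc : S.1 c = false) (z w : Bool)
    (hr : D.circleSetoid S.1 c.lowerLeft c.upperRight) :
    (edgeState S hc z w).2 (D.circleOf (Function.update S.1 c true) c.upperRight) = w := by
  rw [edgeState_label, if_neg fun h => (rel_update_iff hc).1 (Setoid.symm' _ h) hr,
    if_pos (Setoid.refl' _ _)]

theorem edgeState_of_not_meets (hc : S.1 c = false) (z w : Bool) {x : D.Point}
    (hx : ¬ Meets S.1 c x) : (edgeState S hc z w).2 (D.circleOf (Function.update S.1 c true) x) =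
      S.2 (D.circleOf S.1 x) := by
  obtain ⟨hl, hr⟩ := not_or.1 (mt (meets_update_iff hc).1 hx)
  rw [edgeState_label, if_neg hl, if_neg hr]

theorem isEdge_edgeState (hc : S.1 c = false) (z w : Bool) :
    D.IsEdge c S (edgeState S hc z w) :=
  ⟨hc, Function.update_self _ _ _, fun _ h => Function.update_of_ne h .., fun _ hl hr =>
    edgeState_of_not_meets hc z w (not_or.2 ⟨mt circleOf_eq_iff.2 hl, mt circleOf_eq_iff.2 hr⟩)⟩

theorem IsEdge.fst_eq (h : D.IsEdge c S T) : T.1 = Function.update S.1 c true :=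
  Function.eq_update_iff.2 ⟨h.2.1, h.2.2.1⟩

theorem IsEdge.eq_edgeState (h : D.IsEdge c S T) : T = edgeState S h.1
    (T.2 (D.circleOf T.1 c.lowerLeft)) (T.2 (D.circleOf T.1 c.upperRight)) := by
  have hv := h.fst_eq
  refine EnhancedState.ext_circleOf hv fun x => ?_
  change _ = (edgeState S h.1 _ _).2 (D.circleOf (Function.update S.1 c true) x)
  by_cases hx : Meets S.1 c x
  · rw [edgeState_label, ← hv]
    rw [← meets_update_iff h.1, ← hv] at hx
    split_ifs with hl hr
    · rw [circleOf_eq_iff.2 hl]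
    · rw [circleOf_eq_iff.2 hr]
    · exact (not_or.2 ⟨hl, hr⟩ hx).elim
  · rw [edgeState_of_not_meets h.1 _ _ hx]
    exact h.2.2.2 x (fun hl => hx (Or.inl (circleOf_eq_iff.1 hl)))
      fun hr => hx (Or.inr (circleOf_eq_iff.1 hr))

open Classical in
theorem sum_isEdge_of_merge (hc : S.1 c = false)
    (hn : ¬ D.circleSetoid S.1 c.lowerLeft c.upperRight) (F : D.EnhancedState → ℂ) :
    ∑ T with D.IsEdge c S T, F T = ∑ z : Bool, F (edgeState S hc z z) := by
  refine Finset.sum_bij' (fun T _ => T.2 (D.circleOf T.1 c.lowerLeft))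
    (fun z _ => edgeState S hc z z) (fun _ _ => Finset.mem_univ _) (fun z _ => by
      simpa using isEdge_edgeState hc z z) ?_ (fun z _ => edgeState_lowerLeft hc z z) ?_
  all_goals
    intro T hT
    have hT : D.IsEdge c S T := by simpa using hT
    have hsame : D.circleOf T.1 c.upperRight = D.circleOf T.1 c.lowerLeft := by
      rw [hT.fst_eq]
      exact (circleOf_eq_iff.2 ((rel_update_iff hc).2 hn)).symm
    have := hT.eq_edgeState
    rw [hsame] at this
    simp only [← this]

open Classical in
theorem sum_isEdge_of_split (hc : S.1 c = false)
    (hr : D.circleSetoid S.1 c.lowerLeft c.upperRight) (F : D.EnhancedState → ℂ) :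
    ∑ T with D.IsEdge c S T, F T = ∑ z : Bool, ∑ w : Bool, F (edgeState S hc z w) := by
  rw [← Fintype.sum_prod_type']
  refine Finset.sum_bij'
    (fun T _ => (T.2 (D.circleOf T.1 c.lowerLeft), T.2 (D.circleOf T.1 c.upperRight)))
    (fun z _ => edgeState S hc z.1 z.2) (fun _ _ => Finset.mem_univ _) (fun z _ => by
      simpa using isEdge_edgeState hc z.1 z.2) ?_ (fun z _ => Prod.ext (edgeState_lowerLeft hc ..)
      (edgeState_upperRight hc _ _ hr)) ?_
  all_goals
    intro T hT
    have hT : D.IsEdge c S T := by simpa using hT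
    simp only [← hT.eq_edgeState]

end Edge

section Evaluation

/-- A square root of `2 X` at the root `X = 1` (`true`) or `X = -1` (`false`) of `X ^ 2 - 1`.  Here
`2 X` is the value of `Δ 1`, by which a split map acts on evaluations. -/
noncomputable def colourRoot (e : Bool) : ℂ :=
  if e then (Real.sqrt 2 : ℂ) else Complex.I * (Real.sqrt 2 : ℂ)

theorem colourRoot_sq (e : Bool) : colourRoot e ^ 2 = if e then 2 else -2 := by
  have hsq : (Real.sqrt 2 : ℂ) ^ 2 = 2 := by
    rw [← Complex.ofReal_pow, Real.sq_sqrt (by norm_num)]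
    norm_num
  cases e <;> simp [colourRoot, mul_pow, hsq]

theorem colourRoot_ne_zero (e : Bool) : colourRoot e ≠ 0 := by
  cases e <;> simp [colourRoot]

/-- The value of the label `v₊ = 1` (`true`) or `v₋ = X` (`false`) at the root `X = 1` (`true`) or
`X = -1` (`false`) of `X ^ 2 - 1`, divided by `colourRoot`.  This normalization makes merge and
split maps act on evaluations by the same factor. -/
noncomputable def labelValue (l e : Bool) : ℂ := (if l || e then 1 else -1) / colourRoot e

theorem labelValue_ne_zero (l e : Bool) : labelValue l e ≠ 0 :=
  div_ne_zero (by split_ifs <;> simp) (colourRoot_ne_zero e)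

theorem sum_leeMul_mul_labelValue (a b e : Bool) :
    ∑ z, leeMul a b z * labelValue z e =
      colourRoot e * (labelValue a e * labelValue b e) := by
  have := colourRoot_ne_zero e
  rw [Fintype.sum_bool]
  cases a <;> cases b <;> cases e <;> simp [leeMul, labelValue] <;> field_simp

theorem sum_leeComul_mul_labelValue (a e e' : Bool) :
    ∑ z, ∑ w, leeComul a z w * (labelValue z e * labelValue w e') =
      if e = e' then colourRoot e * labelValue a e else 0 := by
  have he := colourRoot_ne_zero e
  have he' := colourRoot_ne_zero e'
  have hsq := colourRoot_sq e
  simp only [Fintype.sum_bool]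
  cases a <;> cases e <;> cases e' <;> simp [leeComul, labelValue] at * <;> field_simp <;>
    simp [hsq] <;> norm_num

theorem sum_colourRoot_sq_mul_labelValue (l l' : Bool) :
    ∑ e, colourRoot e ^ 2 * (labelValue l e * labelValue l' e) = if l = l' then 2 else 0 := by
  have ht := colourRoot_ne_zero true
  have hf := colourRoot_ne_zero false
  rw [Fintype.sum_bool]
  cases l <;> cases l' <;> simp [labelValue] <;> field_simp <;> norm_num

/-- The colouring `ε` of the points is constant on the circles of `v`. -/
def Compatible (v : D.Resolution) (ε : D.Point → Bool) : Prop :=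
  ∀ ⦃x y⦄, D.circleSetoid v x y → ε x = ε y

variable {v : D.Resolution} {c : D.Crossing} {ε : D.Point → Bool} {S : D.EnhancedState}

theorem Compatible.out (h : Compatible v ε) (x : D.Point) : ε (D.circleOf v x).out = ε x :=
  h (Quotient.mk_out x)

theorem compatible_circleOf (e : D.Circle v → Bool) : Compatible v fun x => e (D.circleOf v x) :=
  fun _ _ hxy => congrArg e (circleOf_eq_iff.2 hxy)

theorem Compatible.update (hε : Compatible v ε) {b : Bool} (hc : v c = !b)
    (he : ε c.lowerLeft = ε c.upperRight) : Compatible (Function.update v c b) ε := by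
  have h (c') (hc' : c' ≠ c) : Function.update v c b c' = v c' := Function.update_of_ne hc' ..
  have hker : D.circleSetoid v ≤ Setoid.ker ε := hε
  change D.circleSetoid (Function.update v c b) ≤ Setoid.ker ε
  by_cases hr : D.circleSetoid v c.lowerLeft c.upperRight
  · exact (isMerge_circleSetoid_of_rel h (update_ne_self hc) hr).le.trans hker
  · rw [(isMerge_circleSetoid h (update_ne_self hc) hr).eq_mergeClasses]
    exact mergeClasses_le hker he

/-- The product over the circles of an enhanced state of a quantity that depends on their labels and
on their colours. -/
noncomputable def circleProd {M : Type*} [CommMonoid M] (g : Bool → Bool → M)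
    (ε : D.Point → Bool) (S : D.EnhancedState) : M :=
  ∏ C : D.Circle S.1, g (S.2 C) (ε C.out)

section circleProd

variable {M : Type*} [CommMonoid M] (g : Bool → Bool → M)

theorem circleProd_edgeState_of_merge (hc : S.1 c = false)
    (hε : Compatible (Function.update S.1 c true) ε)
    (hn : ¬ D.circleSetoid S.1 c.lowerLeft c.upperRight) (z w : Bool) :
    circleProd g ε S * g z (ε c.lowerLeft) =
      g (S.2 (D.circleOf S.1 c.lowerLeft)) (ε c.lowerLeft) *
        g (S.2 (D.circleOf S.1 c.upperRight)) (ε c.upperRight) *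
          circleProd g ε (edgeState S hc z w) := by
  have hm := isMerge_circleSetoid (v' := Function.update S.1 c true)
    (fun _ h => Function.update_of_ne h ..) (update_ne_self hc) hn
  have hε' : Compatible S.1 ε := fun x y h => hε (hm.le h)
  have := hm.prod_mul_eq (fun C => g (S.2 C) (ε C.out))
    (fun C => g ((edgeState S hc z w).2 C) (ε C.out)) fun x hx => by
      rw [← circleOf, ← circleOf, hε.out, hε'.out, edgeState_of_not_meets hc z w
        fun h => hx (hm.rel_left_iff.2 h)]
  rwa [← circleOf, ← circleOf, ← circleOf, hε.out, hε'.out, hε'.out, edgeState_lowerLeft] at this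

theorem circleProd_edgeState_of_split (hc : S.1 c = false)
    (hε : Compatible (Function.update S.1 c true) ε)
    (hr : D.circleSetoid S.1 c.lowerLeft c.upperRight) (he : ε c.lowerLeft = ε c.upperRight)
    (z w : Bool) :
    circleProd g ε (edgeState S hc z w) *
        g (S.2 (D.circleOf S.1 c.lowerLeft)) (ε c.lowerLeft) =
      g z (ε c.lowerLeft) * g w (ε c.upperRight) * circleProd g ε S := by
  have hm := isMerge_circleSetoid_of_rel (v' := Function.update S.1 c true)
    (fun _ h => Function.update_of_ne h ..) (update_ne_self hc) hr
  have hε' : Compatible S.1 ε := by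
    have := hε.update (c := c) (b := false) (Function.update_self ..) he
    rwa [Function.update_idem, ← hc, Function.update_eq_self] at this
  have := hm.prod_mul_eq (fun C => g ((edgeState S hc z w).2 C) (ε C.out))
    (fun C => g (S.2 C) (ε C.out)) fun x hx => by
      rw [← circleOf, ← circleOf, hε.out, hε'.out, edgeState_of_not_meets hc z w
        fun h => hx (hm.rel_left_iff.2 ((meets_update_iff hc).2 h))]
  rwa [← circleOf, ← circleOf, ← circleOf, hε'.out, hε.out, hε.out, edgeState_lowerLeft,
    edgeState_upperRight hc z w hr] at this

end circleProd

theorem exists_circleProd_edgeState_eq (hc : S.1 c = false)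
    (hε : Compatible (Function.update S.1 c true) ε)
    (hr : D.circleSetoid S.1 c.lowerLeft c.upperRight) : ∃ K : ℂ, ∀ z w,
      circleProd labelValue ε (edgeState S hc z w) =
        K * (labelValue z (ε c.lowerLeft) * labelValue w (ε c.upperRight)) := by
  classical
  set v' := Function.update S.1 c true
  have hne : D.circleOf v' c.upperRight ≠ D.circleOf v' c.lowerLeft := fun h =>
    (rel_update_iff hc).1 (Setoid.symm' _ (circleOf_eq_iff.1 h)) hr
  let others := (Finset.univ.erase (D.circleOf v' c.lowerLeft)).erase (D.circleOf v' c.upperRight)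
  have hvalue (l : D.Circle v' → Bool) : circleProd labelValue ε ⟨v', l⟩ =
      labelValue (l (D.circleOf v' c.lowerLeft)) (ε c.lowerLeft) *
        (labelValue (l (D.circleOf v' c.upperRight)) (ε c.upperRight) *
          ∏ C ∈ others, labelValue (l C) (ε C.out)) := by
    rw [circleProd, ← Finset.mul_prod_erase _ _ (Finset.mem_univ (D.circleOf v' c.lowerLeft)),
      ← Finset.mul_prod_erase _ _ (Finset.mem_erase.2 ⟨hne, Finset.mem_univ _⟩), hε.out, hε.out]
  refine ⟨∏ C ∈ others, labelValue ((edgeState S hc true true).2 C) (ε C.out), fun z w => ?_⟩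
  have hothers : ∏ C ∈ others, labelValue ((edgeState S hc true true).2 C) (ε C.out) =
      ∏ C ∈ others, labelValue ((edgeState S hc z w).2 C) (ε C.out) := by
    refine Finset.prod_congr rfl fun C hC => ?_
    induction C using Quotient.inductionOn with | h x
    simp only [others, Finset.mem_erase, Finset.mem_univ, and_true] at hC
    have hx : ¬ Meets S.1 c x := fun h => ((meets_update_iff hc).2 h).elim
      (fun h => hC.2 (Quotient.sound h)) (fun h => hC.1 (Quotient.sound h))
    rw [← circleOf, edgeState_of_not_meets hc _ _ hx, edgeState_of_not_meets hc _ _ hx]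
  rw [hothers]
  calc circleProd labelValue ε (edgeState S hc z w) = _ := hvalue (edgeState S hc z w).2
    _ = labelValue z (ε c.lowerLeft) * (labelValue w (ε c.upperRight) * _) :=
      congrArg₂ (fun a b => labelValue a _ * (labelValue b _ * _)) (edgeState_lowerLeft hc z w)
        (edgeState_upperRight hc z w hr)
    _ = _ := by ring

theorem saddleCoeff_edgeState (hc : S.1 c = false) (z w : Bool) [Decidable
    (D.circleSetoid S.1 c.lowerLeft c.upperRight)] : D.saddleCoeff c S (edgeState S hc z w) =
      if D.circleSetoid S.1 c.lowerLeft c.upperRight then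
        leeComul (S.2 (D.circleOf S.1 c.lowerLeft)) z w
      else leeMul (S.2 (D.circleOf S.1 c.lowerLeft)) (S.2 (D.circleOf S.1 c.upperRight)) z := by
  have hl := edgeState_lowerLeft hc z w
  simp only [saddleCoeff, ne_eq, circleOf_eq_iff, ite_not]
  split_ifs with hr
  · exact congrArg₂ _ hl (edgeState_upperRight hc z w hr)
  · exact congrArg _ hl

open Classical in
theorem sum_isEdge_circleProd (hc : S.1 c = false)
    (hε : Compatible (Function.update S.1 c true) ε) :
    ∑ T with D.IsEdge c S T, circleProd labelValue ε T * D.saddleCoeff c S T =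
      if ε c.lowerLeft = ε c.upperRight then colourRoot (ε c.lowerLeft) * circleProd labelValue ε S
      else 0 := by
  by_cases hr : D.circleSetoid S.1 c.lowerLeft c.upperRight
  · obtain ⟨K, hK⟩ := exists_circleProd_edgeState_eq hc hε hr
    set a := S.2 (D.circleOf S.1 c.lowerLeft) with ha
    have hsum : ∑ T with D.IsEdge c S T, circleProd labelValue ε T * D.saddleCoeff c S T = K *
        ∑ z, ∑ w, leeComul a z w *
          (labelValue z (ε c.lowerLeft) * labelValue w (ε c.upperRight)) := by
      simp only [sum_isEdge_of_split hc hr, saddleCoeff_edgeState, if_pos hr, hK, Finset.mul_sum]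
      exact Finset.sum_congr rfl fun z _ => Finset.sum_congr rfl fun w _ => by ring
    rw [hsum, sum_leeComul_mul_labelValue]
    split_ifs with he
    · have hT := circleProd_edgeState_of_split labelValue hc hε hr he true true
      have h1 := labelValue_ne_zero true (ε c.lowerLeft)
      have h2 := labelValue_ne_zero true (ε c.upperRight)
      rw [hK, ← ha] at hT
      refine mul_left_cancel₀ (mul_ne_zero h1 h2) ?_
      linear_combination colourRoot (ε c.lowerLeft) * hT
    · rw [mul_zero]
  · have he : ε c.lowerLeft = ε c.upperRight := hε ((rel_update_iff hc).2 hr)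
    set a := S.2 (D.circleOf S.1 c.lowerLeft) with ha
    set b := S.2 (D.circleOf S.1 c.upperRight) with hb
    have hab := mul_ne_zero (labelValue_ne_zero a (ε c.lowerLeft))
      (labelValue_ne_zero b (ε c.lowerLeft))
    have hz (z : Bool) : labelValue a (ε c.lowerLeft) * labelValue b (ε c.lowerLeft) *
        (circleProd labelValue ε (edgeState S hc z z) * leeMul a b z) =
        circleProd labelValue ε S * (leeMul a b z * labelValue z (ε c.lowerLeft)) := by
      have := circleProd_edgeState_of_merge labelValue hc hε hr z z
      rw [← he, ← ha, ← hb] at this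
      linear_combination -leeMul a b z * this
    refine mul_left_cancel₀ hab ?_
    simp only [sum_isEdge_of_merge hc hr, saddleCoeff_edgeState, if_neg hr, ← ha, ← hb,
      Finset.mul_sum, hz]
    rw [← Finset.mul_sum, sum_leeMul_mul_labelValue, if_pos he]
    ring

open Classical in
/-- The evaluation of chains over the resolution `v` at the colouring `ε`, a functional on the Lee
complex given by its values on the distinguished basis. -/
noncomputable def evalFun (v : D.Resolution) (ε : D.Point → Bool) : D.EnhancedState → ℂ :=
  fun S => if S.1 = v then circleProd labelValue ε S else 0

open Classical in
theorem sum_evalFun_mul_leeCoeff (hε : Compatible v ε) (S : D.EnhancedState) :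
    ∑ T, evalFun v ε T * D.leeCoeff S T =
      ∑ c, if v c = true ∧ ε c.lowerLeft = ε c.upperRight then
        D.edgeSign (Function.update v c false) c * colourRoot (ε c.lowerLeft) *
          evalFun (Function.update v c false) ε S else 0 := by
  simp only [leeCoeff, Finset.mul_sum]
  rw [Finset.sum_comm]
  refine Finset.sum_congr rfl fun c _ => ?_
  simp only [mul_ite, mul_zero]
  rw [← Finset.sum_filter]
  by_cases hv : v c = true ∧ S.1 = Function.update v c false
  · obtain ⟨hvc, hS⟩ := hv
    have hc : S.1 c = false := by rw [hS, Function.update_self]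
    have hv : Function.update S.1 c true = v := by
      rw [hS, Function.update_idem, ← hvc, Function.update_eq_self]
    have hT : ∑ T with D.IsEdge c S T, evalFun v ε T * (D.edgeSign S.1 c * D.saddleCoeff c S T) =
        D.edgeSign S.1 c *
          ∑ T with D.IsEdge c S T, circleProd labelValue ε T * D.saddleCoeff c S T := by
      rw [Finset.mul_sum]
      refine Finset.sum_congr rfl fun T hT => ?_
      rw [evalFun, if_pos ((Finset.mem_filter.1 hT).2.fst_eq.trans hv)]
      ring
    rw [hT, sum_isEdge_circleProd hc (by rwa [hv]), ← hS]
    simp only [hvc, true_and, evalFun, if_true]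
    split_ifs <;> ring
  · have hsource {T : D.EnhancedState} (hT : D.IsEdge c S T) (hTv : T.1 = v) : False := by
      refine hv ⟨hTv ▸ hT.2.1, ?_⟩
      rw [← hTv, hT.fst_eq, Function.update_idem, ← hT.1, Function.update_eq_self]
    rw [Finset.sum_eq_zero fun T hT => by
      rw [evalFun, if_neg (hsource (Finset.mem_filter.1 hT).2), zero_mul]]
    split_ifs with hvc
    · rw [evalFun, if_neg fun hS => hv ⟨hvc.1, hS⟩, mul_zero]
    · rfl

open Matrix

open Classical in
theorem evalFun_dotProduct_leeDifferential (hε : Compatible v ε) (x : D.LeeChain) :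
    evalFun v ε ⬝ᵥ D.leeDifferential x =
      ∑ c, if v c = true ∧ ε c.lowerLeft = ε c.upperRight then
        D.edgeSign (Function.update v c false) c * colourRoot (ε c.lowerLeft) *
          (evalFun (Function.update v c false) ε ⬝ᵥ x) else 0 := by
  rw [leeDifferential, mulVecLin_apply, dotProduct_mulVec]
  simp only [dotProduct, vecMul, of_apply, sum_evalFun_mul_leeCoeff hε, Finset.sum_mul]
  rw [Finset.sum_comm]
  refine Finset.sum_congr rfl fun c _ => ?_
  split_ifs
  · simp only [Finset.mul_sum, mul_assoc]
  · simp

theorem evalFun_circleOf (e l : D.Circle v → Bool) :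
    evalFun v (fun x => e (D.circleOf v x)) ⟨v, l⟩ = ∏ C, labelValue (l C) (e C) := by
  simp only [evalFun, if_true, circleProd, circleOf_out]

open Classical in
theorem sum_mul_evalFun (l : D.Circle v → Bool) (S : D.EnhancedState) :
    ∑ e : D.Circle v → Bool, (∏ C, colourRoot (e C) ^ 2 * labelValue (l C) (e C)) *
        evalFun v (fun x => e (D.circleOf v x)) S =
      if S = ⟨v, l⟩ then 2 ^ Fintype.card (D.Circle v) else 0 := by
  obtain ⟨v', l'⟩ := S
  by_cases hv : v' = v
  · subst hv
    simp only [evalFun_circleOf, ← Finset.prod_mul_distrib, mul_assoc]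
    rw [← Fintype.piFinset_univ, ← Finset.prod_univ_sum (fun _ => Finset.univ)
      fun C b => colourRoot b ^ 2 * (labelValue (l C) b * labelValue (l' C) b)]
    simp only [sum_colourRoot_sq_mul_labelValue, Sigma.mk.injEq, heq_eq_eq, true_and]
    split_ifs with hl
    · simp [hl]
    · obtain ⟨C, hC⟩ := Function.ne_iff.1 hl
      exact Finset.prod_eq_zero (Finset.mem_univ C) (if_neg (Ne.symm hC))
  · simp [evalFun, hv]

theorem eq_zero_of_evalFun_dotProduct {x : D.LeeChain}
    (h : ∀ v ε, Compatible v ε → evalFun v ε ⬝ᵥ x = 0) : x = 0 := by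
  classical
  funext S
  obtain ⟨v, l⟩ := S
  have hzero : (2 : ℂ) ^ Fintype.card (D.Circle v) * x ⟨v, l⟩ = 0 := calc
    _ = ∑ S, (∑ e : D.Circle v → Bool, (∏ C, colourRoot (e C) ^ 2 * labelValue (l C) (e C)) *
          evalFun v (fun x => e (D.circleOf v x)) S) * x S := by
      simp [sum_mul_evalFun]
    _ = ∑ e : D.Circle v → Bool, (∏ C, colourRoot (e C) ^ 2 * labelValue (l C) (e C)) *
          (evalFun v (fun x => e (D.circleOf v x)) ⬝ᵥ x) := by
      simp only [Finset.sum_mul, Finset.mul_sum, dotProduct, mul_assoc]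
      exact Finset.sum_comm
    _ = 0 := Finset.sum_eq_zero fun e _ => by rw [h v _ (compatible_circleOf e), mul_zero]
  simpa using hzero

theorem edgeSign_update (hc : v c = true) (c' : D.Crossing) :
    D.edgeSign (Function.update v c false) c' =
      (if c.time < c'.time then -1 else 1) * D.edgeSign v c' := by
  classical
  simp only [edgeSign]
  split_ifs with hcc'
  · have hinsert : (Finset.univ.filter fun b : D.Crossing => b.time < c'.time ∧ v b = true) =
        insert c (Finset.univ.filter fun b : D.Crossing =>
          b.time < c'.time ∧ Function.update v c false b = true) := by
      ext b
      by_cases hb : b = c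
      · simp [hb, hcc', hc]
      · simp [hb]
    rw [hinsert, Finset.card_insert_of_notMem (by simp), pow_succ]
    ring
  · rw [one_mul]
    congr 3
    ext b
    by_cases hb : b = c
    · simp [hb, hcc']
    · simp [hb]

theorem edgeSign_mul_edgeSign_update {c' : D.Crossing} (hc : v c = true) (hc' : v c' = true)
    (hne : c ≠ c') :
    D.edgeSign (Function.update v c false) c *
        D.edgeSign (Function.update (Function.update v c' false) c false) c' =
      -(D.edgeSign (Function.update v c' false) c' *
        D.edgeSign (Function.update (Function.update v c' false) c false) c) := by
  have hcc' : Function.update v c' false c = true := by simp [hne, hc]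
  simp only [edgeSign_update hcc', edgeSign_update hc, edgeSign_update hc']
  rcases lt_or_gt_of_ne fun h => hne (Crossing.ext_time h) with h | h <;>
    simp only [h, h.not_gt, lt_irrefl, if_true, if_false] <;> ring

theorem leeDifferential_leeDifferential (x : D.LeeChain) :
    D.leeDifferential (D.leeDifferential x) = 0 := by
  classical
  refine eq_zero_of_evalFun_dotProduct fun v ε hε => ?_
  let active (v : D.Resolution) (c : D.Crossing) : Prop :=
    v c = true ∧ ε c.lowerLeft = ε c.upperRight
  let coeff (v : D.Resolution) (c : D.Crossing) : ℂ :=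
    D.edgeSign (Function.update v c false) c * colourRoot (ε c.lowerLeft)
  let term (c c' : D.Crossing) : ℂ := if active v c ∧ active (Function.update v c false) c' then
    coeff v c * (coeff (Function.update v c false) c' *
      (evalFun (Function.update (Function.update v c false) c' false) ε ⬝ᵥ x)) else 0
  have hterm : evalFun v ε ⬝ᵥ D.leeDifferential (D.leeDifferential x) =
      ∑ c, ∑ c', term c c' := by
    rw [evalFun_dotProduct_leeDifferential hε]
    refine Finset.sum_congr rfl fun c _ => ?_
    by_cases h : active v c
    · rw [if_pos h, evalFun_dotProduct_leeDifferential (hε.update h.1 h.2), Finset.mul_sum]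
      simp only [term, h, true_and, mul_ite, mul_zero]
      rfl
    · rw [if_neg h]
      simp [term, h]
  have hanti (c c' : D.Crossing) : term c c' = -term c' c := by
    by_cases hcc' : c = c'
    · simp [hcc', term, active]
    simp only [term, active, coeff, Function.update_of_ne hcc',
      Function.update_of_ne (Ne.symm hcc')]
    rw [if_congr and_comm rfl rfl, Function.update_comm hcc']
    split_ifs with h
    · obtain ⟨⟨hc', -⟩, hc, -⟩ := h
      linear_combination colourRoot (ε c.lowerLeft) * colourRoot (ε c'.lowerLeft) *
        (evalFun (Function.update (Function.update v c' false) c false) ε ⬝ᵥ x) *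
          edgeSign_mul_edgeSign_update hc hc' hcc'
    · simp
  have hneg : ∑ c, ∑ c', term c c' = -∑ c, ∑ c', term c c' := by
    conv_lhs => rw [Finset.sum_comm]
    simp only [← Finset.sum_neg_distrib, ← hanti]
  rw [hterm]
  exact self_eq_neg.1 hneg

end Evaluation

end OrientedAnnularDiagram

namespace OrientedAnnularDiagram

open Matrix

variable {D : OrientedAnnularDiagram} {v v' : D.Resolution} {ε ε' : D.Point → Bool}

open Classical in
/-- The chain over the resolution `v` whose circles are labelled by `𝐚 = v₋ + v₊` where `ε` is true
and by `𝐛 = v₋ - v₊` where it is false. -/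
noncomputable def colourChain (v : D.Resolution) (ε : D.Point → Bool) : D.LeeChain := fun S =>
  if S.1 = v then ∏ C : D.Circle S.1, if ε C.out = false ∧ S.2 C = true then -1 else 1 else 0

theorem evalFun_dotProduct_colourChain (v : D.Resolution) (ε ε' : D.Point → Bool) :
    evalFun v ε' ⬝ᵥ colourChain v ε = ∏ C : D.Circle v,
      ∑ b, labelValue b (ε' C.out) * (if ε C.out = false ∧ b = true then -1 else 1) := by
  classical
  have expand := Finset.prod_univ_sum (fun _ : D.Circle v => (Finset.univ : Finset Bool))
    (fun C b => labelValue b (ε' C.out) * (if ε C.out = false ∧ b = true then -1 else 1))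
  rw [Fintype.piFinset_univ] at expand
  rw [expand, dotProduct]
  symm
  refine Fintype.sum_of_injective (fun l => (⟨v, l⟩ : D.EnhancedState)) ?_ _ _ ?_ ?_
  · exact fun l l' h => eq_of_heq (Sigma.mk.inj h).2
  · rintro ⟨v', l⟩ h
    obtain rfl | hv := eq_or_ne v' v
    · exact absurd ⟨l, rfl⟩ h
    · simp [evalFun, hv]
  · intro l
    rw [evalFun, if_pos rfl, colourChain, if_pos rfl, circleProd, ← Finset.prod_mul_distrib]

theorem evalFun_dotProduct_colourChain_self_ne_zero (v : D.Resolution) (ε : D.Point → Bool) :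
    evalFun v ε ⬝ᵥ colourChain v ε ≠ 0 := by
  rw [evalFun_dotProduct_colourChain]
  refine Finset.prod_ne_zero_iff.2 fun C _ => ?_
  have hroot := colourRoot_ne_zero (ε C.out)
  rw [Fintype.sum_bool]
  cases h : ε C.out <;> rw [h] at hroot <;>
    simp [labelValue, div_eq_mul_inv, hroot, ← two_mul]

theorem evalFun_dotProduct_colourChain_of_ne (hε : Compatible v ε) (hε' : Compatible v ε')
    {x : D.Point} (hx : ε x ≠ ε' x) : evalFun v ε' ⬝ᵥ colourChain v ε = 0 := by
  rw [evalFun_dotProduct_colourChain]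
  refine Finset.prod_eq_zero (Finset.mem_univ (D.circleOf v x)) ?_
  rw [hε.out, hε'.out, Fintype.sum_bool]
  revert hx
  cases ε x <;> cases ε' x <;> simp [labelValue, neg_div]

theorem evalFun_dotProduct_colourChain_of_resolution_ne (hv : v' ≠ v) :
    evalFun v' ε' ⬝ᵥ colourChain v ε = 0 := by
  refine Finset.sum_eq_zero fun S _ => ?_
  obtain hS | hS := eq_or_ne S.1 v'
  · rw [colourChain, if_neg (hS ▸ hv), mul_zero]
  · rw [evalFun, if_neg hS, zero_mul]

/-- The two arcs at each crossing have different colours. -/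
def Separating (ε : D.Point → Bool) : Prop :=
  ∀ c : D.Crossing, ε c.lowerLeft ≠ ε c.upperRight

theorem leeDifferential_colourChain (hε : Compatible v ε) (hs : Separating ε) :
    D.leeDifferential (colourChain v ε) = 0 := by
  classical
  refine eq_zero_of_evalFun_dotProduct fun v' ε' hε' => ?_
  rw [evalFun_dotProduct_leeDifferential hε']
  refine Finset.sum_eq_zero fun c _ => ite_eq_right_iff.2 fun ⟨hc, hcolour⟩ => ?_
  refine mul_eq_zero_of_right _ ?_
  obtain hv | hv := eq_or_ne (Function.update v' c false) v
  · obtain ⟨x, hx⟩ : ∃ x, ε x ≠ ε' x := by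
      by_contra! h
      exact hs c (by rw [h, h, hcolour])
    rw [hv]
    exact evalFun_dotProduct_colourChain_of_ne hε (hv ▸ hε'.update hc hcolour) hx
  · exact evalFun_dotProduct_colourChain_of_resolution_ne hv

theorem evalFun_dotProduct_leeDifferential_of_separating (hε : Compatible v ε) (hs : Separating ε)
    (x : D.LeeChain) : evalFun v ε ⬝ᵥ D.leeDifferential x = 0 := by
  rw [evalFun_dotProduct_leeDifferential hε]
  exact Finset.sum_eq_zero fun c _ => if_neg fun h => hs c h.2

end OrientedAnnularDiagram

namespace AnnularEvent

variable {l : List Bool} {i : ℕ}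

theorem getElem?_apply_birth (b : Bool) (hi : i ≤ l.length) (p : ℕ) :
    ((birth i b).apply l)[p]? = if p < i then l[p]? else if p = i then some b
      else if p = i + 1 then some (!b) else l[p - 2]? := by
  simp only [apply]
  grind

theorem getElem?_apply_death (hi : i + 1 < l.length) (p : ℕ) :
    ((death i).apply l)[p]? = if p < i then l[p]? else l[p + 2]? := by
  simp only [apply]
  grind

theorem getElem?_apply_cross (s : Bool) (hi : i + 1 < l.length) (p : ℕ) :
    ((cross i s).apply l)[p]? =
      if p = i then l[i + 1]? else if p = i + 1 then l[i]? else l[p]? := by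
  have swap : (l.drop i).take 2 = [l[i], l[i + 1]] := by
    rw [List.drop_eq_getElem_cons (by omega), List.drop_eq_getElem_cons hi]
    rfl
  simp only [apply, swap, List.reverse_cons, List.reverse_nil, List.nil_append, List.cons_append]
  grind

theorem sideStrands_mate {e : AnnularEvent} (hv : e.Valid l) {hz : Bool}
    (hcross : ∀ i s, e = cross i s → (hz = true ↔ l[i]? ≠ l[i + 1]?)) {u b : Bool} {p : ℕ}
    (hb : (e.sideStrands l u)[p]? = some b) :
    (e.sideStrands l (e.mate hz (u, p)).1)[(e.mate hz (u, p)).2]? =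
      some (b ^^ (u == (e.mate hz (u, p)).1)) := by
  cases e with
  | birth i s =>
    have := getElem?_apply_birth s hv
    cases b <;> cases u <;> simp only [mate] <;> split_ifs <;>
      simp only [sideStrands, if_true, Bool.false_eq_true, if_false] at * <;> grind
  | death i =>
    have := getElem?_apply_death (succ_lt_length_of_valid_death hv)
    obtain ⟨s, hs, hs'⟩ := hv
    cases b <;> cases u <;> simp only [mate] <;> split_ifs <;>
      simp only [sideStrands, if_true, Bool.false_eq_true, if_false] at * <;> grind
  | cross i s =>
    have happly := getElem?_apply_cross s hv
    obtain ⟨x, hx⟩ : ∃ x, l[i]? = some x := ⟨_, List.getElem?_eq_getElem (Nat.lt_of_succ_lt hv)⟩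
    obtain ⟨y, hy⟩ : ∃ y, l[i + 1]? = some y := ⟨_, List.getElem?_eq_getElem hv⟩
    have hne := hcross i s rfl
    rw [hx, hy, Ne, Option.some_inj] at hne
    cases x <;> cases y <;> cases b <;> cases u <;> simp only [mate] <;> split_ifs <;>
      simp only [sideStrands, if_true, Bool.false_eq_true, if_false] at * <;> grind

theorem bodd_length_apply {e : AnnularEvent} (hv : e.Valid l) :
    (e.apply l).length.bodd = l.length.bodd := by
  cases e with
  | birth i b => simp [length_apply_birth hv, Nat.bodd_succ]
  | death i => simp [← length_apply_death hv, Nat.bodd_succ]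
  | cross i s => rw [length_apply_cross hv]

end AnnularEvent

namespace OrientedAnnularDiagram

open AnnularEvent

variable {D : OrientedAnnularDiagram}

theorem bodd_length_level {h : ℕ} (hh : h ≤ D.word.length) :
    (D.level h).length.bodd = D.start.length.bodd := by
  induction h with
  | zero => rw [D.level_zero]
  | succ h ih =>
    rw [D.level_succ h hh, bodd_length_apply (l := D.level h) (D.valid h hh),
      ih (Nat.le_of_lt hh)]

theorem Point.getElem?_coord (x : D.Point) : (D.level x.coord.1)[x.coord.2]? = some x.dir :=
  List.getElem?_eq_getElem x.2.2

theorem Point.getElem?_sideStrands {x : D.Point} {u : Bool} {h p : ℕ} (hh : h < D.word.length)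
    (hx : x.coord = (h + u.toNat, p)) :
    ((D.word[h]).sideStrands (D.level h) u)[p]? = some x.dir := by
  rw [← x.getElem?_coord, hx]
  cases u
  · rfl
  · exact congrArg (·[p]?) (D.level_succ h hh).symm

theorem Crossing.getElem?_pos (c : D.Crossing) :
    (D.level c.time)[c.pos]? = some c.lowerLeft.dir := c.lowerLeft.getElem?_coord

theorem Crossing.getElem?_pos_succ (c : D.Crossing) :
    (D.level c.time)[c.pos + 1]? = some c.lowerRight.dir := c.lowerRight.getElem?_coord

theorem Crossing.dir_upperRight (c : D.Crossing) : c.upperRight.dir = c.lowerLeft.dir := by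
  have hdir : (D.level (c.time + 1))[c.pos + 1]? = some c.upperRight.dir :=
    c.upperRight.getElem?_coord
  rw [D.level_succ _ c.time_lt, c.word_time, getElem?_apply_cross _ c.pos_lt] at hdir
  simpa [c.getElem?_pos] using hdir.symm

theorem horizontal_orientedResolution (c : D.Crossing) :
    horizontal D.orientedResolution c.time = true ↔ c.lowerLeft.dir ≠ c.lowerRight.dir := by
  rw [horizontal_time, decide_eq_true_iff]
  simp only [orientedResolution, Crossing.Positive]
  by_cases h : c.lowerLeft.dir = c.lowerRight.dir <;>
    rcases Bool.eq_false_or_eq_true c.risingOver with hr | hr <;> simp [h, hr]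

theorem Point.dir_mate_orientedResolution (x : D.Point) (u : Bool) :
    (x.mate D.orientedResolution u).dir =
      (x.dir ^^ (u == (x.mateEnd D.orientedResolution u).1)) := by
  rcases x.event_or_closing u with ⟨h, hh, hx⟩ | hx
  · have hcross (i : ℕ) (s : Bool) (e : D.word[h] = cross i s) :
        horizontal D.orientedResolution h = true ↔ (D.level h)[i]? ≠ (D.level h)[i + 1]? := by
      obtain ⟨c, rfl, rfl, rfl⟩ := exists_crossing hh e
      rw [horizontal_orientedResolution, c.getElem?_pos, c.getElem?_pos_succ, Ne, Ne,
        Option.some_inj]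
    have hmate :=
      sideStrands_mate (l := D.level h) (D.valid h hh) hcross (getElem?_sideStrands hh hx)
    rw [getElem?_sideStrands hh (coord_mate_of_coord _ hh hx), Option.some_inj] at hmate
    rw [hmate, mateEnd_eq_of_coord _ hh hx]
  · have hcoord := coord_mate_of_closing D.orientedResolution hx
    have hlevel : D.level (x.mate D.orientedResolution u).coord.1 = D.level x.coord.1 := by
      rw [hcoord, hx]
      cases u <;> simp [D.level_zero, D.level_length]
    have hdir := (x.mate D.orientedResolution u).getElem?_coord
    rw [hlevel, hcoord, x.getElem?_coord, Option.some_inj] at hdir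
    simp [mateEnd_of_closing _ hx, hdir]

theorem Point.bodd_leeIndex (x : D.Point) :
    x.leeIndex.bodd = !(D.start.length.bodd ^^ (x.coord.2.bodd ^^ x.dir)) := by
  have hlength : (D.level x.1).length = ((D.level x.1).length - 1 - x.2) + x.2 + 1 := by
    have := x.2.2
    omega
  rw [← bodd_length_level (Nat.lt_succ_iff.1 x.1.2), hlength, Nat.bodd_succ, Nat.bodd_add, leeIndex,
    Nat.bodd_add, show x.coord.2 = (x.2 : ℕ) from rfl]
  cases ((D.level x.1).length - 1 - x.2).bodd <;> cases (x.2 : ℕ).bodd <;> cases x.dir <;> rfl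

variable (D) in
/-- The colouring of the points that belongs to the canonical Lee cycle: `true` stands for `𝐚` and
`false` for `𝐛`. -/
def leeColour (x : D.Point) : Bool := !x.leeIndex.bodd

theorem compatible_leeColour : Compatible D.orientedResolution D.leeColour := by
  refine circleSetoid_le (r := Setoid.ker D.leeColour) fun x u => ?_
  have hparity := x.mateEnd_parity D.orientedResolution u
  have hdir := x.dir_mate_orientedResolution u
  rw [Setoid.ker_def, leeColour, leeColour, Point.bodd_leeIndex, Point.bodd_leeIndex, hdir]
  revert hparity
  generalize (x.mateEnd D.orientedResolution u).1 = u'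
  cases (x.mate D.orientedResolution u).coord.2.bodd <;> cases x.coord.2.bodd <;> cases u <;>
    cases u' <;> simp

theorem separating_leeColour : Separating D.leeColour := by
  intro c
  have hpos : c.upperRight.coord.2 = c.lowerLeft.coord.2 + 1 := rfl
  rw [leeColour, leeColour, Point.bodd_leeIndex, Point.bodd_leeIndex, c.dir_upperRight, hpos,
    Nat.bodd_succ]
  cases D.start.length.bodd <;> cases c.lowerLeft.coord.2.bodd <;> cases c.lowerLeft.dir <;> simp

theorem odd_iff_bodd {n : ℕ} : Odd n ↔ n.bodd = true := by
  rw [Nat.odd_iff, Nat.mod_two_of_bodd]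
  cases n.bodd <;> simp

theorem isB_iff (C : D.Circle D.orientedResolution) :
    D.IsB D.orientedResolution C ↔ D.leeColour C.out = false := by
  rw [leeColour, Bool.not_eq_false', ← odd_iff_bodd]
  refine ⟨?_, fun h => ⟨C.out, circleOf_out _ C, h⟩⟩
  rintro ⟨x, rfl, h⟩
  have hout := compatible_leeColour.out x
  simp only [leeColour, Bool.not_inj_iff] at hout
  rwa [odd_iff_bodd, hout, ← odd_iff_bodd]

theorem canonicalCycle_eq : D.canonicalCycle = colourChain D.orientedResolution D.leeColour := by
  classical
  funext ⟨v, l⟩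
  simp only [canonicalCycle, colourChain]
  split_ifs with h
  · subst h
    simp only [isB_iff]
  · rfl

end OrientedAnnularDiagram

section Level

open Matrix

variable {ι : Type*} [Fintype ι] {d : (ι → ℂ) →ₗ[ℂ] (ι → ℂ)} {j : ι → ℝ} {s : ι → ℂ} {a : ℝ}

/-- The class of `s` in the homology of `d` has filtration level `a` with respect to the grading `j`
of the basis: it is represented by a cycle in level `a`, and some functional on homology detects it
and vanishes on all higher levels. -/
def AttainsLevel (d : (ι → ℂ) →ₗ[ℂ] (ι → ℂ)) (j : ι → ℝ) (s : ι → ℂ) (a : ℝ) : Prop :=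
  (∃ x, d x = 0 ∧ x - s ∈ LinearMap.range d ∧ ∀ i, x i ≠ 0 → a ≤ j i) ∧
    ∃ f : ι → ℂ, (∀ i, f i ≠ 0 → j i ≤ a) ∧ (∀ z, f ⬝ᵥ d z = 0) ∧ f ⬝ᵥ s ≠ 0

theorem exists_lowest_term {ι : Type*} [Finite ι] {x : ι → ℂ} (hx : x ≠ 0) (j : ι → ℝ) :
    ∃ i, x i ≠ 0 ∧ ∀ i', x i' ≠ 0 → j i ≤ j i' :=
  Set.exists_min_image {i | x i ≠ 0} j (Set.toFinite _) (Function.ne_iff.1 hx)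

namespace AttainsLevel

theorem exists_functional {p : ι → Prop} (h : ∀ x, x - s ∈ LinearMap.range d → ∃ i, x i ≠ 0 ∧ p i) :
    ∃ f : ι → ℂ, (∀ i, f i ≠ 0 → p i) ∧ (∀ z, f ⬝ᵥ d z = 0) ∧ f ⬝ᵥ s ≠ 0 := by
  classical
  let N : Submodule ℂ (ι → ℂ) := Submodule.pi {i | p i} fun _ => ⊥
  have hs : s ∉ N ⊔ LinearMap.range d := fun hs => by
    obtain ⟨y, hy, z, hz, rfl⟩ := Submodule.mem_sup.1 hs
    obtain ⟨i, hi, hpi⟩ := h y (by rw [sub_add_cancel_left]; exact neg_mem hz)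
    exact hi (hy i hpi)
  obtain ⟨φ, hφs, hker⟩ := Submodule.exists_le_ker_of_notMem hs
  obtain ⟨f, rfl⟩ := (dotProductEquiv ℂ ι).surjective φ
  refine ⟨f, fun i hi => ?_, fun z => hker (Submodule.mem_sup_right ⟨z, rfl⟩), hφs⟩
  by_contra hpi
  have hsingle : f ⬝ᵥ Pi.single i 1 = 0 := hker (Submodule.mem_sup_left fun i' hi' =>
    Pi.single_eq_of_ne (M := fun _ => ℂ) (ne_of_mem_of_not_mem hi' hpi) 1)
  exact hi (by rwa [dotProduct_single_one] at hsingle)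

theorem exists_of_notMem_range (hd : ∀ x, d (d x) = 0) (hs : d s = 0)
    (hr : s ∉ LinearMap.range d) (j : ι → ℝ) : ∃ a, AttainsLevel d j s a := by
  have hlowest (x) (hx : x - s ∈ LinearMap.range d) :
      ∃ i, x i ≠ 0 ∧ ∀ i', x i' ≠ 0 → j i ≤ j i' :=
    exists_lowest_term (fun h => hr (by simpa [h] using hx)) j
  let A := {i | ∃ x, x - s ∈ LinearMap.range d ∧ ∀ i', x i' ≠ 0 → j i ≤ j i'}
  have hA : A.Nonempty := (hlowest s (by simp)).imp fun i hi => ⟨s, by simp, hi.2⟩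
  obtain ⟨i, ⟨x, hx, hxi⟩, hmax⟩ := Set.exists_max_image A j (Set.toFinite A) hA
  refine ⟨j i, ⟨x, ?_, hx, hxi⟩, exists_functional fun y hy => ?_⟩
  · obtain ⟨z, hz⟩ := hx
    rw [← hs, ← sub_eq_zero, ← map_sub, ← hz, hd]
  · obtain ⟨i', hi', hle⟩ := hlowest y hy
    exact ⟨i', hi', hmax i' ⟨y, hy, hle⟩⟩

theorem exists_le (h : AttainsLevel d j s a) {x : ι → ℂ} (hx : x - s ∈ LinearMap.range d) :
    ∃ i, x i ≠ 0 ∧ j i ≤ a := by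
  obtain ⟨-, f, hfa, hfd, hfs⟩ := h
  obtain ⟨z, hz⟩ := hx
  have hfx : f ⬝ᵥ x ≠ 0 := by
    rwa [← sub_add_cancel x s, ← hz, dotProduct_add, hfd, zero_add]
  obtain ⟨i, -, hi⟩ := Finset.exists_ne_zero_of_sum_ne_zero hfx
  exact ⟨i, right_ne_zero_of_mul hi, hfa i (left_ne_zero_of_mul hi)⟩

theorem smul (h : AttainsLevel d j s a) {c : ℂ} (hc : c ≠ 0) : AttainsLevel d j (c • s) a := by
  obtain ⟨⟨x, hdx, hxs, hxa⟩, f, hfa, hfd, hfs⟩ := h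
  refine ⟨⟨c • x, by rw [map_smul, hdx, smul_zero], ?_, fun i hi => hxa i ?_⟩, f, hfa, hfd, ?_⟩
  · exact smul_sub c x s ▸ Submodule.smul_mem _ _ hxs
  · exact right_ne_zero_of_mul hi
  · rw [dotProduct_smul]
    exact mul_ne_zero hc hfs

theorem diagonal (h : AttainsLevel d j s a) {θ : ι → ℂ} (hθ : ∀ i, θ i ≠ 0)
    (hd : ∀ x, d (θ * x) = θ * d x) : AttainsLevel d j (θ * s) a := by
  obtain ⟨⟨x, hdx, ⟨z, hz⟩, hxa⟩, f, hfa, hfd, hfs⟩ := h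
  have hdot (y : ι → ℂ) : (θ⁻¹ * f) ⬝ᵥ (θ * y) = f ⬝ᵥ y :=
    Finset.sum_congr rfl fun i _ => by
      rw [Pi.mul_apply, Pi.mul_apply, Pi.inv_apply]
      field_simp [hθ i]
  refine ⟨⟨θ * x, by rw [hd, hdx, mul_zero], ⟨θ * z, by rw [hd, hz, mul_sub]⟩, fun i hi =>
    hxa i (right_ne_zero_of_mul hi)⟩, θ⁻¹ * f, fun i hi => hfa i (right_ne_zero_of_mul hi),
    fun y => ?_, by rwa [hdot]⟩
  have hy : θ * (θ⁻¹ * y) = y := funext fun i => mul_inv_cancel_left₀ (hθ i) (y i)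
  rw [← hy, hd, hdot, hfd]

end AttainsLevel

end Level

namespace OrientedAnnularDiagram

open Matrix

variable {D : OrientedAnnularDiagram} {t s a : ℝ} {x : D.LeeChain}

theorem mem_filtration : x ∈ D.filtration t s ↔ ∀ S, x S ≠ 0 → s ≤ D.jtGrading t S := by
  classical
  refine ⟨fun h S => ?_, fun h => ?_⟩
  · contrapose!
    intro hS
    have hle : D.filtration t s ≤ LinearMap.ker (LinearMap.proj (R := ℂ) (φ := fun _ => ℂ) S) := by
      refine Submodule.span_le.2 ?_
      rintro _ ⟨S', hS', rfl⟩
      have hne : S ≠ S' := fun h => hS.not_ge (h ▸ hS')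
      exact Pi.single_eq_of_ne (M := fun _ => ℂ) hne 1
    exact hle h
  · rw [pi_eq_sum_univ' x]
    refine Submodule.sum_mem _ fun S _ => ?_
    obtain hS | hS := eq_or_ne (x S) 0
    · rw [hS, zero_smul]
      exact Submodule.zero_mem _
    · refine Submodule.smul_mem _ _ (Submodule.subset_span ⟨S, h S hS, ?_⟩)
      funext S'
      simp [Pi.single_apply, eq_comm]

theorem le_gr (hx : x ≠ 0) (h : ∀ S, x S ≠ 0 → a ≤ D.jtGrading t S) : a ≤ D.gr t x := by
  obtain ⟨S, hS⟩ := Function.ne_iff.1 hx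
  exact le_csSup ⟨D.jtGrading t S, fun s hs => mem_filtration.1 hs S hS⟩ (mem_filtration.2 h)

theorem gr_le {S : D.EnhancedState} (hS : x S ≠ 0) : D.gr t x ≤ D.jtGrading t S := by
  obtain ⟨m, hm⟩ := (Set.finite_range (D.jtGrading t)).bddBelow
  exact csSup_le ⟨m, mem_filtration.2 fun S _ => hm ⟨S, rfl⟩⟩ fun s hs => mem_filtration.1 hs S hS

theorem isGreatest_classGradings_of_attainsLevel
    (h : AttainsLevel D.leeDifferential (D.jtGrading t) D.canonicalCycle a) :
    IsGreatest (D.classGradings t) a := by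
  obtain ⟨x, hdx, hxs, hxa⟩ := h.1
  have hle {y : D.LeeChain} (hy : y - D.canonicalCycle ∈ LinearMap.range D.leeDifferential) :
      D.gr t y ≤ a := by
    obtain ⟨S, hS, hSa⟩ := h.exists_le hy
    exact (gr_le hS).trans hSa
  have hx : x ≠ 0 := by
    obtain ⟨S, hS, -⟩ := h.exists_le hxs
    exact fun h0 => hS (congrFun h0 S)
  refine ⟨⟨x, hdx, hxs, le_antisymm (le_gr hx hxa) (hle hxs)⟩, ?_⟩
  rintro r ⟨y, -, hy, rfl⟩
  exact hle hy

theorem annularRasmussen_eq_of_attainsLevel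
    (h : AttainsLevel D.leeDifferential (D.jtGrading t) D.canonicalCycle a) :
    D.annularRasmussen t = a :=
  (isGreatest_classGradings_of_attainsLevel h).csSup_eq

theorem colourChain_notMem_range {v : D.Resolution} {ε : D.Point → Bool} (hε : Compatible v ε)
    (hs : Separating ε) : colourChain v ε ∉ LinearMap.range D.leeDifferential := by
  rintro ⟨z, hz⟩
  refine evalFun_dotProduct_colourChain_self_ne_zero v ε ?_
  rw [← hz, evalFun_dotProduct_leeDifferential_of_separating hε hs]

theorem attainsLevel_canonicalCycle (D : OrientedAnnularDiagram) (t : ℝ) :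
    AttainsLevel D.leeDifferential (D.jtGrading t) D.canonicalCycle (D.annularRasmussen t) := by
  obtain ⟨a, ha⟩ := AttainsLevel.exists_of_notMem_range leeDifferential_leeDifferential
    (leeDifferential_colourChain compatible_leeColour separating_leeColour)
    (colourChain_notMem_range compatible_leeColour separating_leeColour) (D.jtGrading t)
  rw [← canonicalCycle_eq] at ha
  rwa [annularRasmussen_eq_of_attainsLevel ha]

section ColourExchange

/-- The number of `1`-smoothings. -/
noncomputable def height (S : D.EnhancedState) : ℕ := Nat.card {c : D.Crossing // S.1 c = true}

variable {c : D.Crossing} {S T : D.EnhancedState}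

theorem IsEdge.height_eq (h : D.IsEdge c S T) : height T = height S + 1 := by
  have hinsert : {c' | T.1 c' = true} = insert c {c' | S.1 c' = true} := by
    ext c'
    obtain rfl | hc := eq_or_ne c' c
    · simp [h.2.1]
    · simp [hc, h.2.2.1 c' hc]
  have hc : c ∉ {c' | S.1 c' = true} := by simp [h.1]
  change Nat.card ↥{c' | T.1 c' = true} = Nat.card ↥{c' | S.1 c' = true} + 1
  rw [Nat.card_coe_set_eq, Nat.card_coe_set_eq, hinsert, Set.ncard_insert_of_notMem hc]

/-- The image `± i` of the degree of a label under `n ↦ i ^ n`. -/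
noncomputable def labelPhase (l : Bool) : ℂ := if l then Complex.I else -Complex.I

/-- The image of the quantum grading under `n ↦ i ^ n`, up to a constant factor.  The Lee
differential preserves the quantum grading modulo `4`, hence commutes with multiplication by the
phase, which exchanges the two colours. -/
noncomputable def phase (S : D.EnhancedState) : ℂ :=
  circleProd (fun l _ => labelPhase l) (fun _ => true) S * Complex.I ^ height S

theorem labelPhase_ne_zero (l : Bool) : labelPhase l ≠ 0 := by cases l <;> simp [labelPhase]

theorem phase_ne_zero (S : D.EnhancedState) : phase S ≠ 0 :=
  mul_ne_zero (Finset.prod_ne_zero_iff.2 fun _ _ => labelPhase_ne_zero _)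
    (pow_ne_zero _ Complex.I_ne_zero)

theorem labelPhase_of_leeMul_ne_zero {a b z : Bool} (h : leeMul a b z ≠ 0) :
    labelPhase a * labelPhase b = Complex.I * labelPhase z := by
  revert h
  cases a <;> cases b <;> cases z <;> simp [leeMul, labelPhase]

theorem labelPhase_of_leeComul_ne_zero {a z w : Bool} (h : leeComul a z w ≠ 0) :
    labelPhase a = Complex.I * (labelPhase z * labelPhase w) := by
  revert h
  cases a <;> cases z <;> cases w <;> simp [leeComul, labelPhase]

theorem phase_edgeState (hc : S.1 c = false) {z w : Bool}
    (h : D.saddleCoeff c S (edgeState S hc z w) ≠ 0) :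
    phase (edgeState S hc z w) = phase S := by
  classical
  have hconst (v : D.Resolution) : Compatible v fun _ => true := fun _ _ _ => rfl
  rw [phase, phase, (isEdge_edgeState hc z w).height_eq]
  rw [saddleCoeff_edgeState] at h
  split_ifs at h with hr
  · have hT := circleProd_edgeState_of_split (fun l _ => labelPhase l) hc (hconst _) hr rfl z w
    refine mul_left_cancel₀ (labelPhase_ne_zero (S.2 (D.circleOf S.1 c.lowerLeft))) ?_
    rw [labelPhase_of_leeComul_ne_zero h] at hT ⊢
    linear_combination Complex.I ^ (height S + 1) * hT
  · have hS := circleProd_edgeState_of_merge (fun l _ => labelPhase l) hc (hconst _) hr z w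
    rw [labelPhase_of_leeMul_ne_zero h] at hS
    refine mul_left_cancel₀ (labelPhase_ne_zero z) ?_
    linear_combination -Complex.I ^ height S * hS

theorem leeDifferential_mul {θ : D.LeeChain} {κ : ℂ}
    (hθ : ∀ {c S T}, D.IsEdge c S T → D.saddleCoeff c S T ≠ 0 → θ S = κ * θ T) (x : D.LeeChain) :
    D.leeDifferential (θ * x) = κ • (θ * D.leeDifferential x) := by
  classical
  funext T
  change ∑ S, D.leeCoeff S T * (θ S * x S) = κ * (θ T * ∑ S, D.leeCoeff S T * x S)
  rw [← mul_assoc, Finset.mul_sum]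
  refine Finset.sum_congr rfl fun S _ => ?_
  obtain h | h := eq_or_ne (D.leeCoeff S T) 0
  · simp [h]
  · obtain ⟨c, -, hc⟩ := Finset.exists_ne_zero_of_sum_ne_zero h
    obtain ⟨hST, hc⟩ := ite_ne_right_iff.1 hc
    rw [hθ hST (right_ne_zero_of_mul hc)]
    ring

theorem leeDifferential_phase_mul (x : D.LeeChain) :
    D.leeDifferential (phase * x) = phase * D.leeDifferential x := by
  rw [leeDifferential_mul (κ := 1) (fun {c S T} hST hcoeff => ?_), one_smul]
  rw [hST.eq_edgeState] at hcoeff ⊢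
  rw [phase_edgeState hST.1 hcoeff, one_mul]

theorem colourChain_not (v : D.Resolution) (ε : D.Point → Bool) :
    ∃ c : ℂ, c ≠ 0 ∧ colourChain v (fun x => !ε x) = c • (phase * colourChain v ε) := by
  classical
  let c : ℂ := (∏ _C : D.Circle v, -Complex.I) *
    Complex.I ^ Nat.card {c : D.Crossing // v c = true}
  have hc : c ≠ 0 :=
    mul_ne_zero (Finset.prod_ne_zero_iff.2 fun C _ => by simp) (pow_ne_zero _ Complex.I_ne_zero)
  refine ⟨c⁻¹, inv_ne_zero hc, ?_⟩
  funext ⟨v', l⟩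
  rw [Pi.smul_apply, smul_eq_mul, eq_inv_mul_iff_mul_eq₀ hc, Pi.mul_apply, colourChain, colourChain]
  split_ifs with hv
  · subst hv
    have hlabel : (∏ C : D.Circle v', (-Complex.I *
        if (!ε C.out) = false ∧ l C = true then -1 else 1)) = ∏ C : D.Circle v',
          (labelPhase (l C) * if ε C.out = false ∧ l C = true then -1 else 1) :=
      Finset.prod_congr rfl fun C _ => by cases ε C.out <;> cases l C <;> simp [labelPhase]
    rw [Finset.prod_mul_distrib, Finset.prod_mul_distrib] at hlabel
    simp only [c, phase, circleProd, height]
    linear_combination Complex.I ^ Nat.card {c : D.Crossing // v' c = true} * hlabel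
  · simp

theorem attainsLevel_colourChain_not (D : OrientedAnnularDiagram) (t : ℝ) :
    AttainsLevel D.leeDifferential (D.jtGrading t)
      (colourChain D.orientedResolution fun x => !D.leeColour x) (D.annularRasmussen t) := by
  obtain ⟨c, hc, h⟩ := colourChain_not D.orientedResolution D.leeColour
  rw [h, ← canonicalCycle_eq]
  exact ((D.attainsLevel_canonicalCycle t).diagonal phase_ne_zero leeDifferential_phase_mul).smul hc

end ColourExchange

end OrientedAnnularDiagram

section Tensor

open Matrix

variable {ι ι₁ ι₂ : Type*}

/-- The tensor product of two vectors, in the basis that `e` identifies with the products of basis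
vectors. -/
def tensorVec (e : ι ≃ ι₁ × ι₂) (x : ι₁ → ℂ) (y : ι₂ → ℂ) : ι → ℂ := fun i => x (e i).1 * y (e i).2

variable (e : ι ≃ ι₁ × ι₂)

theorem tensor_sub_tensor (x x' : ι₁ → ℂ) (y y' : ι₂ → ℂ) :
    tensorVec e x y - tensorVec e x' y' = tensorVec e (x - x') y + tensorVec e x' (y - y') := by
  funext i
  simp only [tensorVec, Pi.sub_apply, Pi.add_apply]
  ring

variable [Fintype ι]

theorem dotProduct_eq_zero_of_tensor {d : (ι → ℂ) →ₗ[ℂ] (ι → ℂ)} {f : ι → ℂ}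
    (h : ∀ x y, f ⬝ᵥ d (tensorVec e x y) = 0) (z : ι → ℂ) : f ⬝ᵥ d z = 0 := by
  classical
  have hsingle (i : ι) : (Pi.single i 1 : ι → ℂ) =
      tensorVec e (Pi.single (e i).1 1) (Pi.single (e i).2 1) := by
    funext i'
    simp only [tensorVec, Pi.single_apply, ← e.injective.eq_iff (b := i), Prod.ext_iff, ite_and]
    split_ifs <;> simp
  rw [pi_eq_sum_univ' z, map_sum, dotProduct_sum]
  refine Finset.sum_eq_zero fun i _ => ?_
  rw [map_smul, dotProduct_smul, hsingle, h, smul_zero]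

variable [Fintype ι₁] [Fintype ι₂]

theorem tensor_dotProduct_tensor (x x' : ι₁ → ℂ) (y y' : ι₂ → ℂ) :
    tensorVec e x y ⬝ᵥ tensorVec e x' y' = (x ⬝ᵥ x') * (y ⬝ᵥ y') := by
  rw [dotProduct, dotProduct, dotProduct, Finset.sum_mul_sum, ← Fintype.sum_prod_type',
    ← e.sum_comp]
  exact Finset.sum_congr rfl fun i _ => mul_mul_mul_comm ..

variable {d : (ι → ℂ) →ₗ[ℂ] (ι → ℂ)} {d₁ : (ι₁ → ℂ) →ₗ[ℂ] (ι₁ → ℂ)}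
  {d₂ : (ι₂ → ℂ) →ₗ[ℂ] (ι₂ → ℂ)} {j : ι → ℝ} {j₁ : ι₁ → ℝ} {j₂ : ι₂ → ℝ} {s₁ : ι₁ → ℂ}
  {s₂ : ι₂ → ℂ} {a₁ a₂ : ℝ} {θ : ι₂ → ℂ}

/-- Künneth formula for filtration levels; `θ` is the sign of the Leibniz rule. -/
theorem attainsLevel_tensor (hθ : θ * θ = 1) (hd₂ : ∀ y, d₂ (θ * y) = -(θ * d₂ y))
    (hd : ∀ x y, d (tensorVec e x y) = tensorVec e (d₁ x) (θ * y) + tensorVec e x (d₂ y))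
    (hj : ∀ i, j i = j₁ (e i).1 + j₂ (e i).2) (hs : d₁ s₁ = 0) (h₁ : AttainsLevel d₁ j₁ s₁ a₁)
    (h₂ : AttainsLevel d₂ j₂ s₂ a₂) : AttainsLevel d j (tensorVec e s₁ s₂) (a₁ + a₂) := by
  have tensor_zero (x : ι₁ → ℂ) : tensorVec e x 0 = 0 := funext fun i => mul_zero _
  have zero_tensor (y : ι₂ → ℂ) : tensorVec e 0 y = 0 := funext fun i => zero_mul _
  obtain ⟨⟨x, hdx, ⟨z, hz⟩, hxa⟩, f, hfa, hfd, hfs⟩ := h₁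
  obtain ⟨⟨y, hdy, ⟨w, hw⟩, hya⟩, g, hga, hgd, hgs⟩ := h₂
  refine ⟨⟨tensorVec e x y, ?_, ?_, fun i hi => ?_⟩, tensorVec e f g, fun i hi => ?_,
    dotProduct_eq_zero_of_tensor e fun x y => ?_, ?_⟩
  · rw [hd, hdx, hdy, tensor_zero, zero_tensor, add_zero]
  · refine ⟨tensorVec e z (θ * y) + tensorVec e s₁ w, ?_⟩
    rw [map_add, hd, hd, hd₂, hdy, hs, hz, hw, ← mul_assoc, hθ, one_mul, mul_zero, neg_zero,
      tensor_zero, zero_tensor, add_zero, zero_add, tensor_sub_tensor]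
  · rw [hj]
    exact add_le_add (hxa _ (left_ne_zero_of_mul hi)) (hya _ (right_ne_zero_of_mul hi))
  · rw [hj]
    exact add_le_add (hfa _ (left_ne_zero_of_mul hi)) (hga _ (right_ne_zero_of_mul hi))
  · rw [hd, dotProduct_add, tensor_dotProduct_tensor, tensor_dotProduct_tensor, hfd, hgd, zero_mul,
      mul_zero, add_zero]
  · rw [tensor_dotProduct_tensor]
    exact mul_ne_zero hfs hgs

end Tensor

namespace OrientedAnnularDiagram

open Matrix

/-- The sign of the number of `1`-smoothings. -/
noncomputable def heightSign {D : OrientedAnnularDiagram} (S : D.EnhancedState) : ℂ :=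
  (-1) ^ height S

theorem heightSign_mul_heightSign {D : OrientedAnnularDiagram} :
    (heightSign : D.LeeChain) * heightSign = 1 :=
  funext fun S => by rw [Pi.mul_apply, heightSign, ← mul_pow, neg_one_mul, neg_neg, one_pow]; rfl

theorem leeDifferential_heightSign_mul {D : OrientedAnnularDiagram} (x : D.LeeChain) :
    D.leeDifferential (heightSign * x) = -(heightSign * D.leeDifferential x) := by
  rw [leeDifferential_mul (κ := -1) fun hST _ => ?_, neg_one_smul]
  rw [heightSign, heightSign, hST.height_eq, pow_succ]
  ring

/-- A copy of the diagram `D` inside the diagram `E`, where it is not linked with the rest of `E`: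
the circles of a resolution of `E` restrict to those of the induced resolution of `D`. -/
structure Inclusion (D E : OrientedAnnularDiagram) where
  point : D.Point → E.Point
  crossing : D.Crossing → E.Crossing
  rel_iff : ∀ (v : E.Resolution) (x y : D.Point),
    E.circleSetoid v (point x) (point y) ↔ D.circleSetoid (v ∘ crossing) x y
  nontrivial_iff : ∀ (v : E.Resolution) (x : D.Point),
    E.Nontrivial v (E.circleOf v (point x)) ↔ D.Nontrivial (v ∘ crossing) (D.circleOf _ x)
  dir_point : ∀ x, (point x).dir = x.dir
  lowerLeft_crossing : ∀ c, (crossing c).lowerLeft = point c.lowerLeft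
  lowerRight_crossing : ∀ c, (crossing c).lowerRight = point c.lowerRight
  upperRight_crossing : ∀ c, (crossing c).upperRight = point c.upperRight
  risingOver_crossing : ∀ c, (crossing c).risingOver = c.risingOver
  time_lt_time_iff : ∀ c c', (crossing c).time < (crossing c').time ↔ c.time < c'.time

namespace Inclusion

variable {D D' E : OrientedAnnularDiagram} (f : Inclusion D E) (g : Inclusion D' E)

theorem circleOf_point_eq_iff {v : E.Resolution} {x y : D.Point} :
    E.circleOf v (f.point x) = E.circleOf v (f.point y) ↔
      D.circleOf (v ∘ f.crossing) x = D.circleOf (v ∘ f.crossing) y := by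
  rw [circleOf_eq_iff, circleOf_eq_iff, f.rel_iff]

/-- The circle of a resolution of the large diagram that a circle of the induced resolution of the
small diagram becomes. -/
def circle (v : E.Resolution) : D.Circle (v ∘ f.crossing) → E.Circle v :=
  Quotient.map f.point fun x y => (f.rel_iff v x y).2

theorem circle_circleOf (v : E.Resolution) (x : D.Point) :
    f.circle v (D.circleOf _ x) = E.circleOf v (f.point x) := rfl

theorem circle_injective (v : E.Resolution) : Function.Injective (f.circle v) := by
  intro C C'
  induction C using Quotient.inductionOn
  induction C' using Quotient.inductionOn
  exact f.circleOf_point_eq_iff.1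

/-- The restriction of an enhanced state to the small diagram. -/
def restrict (S : E.EnhancedState) : D.EnhancedState :=
  ⟨S.1 ∘ f.crossing, S.2 ∘ f.circle S.1⟩

theorem positive_crossing (c : D.Crossing) : (f.crossing c).Positive ↔ c.Positive := by
  rw [Crossing.Positive, f.lowerLeft_crossing, f.lowerRight_crossing, f.dir_point, f.dir_point,
    f.risingOver_crossing, Crossing.Positive]

theorem orientedResolution_comp_crossing :
    E.orientedResolution ∘ f.crossing = D.orientedResolution :=
  open Classical in funext fun c => if_congr (f.positive_crossing c) rfl rfl

theorem saddleCoeff_crossing (c : D.Crossing) (S T : E.EnhancedState) :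
    E.saddleCoeff (f.crossing c) S T = D.saddleCoeff c (f.restrict S) (f.restrict T) := by
  classical
  unfold saddleCoeff
  rw [f.lowerLeft_crossing, f.upperRight_crossing]
  exact if_congr (not_congr f.circleOf_point_eq_iff) rfl rfl

theorem restrict_eq_restrict_iff {S T : E.EnhancedState} : f.restrict S = f.restrict T ↔
    (∀ c, S.1 (f.crossing c) = T.1 (f.crossing c)) ∧
      ∀ x, S.2 (E.circleOf S.1 (f.point x)) = T.2 (E.circleOf T.1 (f.point x)) :=
  ⟨fun h => ⟨congrFun (congrArg Sigma.fst h), fun x =>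
      congrArg (fun R : D.EnhancedState => R.2 (D.circleOf R.1 x)) h⟩,
    fun h => EnhancedState.ext_circleOf (funext h.1) h.2⟩

/-- `E` is the disjoint union of two diagrams, on the level of resolutions. -/
structure IsDisjointUnion : Prop where
  crossing_bijective : Function.Bijective (Sum.elim f.crossing g.crossing)
  not_rel : ∀ v x y, ¬ E.circleSetoid v (f.point x) (g.point y)
  exists_rel : ∀ z, (∃ x, ∀ v, E.circleSetoid v (f.point x) z) ∨
    ∃ y, ∀ v, E.circleSetoid v (g.point y) z

namespace IsDisjointUnion

variable {f g} (h : IsDisjointUnion f g)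
include h

theorem symm : IsDisjointUnion g f where
  crossing_bijective := by
    rw [← Sum.elim_comp_inl_inr (Sum.elim g.crossing f.crossing)]
    convert h.crossing_bijective.comp (Equiv.sumComm _ _).bijective using 1
    funext c
    cases c <;> rfl
  not_rel v x y hxy := h.not_rel v y x ((E.circleSetoid v).symm hxy)
  exists_rel z := (h.exists_rel z).symm

theorem sum_crossing {M : Type*} [AddCommMonoid M] (F : E.Crossing → M) :
    ∑ c, F c = ∑ c, F (f.crossing c) + ∑ c, F (g.crossing c) := by
  rw [← h.crossing_bijective.sum_comp, Fintype.sum_sum_type]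
  rfl

theorem natCard_crossing (p : E.Crossing → Prop) :
    Nat.card {c // p c} = Nat.card {c // p (f.crossing c)} + Nat.card {c // p (g.crossing c)} := by
  classical
  simp only [Nat.card_eq_fintype_card, Fintype.card_subtype, Finset.card_filter, h.sum_crossing]

theorem crossing_ne (c : D.Crossing) (c' : D'.Crossing) : g.crossing c' ≠ f.crossing c := fun he =>
  Sum.inr_ne_inl (h.crossing_bijective.1 he : Sum.inr c' = Sum.inl c)

theorem crossing_injective : Function.Injective f.crossing := fun _ _ he =>
  Sum.inl_injective (h.crossing_bijective.1 he)

theorem circleOf_ne (v : E.Resolution) (x : D.Point) (y : D'.Point) :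
    E.circleOf v (f.point x) ≠ E.circleOf v (g.point y) :=
  fun he => h.not_rel v x y (circleOf_eq_iff.1 he)

theorem exists_circleOf_eq (z : E.Point) :
    (∃ x, ∀ v, E.circleOf v (f.point x) = E.circleOf v z) ∨
      ∃ y, ∀ v, E.circleOf v (g.point y) = E.circleOf v z := by
  simpa only [circleOf_eq_iff] using h.exists_rel z

theorem circle_bijective (v : E.Resolution) :
    Function.Bijective (Sum.elim (f.circle v) (g.circle v)) := by
  refine ⟨(f.circle_injective v).sumElim (g.circle_injective v) fun C C' => ?_, fun C => ?_⟩
  · induction C using Quotient.inductionOn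
    induction C' using Quotient.inductionOn
    exact h.circleOf_ne v _ _
  · induction C using Quotient.inductionOn with | h z => ?_
    rcases h.exists_circleOf_eq z with ⟨x, hx⟩ | ⟨y, hy⟩
    · exact ⟨Sum.inl (D.circleOf _ x), hx v⟩
    · exact ⟨Sum.inr (D'.circleOf _ y), hy v⟩

@[to_additive]
theorem prod_circle {M : Type*} [CommMonoid M] (v : E.Resolution) (F : E.Circle v → M) :
    ∏ C, F C = (∏ C, F (f.circle v C)) * ∏ C, F (g.circle v C) := by
  rw [← (h.circle_bijective v).prod_comp, Fintype.prod_sum_type]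
  rfl

theorem restrict_bijective : Function.Bijective fun S => (f.restrict S, g.restrict S) := by
  constructor
  · intro S T hST
    obtain ⟨hf, hg⟩ := Prod.mk.inj hST
    rw [restrict_eq_restrict_iff] at hf hg
    refine EnhancedState.ext_circleOf (funext fun c => ?_) fun z => ?_
    · obtain ⟨c | c, rfl⟩ := h.crossing_bijective.2 c
      · exact hf.1 c
      · exact hg.1 c
    · rcases h.exists_circleOf_eq z with ⟨x, hx⟩ | ⟨y, hy⟩
      · rw [← hx, ← hx, hf.2]
      · rw [← hy, ← hy, hg.2]
  · rintro ⟨⟨v₁, l₁⟩, v₂, l₂⟩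
    obtain ⟨v, rfl, rfl⟩ : ∃ v : E.Resolution, v ∘ f.crossing = v₁ ∧ v ∘ g.crossing = v₂ := by
      let φ := Equiv.ofBijective _ h.crossing_bijective
      refine ⟨Sum.elim v₁ v₂ ∘ φ.symm, funext fun c => ?_, funext fun c => ?_⟩
      · exact congrArg (Sum.elim v₁ v₂) (φ.symm_apply_apply (Sum.inl c))
      · exact congrArg (Sum.elim v₁ v₂) (φ.symm_apply_apply (Sum.inr c))
    let φ := Equiv.ofBijective _ (h.circle_bijective v)
    refine ⟨⟨v, Sum.elim l₁ l₂ ∘ φ.symm⟩, ?_⟩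
    have hl : (Sum.elim l₁ l₂ ∘ φ.symm) ∘ f.circle v = l₁ := funext fun C =>
      congrArg (Sum.elim l₁ l₂) (φ.symm_apply_apply (Sum.inl C))
    have hr : (Sum.elim l₁ l₂ ∘ φ.symm) ∘ g.circle v = l₂ := funext fun C =>
      congrArg (Sum.elim l₁ l₂) (φ.symm_apply_apply (Sum.inr C))
    simp only [restrict, hl, hr]

/-- Enhanced states of a disjoint union are pairs of enhanced states of its parts. -/
noncomputable def restrictEquiv : E.EnhancedState ≃ D.EnhancedState × D'.EnhancedState :=
  Equiv.ofBijective _ h.restrict_bijective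

theorem isEdge_crossing_iff {c : D.Crossing} {S T : E.EnhancedState} :
    E.IsEdge (f.crossing c) S T ↔
      D.IsEdge c (f.restrict S) (f.restrict T) ∧ g.restrict T = g.restrict S := by
  rw [restrict_eq_restrict_iff]
  constructor
  · rintro ⟨hS, hT, hne, hl⟩
    refine ⟨⟨hS, hT, fun c' hc' => hne _ (h.crossing_injective.ne hc'), fun x hx hx' => ?_⟩,
      fun c' => hne _ (h.crossing_ne c c'), fun y => ?_⟩
    · refine hl _ ?_ ?_
      · rw [f.lowerLeft_crossing]
        exact mt f.circleOf_point_eq_iff.1 hx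
      · rw [f.upperRight_crossing]
        exact mt f.circleOf_point_eq_iff.1 hx'
    · refine hl _ ?_ ?_
      · rw [f.lowerLeft_crossing]
        exact (h.circleOf_ne _ _ _).symm
      · rw [f.upperRight_crossing]
        exact (h.circleOf_ne _ _ _).symm
  · rintro ⟨⟨hS, hT, hne, hl⟩, hv, hg⟩
    refine ⟨hS, hT, fun c' hc' => ?_, fun z hz hz' => ?_⟩
    · obtain ⟨c' | c', rfl⟩ := h.crossing_bijective.2 c'
      · exact hne c' fun he => hc' (congrArg f.crossing he)
      · exact hv c'
    · rw [f.lowerLeft_crossing] at hz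
      rw [f.upperRight_crossing] at hz'
      rcases h.exists_circleOf_eq z with ⟨x, hx⟩ | ⟨y, hy⟩
      · rw [← hx] at hz hz' ⊢
        rw [← hx]
        exact hl x (mt f.circleOf_point_eq_iff.2 hz) (mt f.circleOf_point_eq_iff.2 hz')
      · rw [← hy, ← hy, hg]

theorem height_eq (S : E.EnhancedState) :
    height S = height (f.restrict S) + height (g.restrict S) :=
  h.natCard_crossing fun c => S.1 c = true

theorem nPlus_eq : E.nPlus = D.nPlus + D'.nPlus := by
  simp only [nPlus, h.natCard_crossing, positive_crossing]

theorem nMinus_eq : E.nMinus = D.nMinus + D'.nMinus := by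
  simp only [nMinus, h.natCard_crossing, positive_crossing]

theorem jGrading_eq (S : E.EnhancedState) :
    E.jGrading S = D.jGrading (f.restrict S) + D'.jGrading (g.restrict S) := by
  have hlabel : ∑ C, labelDegree (S.2 C) =
      ∑ C, labelDegree ((f.restrict S).2 C) + ∑ C, labelDegree ((g.restrict S).2 C) :=
    h.sum_circle S.1 fun C => labelDegree (S.2 C)
  have hheight : height S = height (f.restrict S) + height (g.restrict S) := h.height_eq S
  simp only [height] at hheight
  rw [jGrading, jGrading, jGrading, hlabel, hheight, h.nPlus_eq, h.nMinus_eq]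
  push_cast
  ring

theorem kGrading_eq (S : E.EnhancedState) :
    E.kGrading S = D.kGrading (f.restrict S) + D'.kGrading (g.restrict S) := by
  classical
  have hf (C : D.Circle (S.1 ∘ f.crossing)) :
      E.Nontrivial S.1 (f.circle S.1 C) ↔ D.Nontrivial _ C := by
    induction C using Quotient.inductionOn with | h x => exact f.nontrivial_iff S.1 x
  have hg (C : D'.Circle (S.1 ∘ g.crossing)) :
      E.Nontrivial S.1 (g.circle S.1 C) ↔ D'.Nontrivial _ C := by
    induction C using Quotient.inductionOn with | h x => exact g.nontrivial_iff S.1 x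
  rw [kGrading, h.sum_circle]
  exact congrArg₂ _ (Finset.sum_congr rfl fun C _ => if_congr (hf C) rfl rfl)
    (Finset.sum_congr rfl fun C _ => if_congr (hg C) rfl rfl)

theorem jtGrading_eq (t : ℝ) (S : E.EnhancedState) :
    E.jtGrading t S = D.jtGrading t (f.restrict S) + D'.jtGrading t (g.restrict S) := by
  rw [jtGrading, jtGrading, jtGrading, h.jGrading_eq, h.kGrading_eq]
  push_cast
  ring

theorem colourChain_eq {v : E.Resolution} {ε : E.Point → Bool} (hε : Compatible v ε) :
    colourChain v ε = tensorVec h.restrictEquiv (colourChain (v ∘ f.crossing) (ε ∘ f.point))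
      (colourChain (v ∘ g.crossing) (ε ∘ g.point)) := by
  classical
  funext S
  change colourChain v ε S = colourChain (v ∘ f.crossing) (ε ∘ f.point) (f.restrict S) *
    colourChain (v ∘ g.crossing) (ε ∘ g.point) (g.restrict S)
  by_cases hv : S.1 = v
  · obtain ⟨v', l⟩ := S
    obtain rfl : v' = v := hv
    have hf (C : D.Circle (v' ∘ f.crossing)) : ε (f.circle v' C).out = ε (f.point C.out) := by
      rw [← hε.out (f.point _), ← f.circle_circleOf, circleOf_out]
    have hg (C : D'.Circle (v' ∘ g.crossing)) : ε (g.circle v' C).out = ε (g.point C.out) := by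
      rw [← hε.out (g.point _), ← g.circle_circleOf, circleOf_out]
    simp only [colourChain, restrict, if_true, h.prod_circle, hf, hg]
    rfl
  · have hor : (f.restrict S).1 ≠ v ∘ f.crossing ∨ (g.restrict S).1 ≠ v ∘ g.crossing := by
      by_contra! hfg
      refine hv (funext fun c => ?_)
      obtain ⟨c | c, rfl⟩ := h.crossing_bijective.2 c
      · exact congrFun hfg.1 c
      · exact congrFun hfg.2 c
    rcases hor with hne | hne <;> simp only [colourChain, hv, hne, if_false, zero_mul, mul_zero]

variable (hlt : ∀ c c', (g.crossing c').time < (f.crossing c).time)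
include hlt

theorem edgeSign_crossing_right (S : E.EnhancedState) (c : D'.Crossing) :
    E.edgeSign S.1 (g.crossing c) = D'.edgeSign (g.restrict S).1 c := by
  classical
  simp only [edgeSign, Finset.card_filter, h.sum_crossing, (hlt _ _).not_gt, g.time_lt_time_iff,
    false_and, if_false, Finset.sum_const_zero, zero_add]
  rfl

theorem edgeSign_crossing_left (S : E.EnhancedState) (c : D.Crossing) :
    E.edgeSign S.1 (f.crossing c) =
      heightSign (g.restrict S) * D.edgeSign (f.restrict S).1 c := by
  classical
  rw [edgeSign, edgeSign, heightSign, ← pow_add, height, Nat.card_eq_fintype_card,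
    Fintype.card_subtype]
  simp only [Finset.card_filter, h.sum_crossing, hlt, f.time_lt_time_iff, true_and]
  rw [add_comm]
  rfl

open Classical in
theorem leeCoeff_eq (S T : E.EnhancedState) : E.leeCoeff S T =
    (if g.restrict T = g.restrict S then
      heightSign (g.restrict S) * D.leeCoeff (f.restrict S) (f.restrict T) else 0) +
    if f.restrict T = f.restrict S then D'.leeCoeff (g.restrict S) (g.restrict T) else 0 := by
  simp only [leeCoeff, h.sum_crossing, h.isEdge_crossing_iff, h.symm.isEdge_crossing_iff,
    saddleCoeff_crossing, h.edgeSign_crossing_left hlt, h.edgeSign_crossing_right hlt]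
  congr 1 <;> split_ifs with he <;>
    simp only [he, and_true, and_false, if_false, Finset.sum_const_zero, Finset.mul_sum, mul_ite,
      mul_zero, mul_assoc]

theorem leeDifferential_tensorVec (x : D.LeeChain) (y : D'.LeeChain) :
    E.leeDifferential (tensorVec h.restrictEquiv x y) =
      tensorVec h.restrictEquiv (D.leeDifferential x) (heightSign * y) +
        tensorVec h.restrictEquiv x (D'.leeDifferential y) := by
  classical
  funext T
  change ∑ S, E.leeCoeff S T * (x (f.restrict S) * y (g.restrict S)) =
    (∑ P, D.leeCoeff P (f.restrict T) * x P) *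
      (heightSign (g.restrict T) * y (g.restrict T)) +
        x (f.restrict T) * ∑ Q, D'.leeCoeff Q (g.restrict T) * y Q
  have hsum (F : D.EnhancedState → D'.EnhancedState → ℂ) :
      ∑ S, F (f.restrict S) (g.restrict S) = ∑ P, ∑ Q, F P Q := by
    rw [← Fintype.sum_prod_type', ← h.restrictEquiv.sum_comp]
    rfl
  simp only [h.leeCoeff_eq hlt, add_mul, ite_mul, zero_mul, Finset.sum_add_distrib]
  refine congrArg₂ _ ((hsum fun P Q => if g.restrict T = Q then
    heightSign Q * D.leeCoeff P (f.restrict T) * (x P * y Q) else 0).trans ?_)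
    ((hsum fun P Q => if f.restrict T = P then
      D'.leeCoeff Q (g.restrict T) * (x P * y Q) else 0).trans ?_)
  · simp only [Finset.sum_ite_eq, Finset.mem_univ, if_true, Finset.sum_mul]
    exact Finset.sum_congr rfl fun P _ => by ring
  · rw [Finset.sum_comm]
    simp only [Finset.sum_ite_eq, Finset.mem_univ, if_true, Finset.mul_sum]
    exact Finset.sum_congr rfl fun Q _ => by ring

theorem attainsLevel_colourChain {t a a' : ℝ} {v : E.Resolution} {ε : E.Point → Bool}
    (hε : Compatible v ε)
    (hcycle : D.leeDifferential (colourChain (v ∘ f.crossing) (ε ∘ f.point)) = 0)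
    (hf : AttainsLevel D.leeDifferential (D.jtGrading t)
      (colourChain (v ∘ f.crossing) (ε ∘ f.point)) a)
    (hg : AttainsLevel D'.leeDifferential (D'.jtGrading t)
      (colourChain (v ∘ g.crossing) (ε ∘ g.point)) a') :
    AttainsLevel E.leeDifferential (E.jtGrading t) (colourChain v ε) (a + a') := by
  rw [h.colourChain_eq hε]
  exact attainsLevel_tensor _ heightSign_mul_heightSign leeDifferential_heightSign_mul
    (h.leeDifferential_tensorVec hlt) (h.jtGrading_eq t) hcycle hf hg

end IsDisjointUnion

end Inclusion

end OrientedAnnularDiagram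

namespace AnnularEvent

theorem mate_add_length {e : AnnularEvent} {l : List Bool} (h : e.Valid l) (hz u : Bool) (q : ℕ) :
    e.mate hz (u, (e.sideStrands l u).length + q) =
      (!u, (e.sideStrands l (!u)).length + q) := by
  cases e with
  | birth i b =>
    have := length_apply_birth h
    have : i ≤ l.length := h
    cases u <;> simp only [mate, sideStrands] at * <;> grind
  | death i =>
    have := length_apply_death h
    have := succ_lt_length_of_valid_death h
    cases u <;> simp only [mate, sideStrands] at * <;> grind
  | cross i s =>
    have := length_apply_cross h
    have : i + 1 < l.length := h
    cases u <;> simp only [mate, sideStrands] at * <;> grind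

theorem mate_shift_add (e : AnnularEvent) (n : ℕ) (hz u : Bool) (p : ℕ) :
    (e.shift n).mate hz (u, n + p) = ((e.mate hz (u, p)).1, n + (e.mate hz (u, p)).2) := by
  cases e <;> cases u <;> simp only [mate, shift] <;> grind

theorem mate_shift_of_lt (e : AnnularEvent) {n p : ℕ} (hp : p < n) (hz u : Bool) :
    (e.shift n).mate hz (u, p) = (!u, p) := by
  cases e <;> cases u <;> simp only [mate, shift] <;> grind

theorem isCross_shift {e : AnnularEvent} {n : ℕ} : (e.shift n).IsCross ↔ e.IsCross := by
  cases e <;> rfl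

end AnnularEvent

namespace OrientedAnnularDiagram

open AnnularEvent

variable {D D' : OrientedAnnularDiagram}

theorem sideStrands_level {h : ℕ} (hh : h < D.word.length) (u : Bool) :
    (D.word[h]).sideStrands (D.level h) u = D.level (h + u.toNat) := by
  cases u
  · rfl
  · exact (D.level_succ h hh).symm

theorem length_word_annularComp :
    (D.annularComp D').word.length = D'.word.length + D.word.length := by
  simp [annularComp, compWord]

theorem word_annularComp_inner {h : ℕ} (hh : h < D'.word.length) :
    (D.annularComp D').word[h]'(by rw [length_word_annularComp]; omega) = D'.word[h] :=
  List.getElem_append_left hh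

theorem word_annularComp_outer {h : ℕ} (hh : h < D.word.length) :
    (D.annularComp D').word[D'.word.length + h]'(by rw [length_word_annularComp]; omega) =
      (D.word[h]).shift D'.start.length := by
  simp [annularComp, compWord, List.getElem_append_right]

theorem level_annularComp {h : ℕ} (hh : h ≤ D'.word.length + D.word.length) :
    (D.annularComp D').level h =
      D'.level (min h D'.word.length) ++ D.level (h - D'.word.length) := by
  rcases le_total h D'.word.length with hle | hle
  · rw [min_eq_left hle, Nat.sub_eq_zero_of_le hle, level_zero]
    exact levelAt_comp_left D D' h hle
  · obtain ⟨k, rfl⟩ := Nat.exists_eq_add_of_le hle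
    rw [min_eq_right hle, Nat.add_sub_cancel_left, level_length]
    exact levelAt_comp_right D D' k (by omega)

theorem length_level_annularComp {h : ℕ} (hh : h ≤ D'.word.length + D.word.length) :
    ((D.annularComp D').level h).length =
      (D'.level (min h D'.word.length)).length + (D.level (h - D'.word.length)).length := by
  rw [level_annularComp hh, List.length_append]

variable (D D') in
/-- A crossing of the outer diagram, as a crossing of the annular composition. -/
def outerCrossing (c : D.Crossing) : (D.annularComp D').Crossing :=
  ⟨⟨D'.word.length + c.time, by rw [length_word_annularComp]; have := c.time_lt; omega⟩, by
    rw [word_annularComp_outer c.time_lt, isCross_shift]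
    exact c.2⟩

variable (D D') in
/-- A crossing of the inner diagram, as a crossing of the annular composition. -/
def innerCrossing (c : D'.Crossing) : (D.annularComp D').Crossing :=
  ⟨⟨c.time, by rw [length_word_annularComp]; have := c.time_lt; omega⟩, by
    rw [word_annularComp_inner c.time_lt]
    exact c.2⟩

theorem time_outerCrossing (c : D.Crossing) :
    (outerCrossing D D' c).time = D'.word.length + c.time := rfl

theorem time_innerCrossing (c : D'.Crossing) : (innerCrossing D D' c).time = c.time := rfl

theorem pos_outerCrossing (c : D.Crossing) :
    (outerCrossing D D' c).pos = D'.start.length + c.pos := by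
  refine (congrArg AnnularEvent.pos (word_annularComp_outer c.time_lt)).trans ?_
  rw [c.word_time]
  rfl

theorem risingOver_outerCrossing (c : D.Crossing) :
    (outerCrossing D D' c).risingOver = c.risingOver := by
  refine (congrArg AnnularEvent.risingOver (word_annularComp_outer c.time_lt)).trans ?_
  rw [c.word_time]
  rfl

theorem pos_innerCrossing (c : D'.Crossing) : (innerCrossing D D' c).pos = c.pos :=
  congrArg AnnularEvent.pos (word_annularComp_inner c.time_lt)

theorem risingOver_innerCrossing (c : D'.Crossing) :
    (innerCrossing D D' c).risingOver = c.risingOver :=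
  congrArg AnnularEvent.risingOver (word_annularComp_inner c.time_lt)

theorem exists_outerCrossing {c : (D.annularComp D').Crossing} {k : ℕ}
    (hc : c.time = D'.word.length + k) : ∃ c', c'.time = k ∧ outerCrossing D D' c' = c := by
  obtain ⟨⟨h, hh⟩, hcross⟩ := c
  obtain rfl : h = D'.word.length + k := hc
  have hk : k < D.word.length := by rw [length_word_annularComp] at hh; omega
  exact ⟨⟨⟨k, hk⟩, by rwa [word_annularComp_outer hk, isCross_shift] at hcross⟩, rfl, rfl⟩

theorem exists_innerCrossing {c : (D.annularComp D').Crossing} (hc : c.time < D'.word.length) :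
    ∃ c', innerCrossing D D' c' = c := by
  have hcross : ((D.annularComp D').word[c.time]'c.time_lt).IsCross := c.2
  rw [word_annularComp_inner hc] at hcross
  exact ⟨⟨⟨c.time, hc⟩, hcross⟩, rfl⟩

theorem bijective_sumElim_crossing :
    Function.Bijective (Sum.elim (outerCrossing D D') (innerCrossing D D')) := by
  constructor
  · refine Function.Injective.sumElim (fun c c' h => ?_) (fun c c' h => ?_) fun c c' h => ?_
    all_goals have ht := congrArg Crossing.time h
    · exact Crossing.ext_time (Nat.add_left_cancel ht)
    · exact Crossing.ext_time ht
    · have hlt := c'.time_lt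
      rw [time_outerCrossing, time_innerCrossing] at ht
      omega
  · intro c
    rcases lt_or_ge c.time D'.word.length with hlt | hge
    · obtain ⟨c', rfl⟩ := exists_innerCrossing hlt
      exact ⟨Sum.inr c', rfl⟩
    · obtain ⟨c', -, rfl⟩ := exists_outerCrossing (Nat.add_sub_of_le hge).symm
      exact ⟨Sum.inl c', rfl⟩

theorem horizontal_outerCrossing (v : (D.annularComp D').Resolution) (k : ℕ) :
    horizontal v (D'.word.length + k) = horizontal (v ∘ outerCrossing D D') k := by
  refine decide_eq_decide.2 ⟨?_, ?_⟩
  · rintro ⟨c, hc, hv⟩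
    obtain ⟨c, rfl, rfl⟩ := exists_outerCrossing hc
    exact ⟨c, rfl, hv.trans (risingOver_outerCrossing c)⟩
  · rintro ⟨c, rfl, hv⟩
    exact ⟨outerCrossing D D' c, rfl, hv.trans (risingOver_outerCrossing c).symm⟩

theorem horizontal_innerCrossing (v : (D.annularComp D').Resolution) {h : ℕ}
    (hh : h < D'.word.length) : horizontal v h = horizontal (v ∘ innerCrossing D D') h := by
  refine decide_eq_decide.2 ⟨?_, ?_⟩
  · rintro ⟨c, rfl, hv⟩
    obtain ⟨c, rfl⟩ := exists_innerCrossing hh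
    exact ⟨c, rfl, hv.trans (risingOver_innerCrossing c)⟩
  · rintro ⟨c, rfl, hv⟩
    exact ⟨innerCrossing D D' c, rfl, hv.trans (risingOver_innerCrossing c).symm⟩

variable (D D') in
/-- A point of the outer diagram, as a point of the annular composition. -/
def outerPoint (x : D.Point) : (D.annularComp D').Point :=
  ⟨⟨D'.word.length + x.1, by rw [length_word_annularComp]; omega⟩, D'.start.length + x.2,
    (Nat.add_lt_add_left x.2.2 _).trans_eq <| by
      rw [← List.length_append]
      exact congrArg _ (levelAt_comp_right D D' x.1 (Nat.lt_succ_iff.1 x.1.2)).symm⟩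

variable (D D') in
/-- A point of the inner diagram, as a point of the annular composition. -/
def innerPoint (y : D'.Point) : (D.annularComp D').Point :=
  ⟨⟨y.1, by rw [length_word_annularComp]; omega⟩, y.2,
    (Nat.lt_add_right _ y.2.2).trans_eq <| by
      rw [← List.length_append]
      exact congrArg _ (levelAt_comp_left D D' y.1 (Nat.lt_succ_iff.1 y.1.2)).symm⟩

theorem height_le (z : (D.annularComp D').Point) : z.1 ≤ D'.word.length + D.word.length :=
  (Nat.lt_succ_iff.1 z.1.2).trans_eq length_word_annularComp

variable (D D') in
/-- The contraction of the annular composition to the disjoint union of its two parts: while the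
events of one part take place, the strands of the other one run radially straight on, and are
contracted to points. -/
def contract (z : (D.annularComp D').Point) : D.Point ⊕ D'.Point :=
  if h : z.2 < (D'.level (min z.1 D'.word.length)).length then
    Sum.inr ⟨⟨min z.1 D'.word.length, by omega⟩, z.2, h⟩
  else
    Sum.inl ⟨⟨z.1 - D'.word.length, by
        have := height_le z
        omega⟩,
      z.2 - (D'.level (min z.1 D'.word.length)).length, by
        have := length_level_annularComp (height_le z)
        have := z.2.2
        dsimp only
        omega⟩

theorem contract_eq_inl {z : (D.annularComp D').Point} {x : D.Point} :
    contract D D' z = Sum.inl x ↔ x.coord.1 = z.coord.1 - D'.word.length ∧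
      z.coord.2 = (D'.level (min z.coord.1 D'.word.length)).length + x.coord.2 := by
  have hz : z.coord = ((z.1 : ℕ), (z.2 : ℕ)) := rfl
  unfold contract
  split_ifs with h
  · refine iff_of_false not_false fun hx => ?_
    simp only [hz] at hx
    omega
  · rw [Sum.inl.injEq, ← Point.coord_injective.eq_iff, Prod.ext_iff, hz]
    simp only [Point.coord]
    omega

theorem contract_eq_inr {z : (D.annularComp D').Point} {y : D'.Point} :
    contract D D' z = Sum.inr y ↔ y.coord = (min z.coord.1 D'.word.length, z.coord.2) := by
  have hz : z.coord = ((z.1 : ℕ), (z.2 : ℕ)) := rfl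
  unfold contract
  split_ifs with h
  · rw [Sum.inr.injEq, ← Point.coord_injective.eq_iff, eq_comm]
    rfl
  · refine iff_of_false not_false fun hy => h ?_
    have hlt := y.2.2
    rw [Prod.ext_iff, hz] at hy
    simp only [Point.coord] at hy
    rwa [hy.2, hy.1] at hlt

end OrientedAnnularDiagram

namespace OrientedAnnularDiagram

open AnnularEvent

variable {D D' : OrientedAnnularDiagram} {v : (D.annularComp D').Resolution}
  {z z' : (D.annularComp D').Point} {x : D.Point} {y : D'.Point} {u : Bool} {h k p : ℕ}

theorem contract_outerPoint (x : D.Point) : contract D D' (outerPoint D D' x) = Sum.inl x := by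
  rw [contract_eq_inl]
  change x.coord.1 = D'.word.length + x.1 - D'.word.length ∧ D'.start.length + (x.2 : ℕ) =
    (D'.level (min (D'.word.length + x.1) D'.word.length)).length + x.coord.2
  rw [min_eq_right (Nat.le_add_right _ _), level_length, Nat.add_sub_cancel_left]
  exact ⟨rfl, rfl⟩

theorem contract_innerPoint (y : D'.Point) : contract D D' (innerPoint D D' y) = Sum.inr y := by
  rw [contract_eq_inr]
  exact Prod.ext (min_eq_left (Nat.lt_succ_iff.1 y.1.2)).symm rfl

theorem eq_of_contract_eq (hz : z.coord.1 = z'.coord.1)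
    (hc : contract D D' z = contract D D' z') : z = z' := by
  refine Point.coord_injective (Prod.ext hz ?_)
  rcases hc' : contract D D' z' with x | y <;> rw [hc'] at hc
  · rw [contract_eq_inl] at hc hc'
    rw [hc.2, hc'.2, hz]
  · rw [contract_eq_inr, Prod.ext_iff] at hc hc'
    exact hc.2.symm.trans hc'.2

theorem exists_contract_eq_inl (hx : x.coord.1 = h - D'.word.length)
    (hh : h ≤ D'.word.length + D.word.length) :
    ∃ z, z.coord.1 = h ∧ contract D D' z = Sum.inl x := by
  have hlt : x.coord.2 < (D.level x.coord.1).length := x.2.2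
  have hlen := length_level_annularComp hh
  rw [← hx] at hlen
  refine ⟨⟨⟨h, by rw [length_word_annularComp]; omega⟩,
    (D'.level (min h D'.word.length)).length + x.coord.2, by dsimp only; omega⟩, rfl, ?_⟩
  exact contract_eq_inl.2 ⟨hx, rfl⟩

theorem exists_contract_eq_inr (hy : y.coord.1 = min h D'.word.length)
    (hh : h ≤ D'.word.length + D.word.length) :
    ∃ z, z.coord.1 = h ∧ contract D D' z = Sum.inr y := by
  have hlt : y.coord.2 < (D'.level y.coord.1).length := y.2.2
  have hlen := length_level_annularComp hh
  rw [← hy] at hlen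
  refine ⟨⟨⟨h, by rw [length_word_annularComp]; omega⟩, y.coord.2, by dsimp only; omega⟩, rfl, ?_⟩
  exact contract_eq_inr.2 (Prod.ext hy rfl)

theorem coord_mate_inner (hh : h < D'.word.length) (hz : z.coord = (h + u.toNat, p)) :
    (z.mate v u).coord =
      (h + ((D'.word[h]).mate (horizontal (v ∘ innerCrossing D D') h) (u, p)).1.toNat,
        ((D'.word[h]).mate (horizontal (v ∘ innerCrossing D D') h) (u, p)).2) := by
  rw [Point.coord_mate_of_coord v (by rw [length_word_annularComp]; omega) hz,
    horizontal_innerCrossing v hh, word_annularComp_inner hh]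

theorem coord_mate_outer (hk : k < D.word.length)
    (hz : z.coord = (D'.word.length + k + u.toNat, p)) :
    (z.mate v u).coord = (D'.word.length + k +
        (((D.word[k]).shift D'.start.length).mate
          (horizontal (v ∘ outerCrossing D D') k) (u, p)).1.toNat,
      (((D.word[k]).shift D'.start.length).mate
        (horizontal (v ∘ outerCrossing D D') k) (u, p)).2) := by
  rw [Point.coord_mate_of_coord v (by rw [length_word_annularComp]; omega) hz,
    horizontal_outerCrossing v k, word_annularComp_outer hk]

theorem contract_mate_inner_left (hh : h < D'.word.length) (hz : z.coord.1 = h + u.toNat)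
    (hx : contract D D' z = Sum.inl x) :
    (z.mate v u).coord.1 = h + (!u).toNat ∧ contract D D' (z.mate v u) = Sum.inl x := by
  have hle (u : Bool) : h + u.toNat ≤ D'.word.length := by have := u.toNat_le; omega
  rw [contract_eq_inl, hz, min_eq_left (hle u)] at hx
  have hmate := mate_add_length (D'.valid h hh) (horizontal (v ∘ innerCrossing D D') h) u x.coord.2
  have hside (u : Bool) : (D'.word[h]).sideStrands (levelAt D'.start D'.word h) u =
    D'.level (h + u.toNat) := sideStrands_level hh u
  rw [hside, hside] at hmate
  have hcoord := coord_mate_inner (v := v) hh (Prod.ext hz hx.2)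
  rw [hmate] at hcoord
  rw [contract_eq_inl, hcoord, min_eq_left (hle _), Nat.sub_eq_zero_of_le (hle _), hx.1,
    Nat.sub_eq_zero_of_le (hle _)]
  exact ⟨rfl, rfl, rfl⟩

theorem contract_mate_inner_right (hh : h < D'.word.length) (hz : z.coord.1 = h + u.toNat)
    (hy : contract D D' z = Sum.inr y) :
    contract D D' (z.mate v u) = Sum.inr (y.mate (v ∘ innerCrossing D D') u) := by
  have hle (u : Bool) : h + u.toNat ≤ D'.word.length := by have := u.toNat_le; omega
  rw [contract_eq_inr, hz, min_eq_left (hle u)] at hy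
  rw [contract_eq_inr, Point.coord_mate_of_coord _ hh hy, coord_mate_inner hh (Prod.ext hz rfl),
    min_eq_left (hle _)]

theorem contract_mate_outer_left (hk : k < D.word.length)
    (hz : z.coord.1 = D'.word.length + k + u.toNat) (hx : contract D D' z = Sum.inl x) :
    contract D D' (z.mate v u) = Sum.inl (x.mate (v ∘ outerCrossing D D') u) := by
  rw [contract_eq_inl, hz, min_eq_right (by omega), level_length] at hx
  have hcoord := coord_mate_outer (v := v) hk (Prod.ext hz hx.2)
  rw [mate_shift_add] at hcoord
  have hxu : x.coord = (k + u.toNat, x.coord.2) := Prod.ext (by rw [hx.1]; omega) rfl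
  rw [contract_eq_inl, Point.coord_mate_of_coord _ hk hxu, hcoord, min_eq_right (by omega),
    level_length]
  exact ⟨by dsimp only; omega, rfl⟩

theorem contract_mate_outer_right (hk : k < D.word.length)
    (hz : z.coord.1 = D'.word.length + k + u.toNat) (hy : contract D D' z = Sum.inr y) :
    (z.mate v u).coord.1 = D'.word.length + k + (!u).toNat ∧
      contract D D' (z.mate v u) = Sum.inr y := by
  rw [contract_eq_inr, hz, min_eq_right (by omega)] at hy
  have hlt : y.coord.2 < D'.start.length := by
    have hlt : y.coord.2 < (D'.level y.coord.1).length := y.2.2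
    rwa [hy, level_length, ← congrArg Prod.snd hy] at hlt
  have hcoord := coord_mate_outer (v := v) hk (Prod.ext hz (congrArg Prod.snd hy).symm)
  rw [mate_shift_of_lt _ hlt] at hcoord
  rw [contract_eq_inr, hcoord, min_eq_right (by omega), hy]
  exact ⟨rfl, rfl⟩

theorem contract_mate_closing
    (hz : z.coord.1 = if u then 0 else (D.annularComp D').word.length) :
    contract D D' (z.mate v u) = Sum.map (·.mate (v ∘ outerCrossing D D') u)
      (·.mate (v ∘ innerCrossing D D') u) (contract D D' z) := by
  have hcoord := Point.coord_mate_of_closing v hz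
  rw [length_word_annularComp] at hz hcoord
  rcases hc : contract D D' z with x | y
  · rw [contract_eq_inl, hz] at hc
    have hx : x.coord.1 = if u then 0 else D.word.length := by
      rw [hc.1]
      cases u <;> simp
    rw [Sum.map_inl, contract_eq_inl, hcoord, Point.coord_mate_of_closing _ hx, hc.2]
    cases u <;> simp [level_zero, level_length]
  · rw [contract_eq_inr, hz] at hc
    have hy : y.coord.1 = if u then 0 else D'.word.length := by
      rw [hc]
      cases u <;> simp
    rw [Sum.map_inr, contract_eq_inr, hcoord, Point.coord_mate_of_closing _ hy, hc]
    cases u <;> simp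

variable (v z) in
/-- The circle of one of the two parts on which the contraction of `z` lies. -/
def contractCircle : D.Circle (v ∘ outerCrossing D D') ⊕ D'.Circle (v ∘ innerCrossing D D') :=
  (contract D D' z).map (D.circleOf _) (D'.circleOf _)

theorem contractCircle_mate : contractCircle v (z.mate v u) = contractCircle v z := by
  have hpart (s : D.Point ⊕ D'.Point) :
      (s.map (·.mate (v ∘ outerCrossing D D') u) (·.mate (v ∘ innerCrossing D D') u)).map
        (D.circleOf (v ∘ outerCrossing D D')) (D'.circleOf (v ∘ innerCrossing D D')) =
      s.map (D.circleOf _) (D'.circleOf _) := by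
    rcases s with x | y
    · exact congrArg Sum.inl (circleOf_eq_iff.2 (Setoid.symm' _ (circleSetoid_mate _ x u)))
    · exact congrArg Sum.inr (circleOf_eq_iff.2 (Setoid.symm' _ (circleSetoid_mate _ y u)))
  unfold contractCircle
  rcases z.event_or_closing u with ⟨h, hh, hz⟩ | hz
  · rw [length_word_annularComp] at hh
    replace hz := congrArg Prod.fst hz
    rcases lt_or_ge h D'.word.length with hlt | hge
    · rcases hc : contract D D' z with x | y
      · rw [(contract_mate_inner_left hlt hz hc).2]
      · rw [contract_mate_inner_right hlt hz hc]
        exact hpart (Sum.inr y)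
    · obtain ⟨k, rfl⟩ := Nat.exists_eq_add_of_le hge
      have hk : k < D.word.length := by omega
      rcases hc : contract D D' z with x | y
      · rw [contract_mate_outer_left hk hz hc]
        exact hpart (Sum.inl x)
      · rw [(contract_mate_outer_right hk hz hc).2]
  · rw [contract_mate_closing hz, hpart]

theorem rel_outerPoint_of_contract_eq (v : (D.annularComp D').Resolution)
    (hc : contract D D' z = Sum.inl x) :
    (D.annularComp D').circleSetoid v (outerPoint D D' x) z := by
  induction hn : D'.word.length - z.coord.1 generalizing z with
  | zero =>
    rw [eq_of_contract_eq (z := outerPoint D D' x) _ ((contract_outerPoint x).trans hc.symm)]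
    have hx := (contract_eq_inl.1 hc).1
    change D'.word.length + x.coord.1 = z.coord.1
    omega
  | succ n ih =>
    obtain ⟨hz, hc'⟩ := contract_mate_inner_left (v := v) (u := false) (h := z.coord.1)
      (by omega) rfl hc
    refine Setoid.trans' _ (ih hc' ?_) (Setoid.symm' _ (circleSetoid_mate v z false))
    rw [hz]
    exact show D'.word.length - (z.coord.1 + 1) = n by omega

theorem rel_innerPoint_of_contract_eq (v : (D.annularComp D').Resolution)
    (hc : contract D D' z = Sum.inr y) :
    (D.annularComp D').circleSetoid v (innerPoint D D' y) z := by
  induction hn : z.coord.1 - D'.word.length generalizing z with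
  | zero =>
    rw [eq_of_contract_eq (z := innerPoint D D' y) _ ((contract_innerPoint y).trans hc.symm)]
    have hy := congrArg Prod.fst (contract_eq_inr.1 hc)
    change y.coord.1 = z.coord.1
    omega
  | succ n ih =>
    have hle : z.coord.1 ≤ _ := height_le z
    have hheight : z.coord.1 = D'.word.length + n + true.toNat := by rw [Bool.toNat_true]; omega
    obtain ⟨hz, hc'⟩ := contract_mate_outer_right (v := v) (by omega) hheight hc
    refine Setoid.trans' _ (ih hc' ?_) (Setoid.symm' _ (circleSetoid_mate v z true))
    rw [hz]
    exact show D'.word.length + n + 0 - D'.word.length = n by omega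

theorem exists_contract_mate_eq_inl (v : (D.annularComp D').Resolution) (x : D.Point) (u : Bool) :
    ∃ z, contract D D' z = Sum.inl x ∧
      contract D D' (z.mate v u) = Sum.inl (x.mate (v ∘ outerCrossing D D') u) := by
  rcases x.event_or_closing u with ⟨k, hk, hx⟩ | hx
  · refine ⟨outerPoint D D' x, contract_outerPoint x,
      contract_mate_outer_left hk ?_ (contract_outerPoint x)⟩
    rw [add_assoc, ← show x.coord.1 = k + u.toNat from congrArg Prod.fst hx]
    rfl
  · obtain ⟨z, hz, hc⟩ := exists_contract_eq_inl (D' := D') (x := x)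
      (h := if u then 0 else D'.word.length + D.word.length)
      (by rw [hx]; cases u <;> simp) (by cases u <;> simp)
    refine ⟨z, hc, ?_⟩
    rw [contract_mate_closing (by rw [hz, length_word_annularComp]), hc, Sum.map_inl]

theorem exists_contract_mate_eq_inr (v : (D.annularComp D').Resolution) (y : D'.Point) (u : Bool) :
    ∃ z, contract D D' z = Sum.inr y ∧
      contract D D' (z.mate v u) = Sum.inr (y.mate (v ∘ innerCrossing D D') u) := by
  rcases y.event_or_closing u with ⟨h, hh, hy⟩ | hy
  · exact ⟨innerPoint D D' y, contract_innerPoint y,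
      contract_mate_inner_right hh (congrArg Prod.fst hy) (contract_innerPoint y)⟩
  · obtain ⟨z, hz, hc⟩ := exists_contract_eq_inr (D := D) (y := y)
      (h := if u then 0 else D'.word.length + D.word.length)
      (by rw [hy]; cases u <;> simp) (by cases u <;> simp)
    refine ⟨z, hc, ?_⟩
    rw [contract_mate_closing (by rw [hz, length_word_annularComp]), hc, Sum.map_inr]

theorem rel_outerPoint (v : (D.annularComp D').Resolution) {x x' : D.Point}
    (h : D.circleSetoid (v ∘ outerCrossing D D') x x') :
    (D.annularComp D').circleSetoid v (outerPoint D D' x) (outerPoint D D' x') := by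
  refine circleSetoid_le (r := Setoid.comap (outerPoint D D') (circleSetoid _ v)) (fun x u => ?_) h
  obtain ⟨z, hz, hz'⟩ := exists_contract_mate_eq_inl v x u
  change (circleSetoid _ v) (outerPoint D D' x) (outerPoint D D' (x.mate _ u))
  exact Setoid.trans' _ (rel_outerPoint_of_contract_eq v hz) (Setoid.trans' _
    (circleSetoid_mate v z u) (Setoid.symm' _ (rel_outerPoint_of_contract_eq v hz')))

theorem rel_innerPoint (v : (D.annularComp D').Resolution) {y y' : D'.Point}
    (h : D'.circleSetoid (v ∘ innerCrossing D D') y y') :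
    (D.annularComp D').circleSetoid v (innerPoint D D' y) (innerPoint D D' y') := by
  refine circleSetoid_le (r := Setoid.comap (innerPoint D D') (circleSetoid _ v)) (fun y u => ?_) h
  obtain ⟨z, hz, hz'⟩ := exists_contract_mate_eq_inr v y u
  change (circleSetoid _ v) (innerPoint D D' y) (innerPoint D D' (y.mate _ u))
  exact Setoid.trans' _ (rel_innerPoint_of_contract_eq v hz) (Setoid.trans' _
    (circleSetoid_mate v z u) (Setoid.symm' _ (rel_innerPoint_of_contract_eq v hz')))

theorem circleSetoid_annularComp_iff :
    (D.annularComp D').circleSetoid v z z' ↔ contractCircle v z = contractCircle v z' := by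
  refine ⟨fun h => circleSetoid_le (r := Setoid.ker (contractCircle v))
    (fun z u => contractCircle_mate.symm) h, fun h => ?_⟩
  unfold contractCircle at h
  rcases hc : contract D D' z with x | y <;> rcases hc' : contract D D' z' with x' | y' <;>
    rw [hc, hc'] at h
  · exact Setoid.trans' _ (Setoid.symm' _ (rel_outerPoint_of_contract_eq v hc)) (Setoid.trans' _
      (rel_outerPoint v (circleOf_eq_iff.1 (Sum.inl_injective h)))
      (rel_outerPoint_of_contract_eq v hc'))
  · exact (Sum.inl_ne_inr h).elim
  · exact (Sum.inr_ne_inl h).elim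
  · exact Setoid.trans' _ (Setoid.symm' _ (rel_innerPoint_of_contract_eq v hc)) (Setoid.trans' _
      (rel_innerPoint v (circleOf_eq_iff.1 (Sum.inr_injective h)))
      (rel_innerPoint_of_contract_eq v hc'))

theorem contractCircle_outerPoint :
    contractCircle v (outerPoint D D' x) = Sum.inl (D.circleOf _ x) := by
  rw [contractCircle, contract_outerPoint, Sum.map_inl]

theorem contractCircle_innerPoint :
    contractCircle v (innerPoint D D' y) = Sum.inr (D'.circleOf _ y) := by
  rw [contractCircle, contract_innerPoint, Sum.map_inr]

theorem contractCircle_eq_inl {C : D.Circle (v ∘ outerCrossing D D')} :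
    contractCircle v z = Sum.inl C ↔ ∃ x, contract D D' z = Sum.inl x ∧ D.circleOf _ x = C := by
  unfold contractCircle
  cases contract D D' z <;> simp

theorem contractCircle_eq_inr {C : D'.Circle (v ∘ innerCrossing D D')} :
    contractCircle v z = Sum.inr C ↔ ∃ y, contract D D' z = Sum.inr y ∧ D'.circleOf _ y = C := by
  unfold contractCircle
  cases contract D D' z <;> simp

theorem natCard_eq_of_contract {α : Type*} {ι : α → D.Point ⊕ D'.Point} (hι : ι.Injective)
    {p : α → Prop} {q : (D.annularComp D').Point → Prop} (hq : ∀ z, q z → z.coord.1 = 0)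
    (hp : ∀ x, p x → ∃ z, q z ∧ contract D D' z = ι x)
    (hqp : ∀ z, q z → ∃ x, p x ∧ contract D D' z = ι x) :
    Nat.card {z // q z} = Nat.card {x // p x} := by
  choose f hf hcontract using hp
  refine (Nat.card_eq_of_bijective (fun x : {x // p x} => ⟨f x x.2, hf x x.2⟩) ⟨?_, ?_⟩).symm
  · intro x x' h
    refine Subtype.ext (hι ?_)
    have hf' : f x x.2 = f x' x'.2 := congrArg Subtype.val h
    rw [← hcontract x x.2, ← hcontract x' x'.2, hf']
  · rintro ⟨z, hz⟩
    obtain ⟨x, hx, hc⟩ := hqp z hz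
    exact ⟨⟨x, hx⟩, Subtype.ext (eq_of_contract_eq ((hq _ (hf x hx)).trans (hq z hz).symm)
      ((hcontract x hx).trans hc.symm))⟩

theorem nontrivial_outerPoint :
    (D.annularComp D').Nontrivial v ((D.annularComp D').circleOf v (outerPoint D D' x)) ↔
      D.Nontrivial (v ∘ outerCrossing D D') (D.circleOf _ x) := by
  refine iff_of_eq (congrArg Odd (natCard_eq_of_contract Sum.inl_injective
    (fun z hz => Fin.val_eq_zero_iff.2 hz.1) ?_ ?_))
  · rintro x' ⟨hx', hcircle⟩
    obtain ⟨z, hz, hc⟩ := exists_contract_eq_inl (D' := D') (x := x') (h := 0)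
      (by rw [Nat.zero_sub]; exact Fin.val_eq_zero_iff.2 hx') (Nat.zero_le _)
    refine ⟨z, ⟨Fin.val_eq_zero_iff.1 hz, ?_⟩, hc⟩
    rw [circleOf_eq_iff, circleSetoid_annularComp_iff, contractCircle_outerPoint,
      contractCircle_eq_inl]
    exact ⟨x', hc, hcircle⟩
  · rintro z ⟨hz, hcircle⟩
    rw [circleOf_eq_iff, circleSetoid_annularComp_iff, contractCircle_outerPoint,
      contractCircle_eq_inl] at hcircle
    obtain ⟨x', hc, hcircle⟩ := hcircle
    refine ⟨x', ⟨Fin.val_eq_zero_iff.1 ?_, hcircle⟩, hc⟩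
    have hz : z.coord.1 = 0 := Fin.val_eq_zero_iff.2 hz
    exact (contract_eq_inl.1 hc).1.trans (by rw [hz, Nat.zero_sub])

theorem nontrivial_innerPoint :
    (D.annularComp D').Nontrivial v ((D.annularComp D').circleOf v (innerPoint D D' y)) ↔
      D'.Nontrivial (v ∘ innerCrossing D D') (D'.circleOf _ y) := by
  refine iff_of_eq (congrArg Odd (natCard_eq_of_contract Sum.inr_injective
    (fun z hz => Fin.val_eq_zero_iff.2 hz.1) ?_ ?_))
  · rintro y' ⟨hy', hcircle⟩
    obtain ⟨z, hz, hc⟩ := exists_contract_eq_inr (D := D) (y := y') (h := 0)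
      (by rw [Nat.zero_min]; exact Fin.val_eq_zero_iff.2 hy') (Nat.zero_le _)
    refine ⟨z, ⟨Fin.val_eq_zero_iff.1 hz, ?_⟩, hc⟩
    rw [circleOf_eq_iff, circleSetoid_annularComp_iff, contractCircle_innerPoint,
      contractCircle_eq_inr]
    exact ⟨y', hc, hcircle⟩
  · rintro z ⟨hz, hcircle⟩
    rw [circleOf_eq_iff, circleSetoid_annularComp_iff, contractCircle_innerPoint,
      contractCircle_eq_inr] at hcircle
    obtain ⟨y', hc, hcircle⟩ := hcircle
    refine ⟨y', ⟨Fin.val_eq_zero_iff.1 ?_, hcircle⟩, hc⟩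
    have hz : z.coord.1 = 0 := Fin.val_eq_zero_iff.2 hz
    exact (congrArg Prod.fst (contract_eq_inr.1 hc)).trans (by rw [hz, Nat.zero_min])

end OrientedAnnularDiagram

namespace OrientedAnnularDiagram

variable {D D' : OrientedAnnularDiagram}

theorem lowerLeft_outerCrossing (c : D.Crossing) :
    (outerCrossing D D' c).lowerLeft = outerPoint D D' c.lowerLeft :=
  Point.coord_injective (Prod.ext rfl (pos_outerCrossing c))

theorem lowerRight_outerCrossing (c : D.Crossing) :
    (outerCrossing D D' c).lowerRight = outerPoint D D' c.lowerRight :=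
  Point.coord_injective (Prod.ext rfl (congrArg (· + 1) (pos_outerCrossing c)))

theorem upperRight_outerCrossing (c : D.Crossing) :
    (outerCrossing D D' c).upperRight = outerPoint D D' c.upperRight :=
  Point.coord_injective (Prod.ext rfl (congrArg (· + 1) (pos_outerCrossing c)))

theorem lowerLeft_innerCrossing (c : D'.Crossing) :
    (innerCrossing D D' c).lowerLeft = innerPoint D D' c.lowerLeft :=
  Point.coord_injective (Prod.ext rfl (pos_innerCrossing c))

theorem lowerRight_innerCrossing (c : D'.Crossing) :
    (innerCrossing D D' c).lowerRight = innerPoint D D' c.lowerRight :=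
  Point.coord_injective (Prod.ext rfl (congrArg (· + 1) (pos_innerCrossing c)))

theorem upperRight_innerCrossing (c : D'.Crossing) :
    (innerCrossing D D' c).upperRight = innerPoint D D' c.upperRight :=
  Point.coord_injective (Prod.ext rfl (congrArg (· + 1) (pos_innerCrossing c)))

theorem dir_outerPoint (x : D.Point) : (outerPoint D D' x).dir = x.dir := by
  have hlevel := levelAt_comp_right D D' x.1 (Nat.lt_succ_iff.1 x.1.2)
  rw [← Option.some_inj, ← Point.getElem?_coord, ← Point.getElem?_coord]
  refine (congrArg (·[D'.start.length + x.coord.2]?) hlevel).trans ?_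
  rw [List.getElem?_append_right (Nat.le_add_right _ _), Nat.add_sub_cancel_left]
  rfl

theorem dir_innerPoint (y : D'.Point) : (innerPoint D D' y).dir = y.dir := by
  have hlevel := levelAt_comp_left D D' y.1 (Nat.lt_succ_iff.1 y.1.2)
  rw [← Option.some_inj, ← Point.getElem?_coord, ← Point.getElem?_coord]
  exact (congrArg (·[y.coord.2]?) hlevel).trans (List.getElem?_append_left y.2.2)

variable (D D') in
/-- The outer diagram as a part of the annular composition. -/
def outerInclusion : Inclusion D (D.annularComp D') where
  point := outerPoint D D'
  crossing := outerCrossing D D'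
  rel_iff v x y := by
    rw [circleSetoid_annularComp_iff, contractCircle_outerPoint, contractCircle_outerPoint,
      Sum.inl.injEq, circleOf_eq_iff]
  nontrivial_iff v x := nontrivial_outerPoint
  dir_point := dir_outerPoint
  lowerLeft_crossing := lowerLeft_outerCrossing
  lowerRight_crossing := lowerRight_outerCrossing
  upperRight_crossing := upperRight_outerCrossing
  risingOver_crossing := risingOver_outerCrossing
  time_lt_time_iff _ _ := Nat.add_lt_add_iff_left

variable (D D') in
/-- The inner diagram as a part of the annular composition. -/
def innerInclusion : Inclusion D' (D.annularComp D') where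
  point := innerPoint D D'
  crossing := innerCrossing D D'
  rel_iff v x y := by
    rw [circleSetoid_annularComp_iff, contractCircle_innerPoint, contractCircle_innerPoint,
      Sum.inr.injEq, circleOf_eq_iff]
  nontrivial_iff v x := nontrivial_innerPoint
  dir_point := dir_innerPoint
  lowerLeft_crossing := lowerLeft_innerCrossing
  lowerRight_crossing := lowerRight_innerCrossing
  upperRight_crossing := upperRight_innerCrossing
  risingOver_crossing := risingOver_innerCrossing
  time_lt_time_iff _ _ := Iff.rfl

theorem isDisjointUnion_annularComp :
    (outerInclusion D D').IsDisjointUnion (innerInclusion D D') where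
  crossing_bijective := bijective_sumElim_crossing
  not_rel v x y h := by
    have hcircle := circleSetoid_annularComp_iff.1 h
    change contractCircle v (outerPoint D D' x) = contractCircle v (innerPoint D D' y) at hcircle
    rw [contractCircle_outerPoint, contractCircle_innerPoint] at hcircle
    exact Sum.inl_ne_inr hcircle
  exists_rel z := by
    rcases hc : contract D D' z with x | y
    · exact Or.inl ⟨x, fun v => rel_outerPoint_of_contract_eq v hc⟩
    · exact Or.inr ⟨y, fun v => rel_innerPoint_of_contract_eq v hc⟩

theorem leeColour_outerPoint (x : D.Point) :
    (D.annularComp D').leeColour (outerPoint D D' x) = D.leeColour x := by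
  have hstart : (D.annularComp D').start.length = D'.start.length + D.start.length :=
    List.length_append
  have hpos : (outerPoint D D' x).coord.2 = D'.start.length + x.coord.2 := rfl
  simp only [leeColour, Point.bodd_leeIndex, dir_outerPoint, hstart, hpos, Nat.bodd_add]
  cases D'.start.length.bodd <;> cases D.start.length.bodd <;> simp

theorem leeColour_innerPoint (y : D'.Point) :
    (D.annularComp D').leeColour (innerPoint D D' y) =
      (D.start.length.bodd ^^ D'.leeColour y) := by
  have hstart : (D.annularComp D').start.length = D'.start.length + D.start.length :=
    List.length_append
  have hpos : (innerPoint D D' y).coord.2 = y.coord.2 := rfl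
  simp only [leeColour, Point.bodd_leeIndex, dir_innerPoint, hstart, hpos, Nat.bodd_add]
  cases D'.start.length.bodd <;> cases D.start.length.bodd <;> simp

/-- The colouring is the one that the canonical cycle of the composition induces on the inner
diagram: the strands of the outer diagram separate its circles from `𝕆`, and so exchange the labels
`𝐚` and `𝐛` if their number is odd. -/
theorem attainsLevel_innerColour (D D' : OrientedAnnularDiagram) (t : ℝ) :
    AttainsLevel D'.leeDifferential (D'.jtGrading t) (colourChain D'.orientedResolution
      fun y => D.start.length.bodd ^^ D'.leeColour y) (D'.annularRasmussen t) := by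
  cases D.start.length.bodd
  · simpa only [Bool.false_xor, canonicalCycle_eq] using D'.attainsLevel_canonicalCycle t
  · simpa only [Bool.true_xor] using D'.attainsLevel_colourChain_not t

theorem annularRasmussen_annularComp (D D' : OrientedAnnularDiagram) (t : ℝ) :
    (D.annularComp D').annularRasmussen t = D.annularRasmussen t + D'.annularRasmussen t := by
  have houter : (D.annularComp D').orientedResolution ∘ outerCrossing D D' =
    D.orientedResolution := (outerInclusion D D').orientedResolution_comp_crossing
  have hinner : (D.annularComp D').orientedResolution ∘ innerCrossing D D' =
    D'.orientedResolution := (innerInclusion D D').orientedResolution_comp_crossing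
  have houterColour : (D.annularComp D').leeColour ∘ outerPoint D D' = D.leeColour :=
    funext leeColour_outerPoint
  have hinnerColour : (D.annularComp D').leeColour ∘ innerPoint D D' =
    fun y => D.start.length.bodd ^^ D'.leeColour y := funext leeColour_innerPoint
  refine annularRasmussen_eq_of_attainsLevel ?_
  rw [canonicalCycle_eq]
  refine isDisjointUnion_annularComp.attainsLevel_colourChain
    (fun c c' => c'.time_lt.trans_le (Nat.le_add_right _ _)) compatible_leeColour ?_ ?_ ?_
  · change D.leeDifferential (colourChain (_ ∘ outerCrossing D D') (_ ∘ outerPoint D D')) = 0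
    rw [houter, houterColour]
    exact leeDifferential_colourChain compatible_leeColour separating_leeColour
  · change AttainsLevel _ _ (colourChain (_ ∘ outerCrossing D D') (_ ∘ outerPoint D D')) _
    rw [houter, houterColour, ← canonicalCycle_eq]
    exact D.attainsLevel_canonicalCycle t
  · change AttainsLevel _ _ (colourChain (_ ∘ innerCrossing D D') (_ ∘ innerPoint D D')) _
    rw [hinner, hinnerColour]
    exact attainsLevel_innerColour D D' t

end OrientedAnnularDiagram

namespace AttainsLevel

variable {ι : Type*} [Fintype ι] {d : (ι → ℂ) →ₗ[ℂ] (ι → ℂ)} {j : ι → ℝ} {s : ι → ℂ} {a : ℝ}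

theorem exists_eq (h : AttainsLevel d j s a) : ∃ i, j i = a := by
  obtain ⟨x, -, hxs, hxa⟩ := h.1
  obtain ⟨i, hi, hia⟩ := h.exists_le hxs
  exact ⟨i, hia.antisymm (hxa i hi)⟩

theorem of_le_imp_le {i : ι} (h : AttainsLevel d j s (j i)) {j' : ι → ℝ}
    (hj : ∀ i i', j i ≤ j i' → j' i ≤ j' i') : AttainsLevel d j' s (j' i) := by
  obtain ⟨⟨x, hdx, hxs, hx⟩, f, hf, hfd, hfs⟩ := h
  exact ⟨⟨x, hdx, hxs, fun i' hi' => hj _ _ (hx i' hi')⟩, f, fun i' hi' => hj _ _ (hf i' hi'),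
    hfd, hfs⟩

end AttainsLevel

theorem eventually_nonneg_imp_affine_nonneg (b c t : ℝ) :
    ∀ᶠ t₁ in 𝓝[>] t, 0 ≤ b + t₁ * c → ∀ u ∈ Icc t t₁, 0 ≤ b + u * c := by
  rcases le_or_gt 0 (b + t * c) with ht | ht
  · refine Eventually.of_forall fun t₁ ht₁ u hu => ?_
    rcases le_total 0 c with hc | hc
    · exact ht.trans (add_le_add_right (mul_le_mul_of_nonneg_right hu.1 hc) b)
    · exact ht₁.trans (add_le_add_right (mul_le_mul_of_nonpos_right hu.2 hc) b)
  · have hcont : Tendsto (fun u => b + u * c) (𝓝[>] t) (𝓝 (b + t * c)) :=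
      tendsto_nhdsWithin_of_tendsto_nhds (Continuous.tendsto (by fun_prop) t)
    exact (hcont.eventually_lt_const ht).mono fun t₁ hlt hle => (hle.not_gt hlt).elim

namespace OrientedAnnularDiagram

variable (D : OrientedAnnularDiagram) (t : ℝ)

theorem eventually_jtGrading_le_imp_le : ∀ᶠ t₁ in 𝓝[>] t, ∀ S S' : D.EnhancedState,
    D.jtGrading t₁ S ≤ D.jtGrading t₁ S' →
      ∀ u ∈ Icc t t₁, D.jtGrading u S ≤ D.jtGrading u S' := by
  have hsub (u : ℝ) (S S' : D.EnhancedState) : D.jtGrading u S ≤ D.jtGrading u S' ↔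
      0 ≤ ((D.jGrading S' : ℝ) - D.jGrading S) + u * ((D.kGrading S : ℝ) - D.kGrading S') := by
    rw [← sub_nonneg, jtGrading, jtGrading]
    ring_nf
  simp only [hsub]
  exact eventually_all.2 fun S => eventually_all.2 fun S' =>
    eventually_nonneg_imp_affine_nonneg _ _ t

theorem exists_annularRasmussen_eq_jtGrading : ∃ S : D.EnhancedState, ∃ t₁ > t,
    ∀ u ∈ Icc t t₁, D.annularRasmussen u = D.jtGrading u S := by
  obtain ⟨t₁, hle, ht⟩ := ((D.eventually_jtGrading_le_imp_le t).and self_mem_nhdsWithin).exists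
  have h := D.attainsLevel_canonicalCycle t₁
  obtain ⟨S, hS⟩ := h.exists_eq
  rw [← hS] at h
  exact ⟨S, t₁, ht, fun u hu =>
    annularRasmussen_eq_of_attainsLevel (h.of_le_imp_le fun S' S'' hle' => hle S' S'' hle' u hu)⟩

theorem exists_hasSlope : ∃ m, D.HasSlope t m := by
  obtain ⟨S, t₁, ht, hS⟩ := D.exists_annularRasmussen_eq_jtGrading t
  refine ⟨-D.kGrading S, tendsto_const_nhds.congr' ?_⟩
  filter_upwards [Ioo_mem_nhdsGT (sub_pos.2 ht)] with ε hε
  have htε : t + ε ∈ Icc t t₁ := ⟨by linarith [hε.1], by linarith [hε.2]⟩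
  rw [hS _ htε, hS t (left_mem_Icc.2 ht.le), jtGrading, jtGrading, eq_div_iff hε.1.ne']
  ring

theorem isGreatest_annularRasmussen : IsGreatest (D.classGradings t) (D.annularRasmussen t) :=
  isGreatest_classGradings_of_attainsLevel (D.attainsLevel_canonicalCycle t)

variable {D D' : OrientedAnnularDiagram} {t : ℝ}

theorem HasSlope.annularComp {m m' : ℝ} (h : D.HasSlope t m) (h' : D'.HasSlope t m') :
    (D.annularComp D').HasSlope t (m + m') := by
  refine (h.add h').congr fun ε => ?_
  rw [annularRasmussen_annularComp, annularRasmussen_annularComp]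
  ring

end OrientedAnnularDiagram

theorem proposition5p11_general (D D' : OrientedAnnularDiagram) (t : ℝ) :
    (IsGreatest (D.classGradings t) (D.annularRasmussen t) ∧
      IsGreatest (D'.classGradings t) (D'.annularRasmussen t) ∧
      IsGreatest ((D.annularComp D').classGradings t) ((D.annularComp D').annularRasmussen t) ∧
      (D.annularComp D').annularRasmussen t = D.annularRasmussen t + D'.annularRasmussen t) ∧
    ∃ m m' : ℝ,
      D.HasSlope t m ∧ D'.HasSlope t m' ∧ (D.annularComp D').HasSlope t (m + m') := by
  obtain ⟨m, hm⟩ := D.exists_hasSlope t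
  obtain ⟨m', hm'⟩ := D'.exists_hasSlope t
  exact ⟨⟨D.isGreatest_annularRasmussen t, D'.isGreatest_annularRasmussen t,
    (D.annularComp D').isGreatest_annularRasmussen t, D.annularRasmussen_annularComp D' t⟩,
    m, m', hm, hm', hm.annularComp hm'⟩

theorem proposition5p11 (D D' : OrientedAnnularDiagram) :
    (∀ t ∈ Set.Icc (0 : ℝ) 2,
      IsGreatest (D.classGradings t) (D.annularRasmussen t) ∧
      IsGreatest (D'.classGradings t) (D'.annularRasmussen t) ∧
      IsGreatest ((D.annularComp D').classGradings t) ((D.annularComp D').annularRasmussen t) ∧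
      (D.annularComp D').annularRasmussen t = D.annularRasmussen t + D'.annularRasmussen t) ∧
    (∀ t ∈ Set.Ico (0 : ℝ) 2, ∃ m m' : ℝ,
      D.HasSlope t m ∧ D'.HasSlope t m' ∧ (D.annularComp D').HasSlope t (m + m')) :=
  ⟨fun t _ => (proposition5p11_general D D' t).1, fun t _ => (proposition5p11_general D D' t).2⟩
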